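/- **Theorem 5.3 (Three Balls Inequality, star periodic graphs).** Let $\mathbf v_1,\dots,\mathbf v_d$ be a basis of $\mathbb R^d$, let $\mathcal L=\{\sum_j n_j\mathbf v_j : n\in\mathbb Z^d\}$, let $p_1,\dots,p_s\in\mathbb R^d$ ($s\ge 1$) satisfy $p_i-p_j\notin\mathcal L$ for $i\ne j$, and put $\mathcal V_i=p_i+\mathcal L$, $\mathcal V=\bigcup_{i=1}^s\mathcal V_i$. Let $\Gamma$ be a simple undirected graph with vertex set $\mathcal V$ that is connected, locally finite and $\mathcal L$-periodic (if $x\sim y$ and $\ell\in\mathcal L$ then $x+\ell\sim y+\ell$). Assume that $\Gamma$ is a *star periodic graph*: for every $j\in\{2,\dots,s\}$, every neighbour of a vertex $x\in\mathcal V_j$ belongs to $\mathcal V_1$. For $h>0$ let $h\Gamma$ be the rescaled graph, with vertex set $h\mathcal V$ and $hx\sim hy$ in $h\Gamma$ if and only if $x\sim y$ in $\Gamma$. For $V,u:h\mathcal V\to\mathbb R$ let $$\Delta_{h\Gamma}u(x)=\sum_{y\sim x}\bigl(u(y)-u(x)\bigr),\qquad H_hu(x)=h^{-2}\Delta_{h\Gamma}u(x)+V(x)u(x),\qquad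 x\in h\mathcal V .$$ Let $e_1,\dots,e_k$ be vectors spanning $\mathbb R^d$, let $E$ be the $k\times d$ matrix with rows $e_1,\dots,e_k$, and let $$|x|=\sqrt{x^{*}(E^{*}E)^{-1}x},\qquad B_r=\{x\in\mathbb R^d:|x|\le r\},\qquad \|u\|_{\ell^2(B_r)}=\Bigl(\sum_{x\in h\mathcal V\cap B_r}|u(x)|^2\Bigr)^{1/2}.$$ Let $M\ge 0$. Then the following hold, with constants depending only on $\Gamma$, $e_1,\dots,e_k$ and $M$. 1. There exist $h_0,\delta_0\in(0,1)$, $c_1,c_2>0$, $\tau_0>1$ and $C>0$ such that for all $h\in(0,h_0)$, all $\tau\in(\tau_0,\delta_0h^{-1})$, all $V:h\mathcal V\to\mathbb R$ with $\sup|V|\le M$ and all $u:h\mathcal V\to\mathbb R$ with $H_hu=0$ on $h\mathcal V\cap B_4$, $$\|u\|_{\ell^2(B_1)}\le C\left(e^{c_1\tau}\|u\|_{\ell^2(B_{1/2})}+e^{-c_2\tau}\|u\|_{\ell^2(B_2)}\right).$$ 2. There exist $\alpha\in(0,1)$, $c_0>0$, $h_0\in(0,1)$ and $D>1$ such that for all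 $h\in(0,h_0)$, all $V:h\mathcal V\to\mathbb R$ with $\sup|V|\le M$ and all $u:h\mathcal V\to\mathbb R$ with $H_hu=0$ on $h\mathcal V\cap B_4$, $$\|u\|_{\ell^2(B_1)}\le D\left(\|u\|_{\ell^2(B_{1/2})}^{\alpha}\,\|u\|_{\ell^2(B_2)}^{1-\alpha}+e^{-c_0h^{-1}}\|u\|_{\ell^2(B_2)}\right).$$ -/

import Mathlib

/-- The lattice `{∑ j, n j • v j | n ∈ ℤ^d}` generated by a basis `v` of `ℝ^d`. -/
def latticeOf {d : ℕ} (v : Module.Basis (Fin d) ℝ (Fin d → ℝ)) :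
    Submodule ℤ (Fin d → ℝ) :=
  Submodule.span ℤ (Set.range v)

/-- The translate `q + 𝓛` of the lattice generated by `v`. -/
def latticeCoset {d : ℕ} (v : Module.Basis (Fin d) ℝ (Fin d → ℝ)) (q : Fin d → ℝ) :
    Set (Fin d → ℝ) :=
  {x | ∃ l ∈ latticeOf v, x = q + l}

/-- A locally finite `d`-dimensional `s`-point periodic graph `Γ` (mesh size `1`), realised on
points of `ℝ^d`. The normalisation `p₁ = 0` is not imposed. -/
structure PeriodicGraph (d s : ℕ) where
  /-- the basis generating the lattice `𝓛` -/
  v : Module.Basis (Fin d) ℝ (Fin d → ℝ)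
  /-- the base points `p₁, …, p_s` -/
  p : Fin s → (Fin d → ℝ)
  p_sub_notMem : ∀ i j, i ≠ j → p i - p j ∉ latticeOf v
  /-- the (undirected) edge relation, on points of `ℝ^d` -/
  graph : SimpleGraph (Fin d → ℝ)
  /-- edges join vertices, i.e. points of `⋃ i, (p i + 𝓛)` -/
  mem_of_adj : ∀ x y, graph.Adj x y → x ∈ ⋃ i, latticeCoset v (p i)
  /-- edges are invariant under translation by the lattice -/
  periodic : ∀ x y, graph.Adj x y → ∀ l ∈ latticeOf v, graph.Adj (x + l) (y + l)
  locallyFinite : ∀ x, (graph.neighborSet x).Finite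
  connected : (graph.induce (⋃ i, latticeCoset v (p i))).Connected

namespace PeriodicGraph

/-- The sublattice `𝓥_i = p_i + 𝓛` of vertices. -/
def sublattice {d s : ℕ} (Γ : PeriodicGraph d s) (i : Fin s) : Set (Fin d → ℝ) :=
  latticeCoset Γ.v (Γ.p i)

/-- The vertex set `𝓥 = ⋃ i, 𝓥_i`. -/
def verts {d s : ℕ} (Γ : PeriodicGraph d s) : Set (Fin d → ℝ) :=
  ⋃ i, Γ.sublattice i

/-- `Γ` is a star periodic graph: every neighbour of a vertex outside the first sublattice
(which has index `0` here) lies in the first sublattice. -/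
def IsStar {d s : ℕ} [NeZero s] (Γ : PeriodicGraph d s) : Prop :=
  ∀ j : Fin s, j ≠ 0 → ∀ x ∈ Γ.sublattice j, ∀ y, Γ.graph.Adj x y → y ∈ Γ.sublattice 0

/-- The vertex set `h𝓥` of the rescaled graph `hΓ`. -/
def meshVerts {d s : ℕ} (Γ : PeriodicGraph d s) (h : ℝ) : Set (Fin d → ℝ) :=
  (fun a => h • a) '' Γ.verts

/-- The rescaled graph `hΓ` on the vertex set `h𝓥` (used for `h ≠ 0`): `x ∼ y` in `hΓ` if and only
if `h⁻¹ x ∼ h⁻¹ y` in `Γ`. -/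
noncomputable def mesh {d s : ℕ} (Γ : PeriodicGraph d s) (h : ℝ) : SimpleGraph (Γ.meshVerts h) :=
  Γ.graph.comap (fun x => h⁻¹ • (x : Fin d → ℝ))

/-- The graph Laplacian `Δ_{hΓ} u (x) = ∑_{y ∼ x} (u y - u x)`; the sum has finitely many terms. -/
noncomputable def laplacian {d s : ℕ} (Γ : PeriodicGraph d s) (h : ℝ)
    (u : Γ.meshVerts h → ℝ) (x : Γ.meshVerts h) : ℝ :=
  ∑ᶠ y ∈ (Γ.mesh h).neighborSet x, (u y - u x)

/-- The discrete Schrödinger operator `H_h u = h⁻² Δ_{hΓ} u + V u`. -/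
noncomputable def schrodinger {d s : ℕ} (Γ : PeriodicGraph d s) (h : ℝ)
    (V u : Γ.meshVerts h → ℝ) (x : Γ.meshVerts h) : ℝ :=
  (h ^ 2)⁻¹ * Γ.laplacian h u x + V x * u x

end PeriodicGraph

/-- The norm `√(xᵀ (EᵀE)⁻¹ x)` on `ℝ^d` attached to the family of vectors `e_1, …, e_k` which are
the rows of the `k × d` matrix `E` (these vectors are taken to span `ℝ^d`). -/
noncomputable def gramNorm {d k : ℕ} (E : Matrix (Fin k) (Fin d) ℝ) (x : Fin d → ℝ) : ℝ :=
  Real.sqrt (x ⬝ᵥ (Matrix.mulVec (E.transpose * E)⁻¹ x))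

/-- The closed ball `B_r = {x | |x| ≤ r}` of the norm attached to `E`. -/
def gramBall {d k : ℕ} (E : Matrix (Fin k) (Fin d) ℝ) (r : ℝ) : Set (Fin d → ℝ) :=
  {x | gramNorm E x ≤ r}

/-- The norm `‖u‖_{ℓ²(B)} = (∑_{x ∈ h𝓥 ∩ B} |u x|²)^{1/2}`; it is applied to balls `B`, for which
the sum has finitely many terms. -/
noncomputable def ell2Norm {d s : ℕ} (Γ : PeriodicGraph d s) (h : ℝ)
    (u : Γ.meshVerts h → ℝ) (B : Set (Fin d → ℝ)) : ℝ :=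
  Real.sqrt (∑ᶠ x ∈ {x : Γ.meshVerts h | (x : Fin d → ℝ) ∈ B}, |u x| ^ 2)

/-! The estimate is a Carleman inequality on a single lattice coset, reached by eliminating all
vertices outside the first sublattice. In a star graph a vertex y outside that sublattice has all
its neighbours inside it, and the equation at y says that U y is the mean of the neighbouring values
up to O(h²)|U y|. Substituting this into the equation at a vertex x of the first sublattice (a Schur
complement) leaves a translation invariant weighted Laplacian of finite range, `reducedStencil`, for
which the restricted solution w satisfies |lap w x| ≤ A h² ∑ |w (x + e)| (`IsStar.abs_lap_le`).
Connectedness makes the steps of positive weight span ℝ^d, so their second moment form is positive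
definite (`IsStar.exists_moment_bound`); this is the ellipticity. The map `gramMap` turns the given
norm into a Euclidean one.

For such a Laplacian put g = exp(θ) f with θ x = τ φ(h T x) and φ y = exp(-lam ‖y‖²). Conjugation by
exp θ gives A - K with A symmetric and K skew, so the squared norm is ‖A g‖² + ‖K g‖² - 2⟨A g, K g⟩.
The last term has an exact expression (`two_mul_sum_symmOff_mul_skew`) whose leading coefficient is
τ h² times the Hessian of φ. Its rank-one part contributes a square; its negative part costs a sum
of squared differences of g. These are recovered by testing A g against κ g with κ of size τ h² φ.
After polarisation the coefficient of g² is τ³h⁴ times a quantity bounded below by 4 lam³ φ³ m (4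
lam m - const), where m is the second moment form at h T x; it is positive for large lam as long as
h T x stays away from the origin. All errors are small relative to these terms when h ≤ ε, τ h ≤ ε
and 1 ≤ ε τ. This yields `Stencil.exists_carleman`.

The three balls inequality follows by applying the Carleman estimate to a solution cut off to an
annulus. The cutoff errors live in a small ball and in an outer annulus, and the Caccioppoli
inequality bounds them by ℓ² masses. Since the weight is radially decreasing, the outer error
carries an exponentially smaller factor than the middle region. The Hölder form is obtained by
optimising in τ (`exists_holder_of_forall_exp`). -/

open scoped RealInnerProductSpace

/-! ### Symmetric stencils and the conjugated Laplacian. -/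

/-- A finite symmetric stencil on an additive group: steps `e` with weights `wt e = wt (-e) ≥ 0`. -/
structure Stencil (G : Type*) [AddCommGroup G] where
  steps : Finset G
  wt : G → ℝ
  neg_mem : ∀ e ∈ steps, -e ∈ steps
  wt_neg : ∀ e, wt (-e) = wt e
  wt_nonneg : ∀ e, 0 ≤ wt e

/-- `Ω` stands in for the whole group: once it contains the support of `k` and the translate of that
support by `-c`, both sums are full sums, and these are translation invariant. -/
theorem sum_shift {G : Type*} [AddCommGroup G] (Ω : Finset G) (k : G → ℝ) (c : G)
    (h1 : ∀ x, k x ≠ 0 → x ∈ Ω) (h2 : ∀ x, k x ≠ 0 → x - c ∈ Ω) :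
    ∑ x ∈ Ω, k (x + c) = ∑ x ∈ Ω, k x := by
  rw [← finsum_eq_sum_of_support_subset k (s := Ω) (fun x hx => by simpa using h1 x hx),
    ← finsum_eq_sum_of_support_subset (fun x => k (x + c)) (s := Ω)
      (fun x hx => by simpa using h2 (x + c) hx)]
  exact finsum_comp_equiv (f := k) (Equiv.addRight c)

namespace Stencil

variable {G : Type*} [AddCommGroup G] (S : Stencil G)

theorem sum_neg (k : G → ℝ) : ∑ e ∈ S.steps, k (-e) = ∑ e ∈ S.steps, k e :=
  Finset.sum_nbij' (fun e => -e) (fun e => -e) (S.neg_mem) (S.neg_mem) (by simp) (by simp) (by simp)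

theorem sum_odd (k : G → ℝ) (hk : ∀ e, k (-e) = -k e) : ∑ e ∈ S.steps, S.wt e * k e = 0 := by
  have h := S.sum_neg (fun e => S.wt e * k e)
  simp only [S.wt_neg, hk, mul_neg, Finset.sum_neg_distrib] at h
  linarith

/-- The weighted Laplacian of a stencil. -/
def lap (f : G → ℝ) (x : G) : ℝ := ∑ e ∈ S.steps, S.wt e * (f (x + e) - f x)

/-- `Ω` contains the support of `g` and all points reached from it by one step. -/
def Covers (g : G → ℝ) (Ω : Finset G) : Prop :=
  ∀ x, g x ≠ 0 → x ∈ Ω ∧ ∀ e ∈ S.steps, x + e ∈ Ω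

variable {S}

theorem Covers.sub_mem {g : G → ℝ} {Ω : Finset G} (h : S.Covers g Ω) {x : G} (hx : g x ≠ 0)
    {e : G} (he : e ∈ S.steps) : x - e ∈ Ω := by
  rw [sub_eq_add_neg]; exact (h x hx).2 _ (S.neg_mem e he)

variable (S)

/-- The skew part of the Laplacian conjugated by `exp θ`. -/
noncomputable def skew (θ g : G → ℝ) (x : G) : ℝ :=
  ∑ e ∈ S.steps, S.wt e * (Real.sinh (θ (x + e) - θ x) * g (x + e))

/-- The off-diagonal symmetric part of the Laplacian conjugated by `exp θ`. -/
noncomputable def symmOff (θ g : G → ℝ) (x : G) : ℝ :=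
  ∑ e ∈ S.steps, S.wt e * (Real.cosh (θ (x + e) - θ x) * g (x + e))

/-- The total weight. -/
def total : ℝ := ∑ e ∈ S.steps, S.wt e

theorem total_nonneg : 0 ≤ S.total := Finset.sum_nonneg fun e _ => S.wt_nonneg e

/-- The mixed second difference. -/
def mixed (θ : G → ℝ) (e e' x : G) : ℝ := θ (x + e + e') - θ (x + e) - θ (x + e') + θ x

variable {S}

/-- Replacing `e` by `-e` and translating exchanges `x` and `x + e`; as sinh is odd, the operator is
antisymmetric. -/
theorem sum_mul_skew {θ g : G → ℝ} {Ω : Finset G} (h : S.Covers g Ω) :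
    ∑ x ∈ Ω, g x * S.skew θ g x = 0 := by
  have h1 : ∑ x ∈ Ω, g x * S.skew θ g x =
      ∑ e ∈ S.steps, S.wt e * ∑ x ∈ Ω, Real.sinh (θ (x + e) - θ x) * g (x + e) * g x := by
    simp only [skew, Finset.mul_sum]
    rw [Finset.sum_comm]
    exact Finset.sum_congr rfl fun e _ => Finset.sum_congr rfl fun x _ => by ring
  have h2 : ∑ e ∈ S.steps, S.wt e * ∑ x ∈ Ω, Real.sinh (θ (x + e) - θ x) * g (x + e) * g x =
      -∑ e ∈ S.steps, S.wt e * ∑ x ∈ Ω, Real.sinh (θ (x + e) - θ x) * g (x + e) * g x := by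
    conv_lhs => rw [← S.sum_neg]
    rw [← Finset.sum_neg_distrib]
    refine Finset.sum_congr rfl fun e he => ?_
    rw [S.wt_neg, ← mul_neg]
    congr 1
    rw [← sum_shift Ω _ e, ← Finset.sum_neg_distrib]
    · refine Finset.sum_congr rfl fun x _ => ?_
      rw [add_neg_cancel_right, ← neg_sub, Real.sinh_neg]; ring
    · intro x hx; exact (h x (right_ne_zero_of_mul hx)).1
    · intro x hx; exact h.sub_mem (right_ne_zero_of_mul hx) he
  rw [h1]; linarith

/-- Symmetrised in `e, e'`, the product of sinh and cosh is the sinh of a sum of two increments.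
Reflecting both steps and translating by `e + e'` gives the same sum seen from the opposite corner
of the parallelogram. Averaging the two expressions leaves the mixed difference alone inside the
sinh. This is the discrete commutator, which vanishes when `θ` is affine. -/
theorem two_mul_sum_symmOff_mul_skew {θ g : G → ℝ} {Ω : Finset G} (h : S.Covers g Ω) :
    2 * ∑ x ∈ Ω, S.symmOff θ g x * S.skew θ g x =
      -∑ x ∈ Ω, ∑ e ∈ S.steps, ∑ e' ∈ S.steps, S.wt e * S.wt e' *
        (Real.sinh (mixed θ e e' x) * Real.cosh (θ (x + e + e') - θ x) *
          (g (x + e) * g (x + e'))) := by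
  set J := ∑ e ∈ S.steps, ∑ e' ∈ S.steps, S.wt e * S.wt e' * ∑ x ∈ Ω,
    Real.sinh (θ (x + e) + θ (x + e') - 2 * θ x) * (g (x + e) * g (x + e')) with hJ
  have h1 : 2 * ∑ x ∈ Ω, S.symmOff θ g x * S.skew θ g x = J := by
    have : ∀ x, 2 * (S.symmOff θ g x * S.skew θ g x) = ∑ e ∈ S.steps, ∑ e' ∈ S.steps,
        S.wt e * S.wt e' *
          (Real.sinh (θ (x + e) + θ (x + e') - 2 * θ x) * (g (x + e) * g (x + e'))) := by
      intro x
      rw [two_mul]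
      nth_rewrite 2 [mul_comm]
      simp only [symmOff, skew, Finset.sum_mul_sum]
      rw [← Finset.sum_add_distrib]
      refine Finset.sum_congr rfl fun e _ => ?_
      rw [← Finset.sum_add_distrib]
      refine Finset.sum_congr rfl fun e' _ => ?_
      have : θ (x + e) + θ (x + e') - 2 * θ x = (θ (x + e) - θ x) + (θ (x + e') - θ x) := by ring
      rw [this, Real.sinh_add]; ring
    rw [Finset.mul_sum, Finset.sum_congr rfl fun x _ => this x, Finset.sum_comm, hJ]
    refine Finset.sum_congr rfl fun e _ => ?_
    rw [Finset.sum_comm]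
    exact Finset.sum_congr rfl fun e' _ => by rw [Finset.mul_sum]
  have h2 : J = ∑ e ∈ S.steps, ∑ e' ∈ S.steps, S.wt e * S.wt e' * ∑ x ∈ Ω,
      Real.sinh (θ (x + e) + θ (x + e') - 2 * θ (x + e + e')) * (g (x + e) * g (x + e')) := by
    rw [hJ, ← S.sum_neg]
    refine Finset.sum_congr rfl fun e he => ?_
    rw [← S.sum_neg]
    refine Finset.sum_congr rfl fun e' he' => ?_
    rw [S.wt_neg, S.wt_neg]
    congr 1
    rw [← sum_shift Ω _ (e + e')]
    · refine Finset.sum_congr rfl fun x _ => ?_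
      have a1 : x + (e + e') + -e = x + e' := by abel
      have a2 : x + (e + e') + -e' = x + e := by abel
      rw [a1, a2, ← add_assoc, add_comm (θ (x + e')), mul_comm (g (x + e'))]
    · intro x hx
      have := (h _ (left_ne_zero_of_mul (right_ne_zero_of_mul hx))).2 e he
      simpa using this
    · intro x hx
      have := h.sub_mem (left_ne_zero_of_mul (right_ne_zero_of_mul hx)) he'
      convert this using 1; abel
  have h3 : 2 * J = 2 * -∑ x ∈ Ω, ∑ e ∈ S.steps, ∑ e' ∈ S.steps, S.wt e * S.wt e' *
        (Real.sinh (mixed θ e e' x) * Real.cosh (θ (x + e + e') - θ x) *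
          (g (x + e) * g (x + e'))) := by
    rw [two_mul]
    nth_rewrite 2 [h2]
    rw [hJ, Finset.sum_comm (s := Ω), ← Finset.sum_add_distrib, ← Finset.sum_neg_distrib,
      Finset.mul_sum]
    refine Finset.sum_congr rfl fun e _ => ?_
    rw [Finset.sum_comm (s := Ω), ← Finset.sum_add_distrib, ← Finset.sum_neg_distrib,
      Finset.mul_sum]
    refine Finset.sum_congr rfl fun e' _ => ?_
    rw [← mul_add, ← Finset.sum_add_distrib, ← Finset.sum_neg_distrib, Finset.mul_sum,
      Finset.mul_sum]
    refine Finset.sum_congr rfl fun x _ => ?_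
    have e1 : θ (x + e) + θ (x + e') - 2 * θ x =
      -(mixed θ e e' x) + (θ (x + e + e') - θ x) := by unfold mixed; ring
    have e2 : θ (x + e) + θ (x + e') - 2 * θ (x + e + e') =
      -(mixed θ e e' x) - (θ (x + e + e') - θ x) := by unfold mixed; ring
    rw [e1, e2]
    generalize θ (x + e + e') - θ x = η
    rw [Real.sinh_add, Real.sinh_sub, Real.sinh_neg, Real.cosh_neg]; ring
  rw [h1]; linarith

/-- Polarisation of a quadratic form in shifted values into its diagonal part and differences. -/
theorem sum_quadratic_eq {g : G → ℝ} {Ω : Finset G} (h : S.Covers g Ω) (R : G → G → G → ℝ)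
    (hR : ∀ e e' x, R e e' x = R e' e x) :
    ∑ x ∈ Ω, ∑ e ∈ S.steps, ∑ e' ∈ S.steps, S.wt e * S.wt e' *
        (R e e' x * (g (x + e) * g (x + e'))) =
      ∑ x ∈ Ω, (∑ e ∈ S.steps, ∑ e' ∈ S.steps, S.wt e * S.wt e' * R (-e) e' (x + e)) * g x ^ 2 -
      2⁻¹ * ∑ x ∈ Ω, ∑ e ∈ S.steps, ∑ e' ∈ S.steps, S.wt e * S.wt e' *
        (R e e' x * (g (x + e) - g (x + e')) ^ 2) := by
  set D := ∑ x ∈ Ω, ∑ e ∈ S.steps, ∑ e' ∈ S.steps, S.wt e * S.wt e' *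
        (R e e' x * g (x + e) ^ 2) with hD
  -- The square of `g (x + e)` is recentred at `x` by a reflection of `e` and a translation, which
  -- is why `R` appears with arguments `-e`, `e'`, `x + e`.
  have h1 : ∑ x ∈ Ω, (∑ e ∈ S.steps, ∑ e' ∈ S.steps, S.wt e * S.wt e' * R (-e) e' (x + e)) * g x ^ 2
      = D := by
    simp only [Finset.sum_mul, hD]
    rw [Finset.sum_comm, Finset.sum_comm (s := Ω), ← S.sum_neg (fun e => ∑ x ∈ Ω, _)]
    refine Finset.sum_congr rfl fun e he => ?_
    rw [Finset.sum_comm, Finset.sum_comm (s := Ω)]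
    refine Finset.sum_congr rfl fun e' _ => ?_
    rw [← sum_shift Ω _ e]
    · refine Finset.sum_congr rfl fun x _ => ?_
      rw [S.wt_neg, add_neg_cancel_right, neg_neg]; ring
    · intro x hx
      exact (h x (by rintro h0; simp [h0] at hx)).1
    · intro x hx
      exact h.sub_mem (by rintro h0; simp [h0] at hx) he
  have h2 : ∑ x ∈ Ω, ∑ e ∈ S.steps, ∑ e' ∈ S.steps, S.wt e * S.wt e' *
        (R e e' x * g (x + e') ^ 2) = D := by
    refine Finset.sum_congr rfl fun x _ => ?_
    rw [Finset.sum_comm]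
    refine Finset.sum_congr rfl fun e _ => Finset.sum_congr rfl fun e' _ => ?_
    rw [hR e' e, mul_comm (S.wt e')]
  have h3 : ∑ x ∈ Ω, ∑ e ∈ S.steps, ∑ e' ∈ S.steps, S.wt e * S.wt e' *
        (R e e' x * (g (x + e) - g (x + e')) ^ 2) = D + ∑ x ∈ Ω, ∑ e ∈ S.steps, ∑ e' ∈ S.steps,
        S.wt e * S.wt e' * (R e e' x * g (x + e') ^ 2) - 2 * ∑ x ∈ Ω, ∑ e ∈ S.steps,
        ∑ e' ∈ S.steps, S.wt e * S.wt e' * (R e e' x * (g (x + e) * g (x + e'))) := by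
    simp only [hD, Finset.mul_sum, ← Finset.sum_add_distrib, ← Finset.sum_sub_distrib]
    refine Finset.sum_congr rfl fun x _ => Finset.sum_congr rfl fun e _ =>
      Finset.sum_congr rfl fun e' _ => ?_
    ring
  rw [h1, h3, h2]; ring

/-- The symmetric part of the conjugated Laplacian, tested against a multiple of the function. -/
theorem sum_symm_mul_eq {θ g κ : G → ℝ} {Ω : Finset G} (h : S.Covers g Ω) :
    2 * ∑ x ∈ Ω, (S.symmOff θ g x - S.total * g x) * (κ x * g x) =
      ∑ x ∈ Ω, (∑ e ∈ S.steps, S.wt e *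
        ((Real.cosh (θ (x + e) - θ x) - 1) * (κ x + κ (x + e)) + (κ (x + e) - κ x))) * g x ^ 2 -
      ∑ x ∈ Ω, κ x * ∑ e ∈ S.steps, S.wt e *
        (Real.cosh (θ (x + e) - θ x) * (g (x + e) - g x) ^ 2) := by
  have h1 : ∑ x ∈ Ω, ∑ e ∈ S.steps, S.wt e * (Real.cosh (θ (x + e) - θ x) * κ x * g (x + e) ^ 2) =
      ∑ x ∈ Ω, ∑ e ∈ S.steps, S.wt e * (Real.cosh (θ (x + e) - θ x) * κ (x + e) * g x ^ 2) := by
    rw [Finset.sum_comm, Finset.sum_comm (s := Ω), ← S.sum_neg]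
    refine Finset.sum_congr rfl fun e he => ?_
    rw [← sum_shift Ω _ e]
    · refine Finset.sum_congr rfl fun x _ => ?_
      rw [S.wt_neg, add_neg_cancel_right, ← Real.cosh_neg, neg_sub]
    · intro x hx
      have := (h (x + -e) (by rintro h0; simp [h0] at hx)).2 e he
      simpa using this
    · intro x hx
      have := (h (x + -e) (by rintro h0; simp [h0] at hx)).1
      rwa [sub_eq_add_neg]
  have h2 : ∀ x, 2 * ((S.symmOff θ g x - S.total * g x) * (κ x * g x)) =
      (∑ e ∈ S.steps, S.wt e *
        ((Real.cosh (θ (x + e) - θ x) - 1) * (κ x + κ (x + e)) + (κ (x + e) - κ x))) * g x ^ 2 -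
      (κ x * ∑ e ∈ S.steps, S.wt e * (Real.cosh (θ (x + e) - θ x) * (g (x + e) - g x) ^ 2)) +
      (∑ e ∈ S.steps, S.wt e * (Real.cosh (θ (x + e) - θ x) * κ x * g (x + e) ^ 2) -
        ∑ e ∈ S.steps, S.wt e * (Real.cosh (θ (x + e) - θ x) * κ (x + e) * g x ^ 2)) := by
    intro x
    simp only [symmOff, total, Finset.mul_sum, Finset.sum_mul, ← Finset.sum_add_distrib,
      ← Finset.sum_sub_distrib]
    exact Finset.sum_congr rfl fun e _ => by ring
  rw [Finset.mul_sum, Finset.sum_congr rfl fun x _ => h2 x, Finset.sum_add_distrib,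
    Finset.sum_sub_distrib, Finset.sum_sub_distrib, h1]
  ring

/-- The conjugation factor is exp(-t) = cosh t - sinh t, where t is the increment of `θ` along the
step; its even part is symmetric and its odd part skew. -/
theorem exp_mul_lap (θ f : G → ℝ) (x : G) :
    Real.exp (θ x) * S.lap f x =
      (S.symmOff θ (fun z => Real.exp (θ z) * f z) x - S.total * (Real.exp (θ x) * f x)) -
        S.skew θ (fun z => Real.exp (θ z) * f z) x := by
  simp only [lap, symmOff, skew, total, Finset.mul_sum, Finset.sum_mul, ← Finset.sum_sub_distrib]
  refine Finset.sum_congr rfl fun e _ => ?_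
  have : Real.exp (θ x) * f (x + e) = (Real.cosh (θ (x + e) - θ x) - Real.sinh (θ (x + e) - θ x)) *
      (Real.exp (θ (x + e)) * f (x + e)) := by
    rw [Real.cosh_sub_sinh, ← mul_assoc, ← Real.exp_add]; congr 2; ring
  linear_combination (S.wt e) * this

/-- A lower bound for the conjugated Laplacian: the sum of the squares of the symmetric part and the
commutator, the former estimated from below by its pairing with `κ g`. -/
theorem sum_sq_exp_mul_lap_ge {θ f κ : G → ℝ} {Ω : Finset G}
    (h : S.Covers f Ω) :
    ∑ x ∈ Ω, ∑ e ∈ S.steps, ∑ e' ∈ S.steps, S.wt e * S.wt e' *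
        (Real.sinh (mixed θ e e' x) * Real.cosh (θ (x + e + e') - θ x) *
          ((Real.exp (θ (x + e)) * f (x + e)) * (Real.exp (θ (x + e')) * f (x + e')))) +
      ∑ x ∈ Ω, κ x * ∑ e ∈ S.steps, S.wt e * (Real.cosh (θ (x + e) - θ x) *
        (Real.exp (θ (x + e)) * f (x + e) - Real.exp (θ x) * f x) ^ 2) -
      ∑ x ∈ Ω, (∑ e ∈ S.steps, S.wt e * ((Real.cosh (θ (x + e) - θ x) - 1) * (κ x + κ (x + e)) +
        (κ (x + e) - κ x)) + κ x ^ 2) * (Real.exp (θ x) * f x) ^ 2 ≤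
      ∑ x ∈ Ω, (Real.exp (θ x) * S.lap f x) ^ 2 := by
  set g : G → ℝ := fun z => Real.exp (θ z) * f z with hg
  have hc : S.Covers g Ω := fun x hx => h x (right_ne_zero_of_mul hx)
  have h1 := two_mul_sum_symmOff_mul_skew (θ := θ) hc
  have h2 := sum_symm_mul_eq (θ := θ) (κ := κ) hc
  have h3 := sum_mul_skew (θ := θ) hc
  have h4 : ∑ x ∈ Ω, (-2 * (S.symmOff θ g x * S.skew θ g x) + 2 * S.total * (g x * S.skew θ g x)
      - 2 * ((S.symmOff θ g x - S.total * g x) * (κ x * g x)) - (κ x * g x) ^ 2) ≤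
      ∑ x ∈ Ω, (Real.exp (θ x) * S.lap f x) ^ 2 := by
    refine Finset.sum_le_sum fun x _ => ?_
    rw [exp_mul_lap]
    -- The square of the skew part is dropped; the symmetric part a is bounded through a² ≥ -2 a κ g
    -- - (κ g)².
    nlinarith [sq_nonneg (S.skew θ g x), sq_nonneg (S.symmOff θ g x - S.total * g x + κ x * g x)]
  refine le_trans (le_of_eq ?_) h4
  rw [Finset.sum_sub_distrib, Finset.sum_sub_distrib, Finset.sum_add_distrib, ← Finset.mul_sum,
    ← Finset.mul_sum, ← Finset.mul_sum, h2, h3]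
  have h5 : ∑ x ∈ Ω, (∑ e ∈ S.steps, S.wt e * ((Real.cosh (θ (x + e) - θ x) - 1) *
      (κ x + κ (x + e)) + (κ (x + e) - κ x)) + κ x ^ 2) * g x ^ 2 =
      ∑ x ∈ Ω, (∑ e ∈ S.steps, S.wt e * ((Real.cosh (θ (x + e) - θ x) - 1) *
      (κ x + κ (x + e)) + (κ (x + e) - κ x))) * g x ^ 2 + ∑ x ∈ Ω, (κ x * g x) ^ 2 := by
    rw [← Finset.sum_add_distrib]
    exact Finset.sum_congr rfl fun x _ => by ring
  simp only [hg] at *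
  linarith

end Stencil

/-! ### Finite differences of smooth functions, with bounds uniform on balls. -/

section Taylor

variable {Y : Type*} [NormedAddCommGroup Y] [InnerProductSpace ℝ Y]

/-- The directional derivative of `ψ` along `E`. -/
noncomputable def dirDeriv (E : Y) (ψ : Y → ℝ) (y : Y) : ℝ := fderiv ℝ ψ y E

open scoped ContDiff in
theorem ContDiff.dirDeriv {ψ : Y → ℝ} (hψ : ContDiff ℝ ∞ ψ) (E : Y) :
    ContDiff ℝ ∞ (dirDeriv E ψ) :=
  (hψ.fderiv_right (m := ∞) (by simp)).clm_apply contDiff_const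

open scoped ContDiff in
theorem hasDerivAt_line {ψ : Y → ℝ} (hψ : ContDiff ℝ ∞ ψ) (y E : Y) (t : ℝ) :
    HasDerivAt (fun t : ℝ => ψ (y + t • E)) (dirDeriv E ψ (y + t • E)) t := by
  have h1 : HasFDerivAt ψ (fderiv ℝ ψ (y + t • E)) (y + t • E) :=
    (hψ.differentiable (by simp) _).hasFDerivAt
  have h2 : HasDerivAt (fun t : ℝ => y + t • E) E t := by
    simpa using ((hasDerivAt_id t).smul_const E).const_add y
  exact h1.comp_hasDerivAt t h2

open scoped ContDiff in
theorem dirDeriv_add_const_sub {ψ : Y → ℝ} (hψ : ContDiff ℝ ∞ ψ) (E c : Y) (y : Y) :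
    dirDeriv E (fun z => ψ (z + c) - ψ z) y = dirDeriv E ψ (y + c) - dirDeriv E ψ y := by
  have hd : Differentiable ℝ ψ := hψ.differentiable (by simp)
  have hd' : DifferentiableAt ℝ (fun z => ψ (z + c)) y :=
    (hd _).comp y (differentiableAt_id.add_const c)
  simp only [dirDeriv]
  rw [fderiv_fun_sub hd' (hd y), fderiv_comp_add_right]
  simp

open scoped ContDiff in
theorem ContDiff.add_const_sub {ψ : Y → ℝ} (hψ : ContDiff ℝ ∞ ψ) (c : Y) :
    ContDiff ℝ ∞ (fun z => ψ (z + c) - ψ z) :=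
  (hψ.comp (contDiff_id.add contDiff_const)).sub hψ

open scoped ContDiff in
theorem abs_sub_le_of_dirDeriv {ψ : Y → ℝ} (hψ : ContDiff ℝ ∞ ψ) {y E : Y} {h M : ℝ} (hh : 0 ≤ h)
    (hM : ∀ s ∈ Set.Icc 0 h, |dirDeriv E ψ (y + s • E)| ≤ M) :
    |ψ (y + h • E) - ψ y| ≤ M * h := by
  have := norm_image_sub_le_of_norm_deriv_le_segment' (f := fun t : ℝ => ψ (y + t • E))
    (f' := fun t => dirDeriv E ψ (y + t • E)) (a := 0) (b := h) (C := M)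
    (fun t _ => (hasDerivAt_line hψ y E t).hasDerivWithinAt)
    (fun t ht => hM t (Set.Ico_subset_Icc_self ht)) h (Set.right_mem_Icc.2 hh)
  simpa using this

open scoped ContDiff in
theorem abs_sub_sub_le_of_dirDeriv {ψ : Y → ℝ} (hψ : ContDiff ℝ ∞ ψ) {y E : Y} {h M : ℝ}
    (hh : 0 ≤ h) (hM : ∀ s ∈ Set.Icc 0 h, |dirDeriv E (dirDeriv E ψ) (y + s • E)| ≤ M) :
    |ψ (y + h • E) - ψ y - h * dirDeriv E ψ y| ≤ M * h ^ 2 := by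
  have hM0 : 0 ≤ M := (abs_nonneg _).trans (hM 0 ⟨le_rfl, hh⟩)
  have := norm_image_sub_le_of_norm_deriv_le_segment'
    (f := fun t : ℝ => ψ (y + t • E) - t * dirDeriv E ψ y)
    (f' := fun t => dirDeriv E ψ (y + t • E) - dirDeriv E ψ y) (a := 0) (b := h) (C := M * h)
    (fun t _ => by
      have := (hasDerivAt_line hψ y E t).sub ((hasDerivAt_id t).mul_const (dirDeriv E ψ y))
      simp only [one_mul] at this
      exact this.hasDerivWithinAt)
    (fun t ht => by
      have h1 := abs_sub_le_of_dirDeriv (hψ.dirDeriv E) (y := y) (E := E) ht.1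
        (fun s hs => hM s ⟨hs.1, hs.2.trans ht.2.le⟩)
      exact h1.trans (mul_le_mul_of_nonneg_left ht.2.le hM0)) h (Set.right_mem_Icc.2 hh)
  simp only [zero_smul, add_zero, zero_mul, sub_zero, Real.norm_eq_abs] at this
  calc _ = |ψ (y + h • E) - h * dirDeriv E ψ y - ψ y| := by congr 1; ring
    _ ≤ _ := this
    _ = _ := by ring

theorem exists_bound_on_ball [FiniteDimensional ℝ Y] {ψ : Y → ℝ} (hψ : Continuous ψ) (R : ℝ) :
    ∃ C, 0 ≤ C ∧ ∀ y, ‖y‖ ≤ R → |ψ y| ≤ C := by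
  have : ProperSpace Y := FiniteDimensional.proper ℝ Y
  obtain ⟨C, hC⟩ := (isCompact_closedBall (0 : Y) R).exists_bound_of_continuousOn hψ.continuousOn
  exact ⟨max C 0, le_max_right _ _, fun y hy =>
    (hC y (by simpa using hy)).trans (le_max_left _ _)⟩

theorem norm_add_smul_le {y E : Y} {R s h : ℝ} (hy : ‖y‖ ≤ R) (hs : s ∈ Set.Icc 0 h) (hh : h ≤ 1) :
    ‖y + s • E‖ ≤ R + ‖E‖ := by
  refine (norm_add_le _ _).trans (add_le_add hy ?_)
  rw [norm_smul, Real.norm_of_nonneg hs.1]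
  exact mul_le_of_le_one_left (norm_nonneg _) (hs.2.trans hh)

open scoped ContDiff in
theorem exists_first_diff_bound [FiniteDimensional ℝ Y] {ψ : Y → ℝ} (hψ : ContDiff ℝ ∞ ψ) (R : ℝ) (E : Y) :
    ∃ C, 0 ≤ C ∧ ∀ y, ‖y‖ ≤ R → ∀ h ∈ Set.Icc (0 : ℝ) 1, |ψ (y + h • E) - ψ y| ≤ C * h := by
  obtain ⟨C, hC0, hC⟩ := exists_bound_on_ball (hψ.dirDeriv E).continuous (R + ‖E‖)
  exact ⟨C, hC0, fun y hy h hh => abs_sub_le_of_dirDeriv hψ hh.1 fun s hs =>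
    hC _ (norm_add_smul_le hy hs hh.2)⟩

open scoped ContDiff in
theorem exists_taylor_bound [FiniteDimensional ℝ Y] {ψ : Y → ℝ} (hψ : ContDiff ℝ ∞ ψ) (R : ℝ) (E : Y) :
    ∃ C, 0 ≤ C ∧ ∀ y, ‖y‖ ≤ R → ∀ h ∈ Set.Icc (0 : ℝ) 1,
      |ψ (y + h • E) - ψ y - h * dirDeriv E ψ y| ≤ C * h ^ 2 := by
  obtain ⟨C, hC0, hC⟩ := exists_bound_on_ball ((hψ.dirDeriv E).dirDeriv E).continuous (R + ‖E‖)
  exact ⟨C, hC0, fun y hy h hh => abs_sub_sub_le_of_dirDeriv hψ hh.1 fun s hs =>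
    hC _ (norm_add_smul_le hy hs hh.2)⟩

-- Second order Taylor expansion along `E` is applied to the increment of `ψ` along `h • E'`. The
-- second derivative of that increment is itself O(h), so the error is O(h³).
open scoped ContDiff in
theorem exists_mixed_bound [FiniteDimensional ℝ Y] {ψ : Y → ℝ} (hψ : ContDiff ℝ ∞ ψ) (R : ℝ) (E E' : Y) :
    ∃ C, 0 ≤ C ∧ ∀ y, ‖y‖ ≤ R → ∀ h ∈ Set.Icc (0 : ℝ) 1,
      |Stencil.mixed ψ (h • E) (h • E') y - h ^ 2 * dirDeriv E' (dirDeriv E ψ) y| ≤ C * h ^ 3 := by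
  obtain ⟨C, hC0, hC⟩ := exists_first_diff_bound ((hψ.dirDeriv E).dirDeriv E) (R + ‖E‖) E'
  obtain ⟨D, hD0, hD⟩ := exists_taylor_bound (hψ.dirDeriv E) R E'
  refine ⟨C + D, by positivity, fun y hy h hh => ?_⟩
  have h1 := abs_sub_sub_le_of_dirDeriv (hψ.add_const_sub (h • E')) (y := y) (E := E) (M := C * h)
    hh.1 (fun s hs => by
      have : dirDeriv E (fun z => ψ (z + h • E') - ψ z) =
          fun z => dirDeriv E ψ (z + h • E') - dirDeriv E ψ z :=
        funext (dirDeriv_add_const_sub hψ E (h • E'))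
      rw [this, dirDeriv_add_const_sub (hψ.dirDeriv E)]
      exact hC _ (norm_add_smul_le hy hs hh.2) h hh)
  rw [dirDeriv_add_const_sub hψ] at h1
  have h2 := hD y hy h hh
  have h3 : |h * (dirDeriv E ψ (y + h • E') - dirDeriv E ψ y - h * dirDeriv E' (dirDeriv E ψ) y)| ≤
      h * (D * h ^ 2) := by
    rw [abs_mul, abs_of_nonneg hh.1]; exact mul_le_mul_of_nonneg_left h2 hh.1
  have h4 : Stencil.mixed ψ (h • E) (h • E') y - h ^ 2 * dirDeriv E' (dirDeriv E ψ) y =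
      (ψ (y + h • E + h • E') - ψ (y + h • E) - (ψ (y + h • E') - ψ y) -
        h * (dirDeriv E ψ (y + h • E') - dirDeriv E ψ y)) +
      h * (dirDeriv E ψ (y + h • E') - dirDeriv E ψ y - h * dirDeriv E' (dirDeriv E ψ) y) := by
    unfold Stencil.mixed; ring
  rw [h4]
  refine (abs_add_le _ _).trans ((add_le_add h1 h3).trans (le_of_eq ?_))
  ring

open scoped ContDiff in
theorem abs_second_diff_le {ψ : Y → ℝ} (hψ : ContDiff ℝ ∞ ψ) {y E : Y} {h M : ℝ}
    (hh : 0 ≤ h) (hM : ∀ s ∈ Set.Icc 0 h, ∀ σ : ℝ, |σ| = 1 →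
      |dirDeriv E (dirDeriv E ψ) (y + s • (σ • E))| ≤ M) :
    |ψ (y + h • E) + ψ (y + -(h • E)) - 2 * ψ y| ≤ 2 * M * h ^ 2 := by
  have h1 := abs_sub_sub_le_of_dirDeriv hψ (y := y) (E := E) hh
    (fun s hs => by simpa using hM s hs 1 (by simp))
  have hneg : ∀ ξ : Y → ℝ, dirDeriv (-E) ξ = fun z => -dirDeriv E ξ z := fun ξ => by
    funext z; simp [dirDeriv]
  have h2 := abs_sub_sub_le_of_dirDeriv hψ (y := y) (E := -E) hh (M := M) (fun s hs => by
    have := hM s hs (-1) (by simp)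
    rw [hneg, hneg]
    beta_reduce
    have h3 : dirDeriv E (fun z => -dirDeriv E ψ z) (y + s • -E) =
        -dirDeriv E (dirDeriv E ψ) (y + s • -E) := by
      rw [dirDeriv, fderiv_fun_neg]; rfl
    rw [h3, neg_neg]
    simpa using this)
  rw [hneg, smul_neg] at h2
  rw [abs_le] at *
  constructor <;> linarith [h1.1, h1.2, h2.1, h2.2]

open scoped ContDiff in
theorem exists_second_diff_bound [FiniteDimensional ℝ Y] {ψ : Y → ℝ} (hψ : ContDiff ℝ ∞ ψ) (R : ℝ) (E : Y) :
    ∃ C, 0 ≤ C ∧ ∀ y, ‖y‖ ≤ R → ∀ h ∈ Set.Icc (0 : ℝ) 1,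
      |ψ (y + h • E) + ψ (y + -(h • E)) - 2 * ψ y| ≤ C * h ^ 2 := by
  obtain ⟨C, hC0, hC⟩ := exists_bound_on_ball ((hψ.dirDeriv E).dirDeriv E).continuous (R + ‖E‖)
  refine ⟨2 * C, by positivity, fun y hy h hh => abs_second_diff_le hψ hh.1 fun s hs σ hσ => ?_⟩
  have := norm_add_smul_le (E := σ • E) hy hs hh.2
  rw [norm_smul, Real.norm_eq_abs, hσ, one_mul] at this
  exact hC _ this

-- The four sign choices add up to a second difference along `E` of a second difference along `E'`.
-- Each contributes a factor h², so the Hessian term of order h² and all terms of order h³ cancel.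
open scoped ContDiff in
theorem exists_fourth_diff_bound [FiniteDimensional ℝ Y] {ψ : Y → ℝ} (hψ : ContDiff ℝ ∞ ψ) (R : ℝ) (E E' : Y) :
    ∃ C, 0 ≤ C ∧ ∀ y, ‖y‖ ≤ R → ∀ h ∈ Set.Icc (0 : ℝ) 1,
      |Stencil.mixed ψ (h • E) (h • E') y + Stencil.mixed ψ (-(h • E)) (h • E') y +
        Stencil.mixed ψ (h • E) (-(h • E')) y + Stencil.mixed ψ (-(h • E)) (-(h • E')) y|
        ≤ C * h ^ 4 := by
  obtain ⟨C, hC0, hC⟩ := exists_second_diff_bound ((hψ.dirDeriv E).dirDeriv E) (R + ‖E‖) E'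
  refine ⟨2 * C, by positivity, fun y hy h hh => ?_⟩
  set c := h • E'
  let χ : Y → ℝ := fun z => (ψ (z + c) - ψ z) + (ψ (z + -c) - ψ z)
  have hχ : ContDiff ℝ ∞ χ := (hψ.add_const_sub c).add (hψ.add_const_sub (-c))
  have hD : ∀ ξ : Y → ℝ, ContDiff ℝ ∞ ξ →
      dirDeriv E (fun z => (ξ (z + c) - ξ z) + (ξ (z + -c) - ξ z)) = fun z =>
        (dirDeriv E ξ (z + c) - dirDeriv E ξ z) + (dirDeriv E ξ (z + -c) - dirDeriv E ξ z) := by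
    intro ξ hξ
    funext z
    rw [← dirDeriv_add_const_sub hξ, ← dirDeriv_add_const_sub hξ]
    simp only [dirDeriv]
    rw [fderiv_fun_add (((hξ.add_const_sub c).differentiable (by simp)) z)
      (((hξ.add_const_sub (-c)).differentiable (by simp)) z)]
    rfl
  have h1 := abs_second_diff_le hχ (y := y) (E := E) (M := C * h ^ 2) hh.1 (fun s hs σ hσ => by
    rw [hD ψ hψ, hD _ (hψ.dirDeriv E)]
    have := norm_add_smul_le (E := σ • E) hy hs hh.2
    rw [norm_smul, Real.norm_eq_abs, hσ, one_mul] at this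
    have := hC _ this h hh
    convert this using 2; simp only [c]; ring)
  have h2 : 2 * C * h ^ 4 = 2 * (C * h ^ 2) * h ^ 2 := by ring
  rw [h2]
  refine le_of_eq_of_le ?_ h1
  simp only [χ, Stencil.mixed]
  congr 1; ring

theorem exists_common_bound {α : Type*} (F : Finset α) (p : α → ℝ → Prop)
    (mono : ∀ e C C', C ≤ C' → p e C → p e C') (h : ∀ e ∈ F, ∃ C, 0 ≤ C ∧ p e C) :
    ∃ C, 0 ≤ C ∧ ∀ e ∈ F, p e C := by
  classical
  induction F using Finset.induction_on with
  | empty => exact ⟨0, le_rfl, by simp⟩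
  | insert b s hb ih =>
    obtain ⟨C, hC0, hC⟩ := ih fun e he => h e (Finset.mem_insert_of_mem he)
    obtain ⟨D, hD0, hD⟩ := h b (Finset.mem_insert_self _ _)
    refine ⟨max C D, hC0.trans (le_max_left _ _), fun e he => ?_⟩
    rcases Finset.mem_insert.1 he with rfl | he
    · exact mono _ _ _ (le_max_right _ _) hD
    · exact mono _ _ _ (le_max_left _ _) (hC e he)

end Taylor

/-! ### The Gaussian weight and its derivatives. -/

section Weight

variable {Y : Type*} [NormedAddCommGroup Y]

/-- The Gaussian weight `exp (-lam ‖y‖²)`. -/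
noncomputable def gaussWeight (lam : ℝ) (y : Y) : ℝ := Real.exp (-lam * ‖y‖ ^ 2)

theorem gaussWeight_pos (lam : ℝ) (y : Y) : 0 < gaussWeight lam y := Real.exp_pos _

theorem gaussWeight_le_one {lam : ℝ} (hl : 0 ≤ lam) (y : Y) : gaussWeight lam y ≤ 1 := by
  rw [gaussWeight, Real.exp_le_one_iff]
  have : 0 ≤ lam * ‖y‖ ^ 2 := by positivity
  linarith

variable [InnerProductSpace ℝ Y]

open scoped ContDiff in
theorem contDiff_gaussWeight (lam : ℝ) : ContDiff ℝ ∞ (gaussWeight lam : Y → ℝ) :=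
  (contDiff_const.mul (contDiff_norm_sq ℝ)).exp

theorem dirDeriv_gaussWeight (lam : ℝ) (E : Y) :
    dirDeriv E (gaussWeight lam : Y → ℝ) = fun y => -2 * lam * ⟪y, E⟫ * gaussWeight lam y := by
  funext y
  have h1 : HasFDerivAt (fun y : Y => -lam * ‖y‖ ^ 2) ((-lam) • (2 • innerSL ℝ y)) y :=
    (hasStrictFDerivAt_norm_sq y).hasFDerivAt.const_mul (-lam)
  have h2 := h1.exp
  rw [dirDeriv, show (gaussWeight lam : Y → ℝ) = fun y => Real.exp (-lam * ‖y‖ ^ 2) from rfl,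
    h2.fderiv]
  simp [innerSL_apply_apply]
  ring

theorem dirDeriv_dirDeriv_gaussWeight (lam : ℝ) (E E' : Y) :
    dirDeriv E' (dirDeriv E (gaussWeight lam : Y → ℝ)) = fun y =>
      gaussWeight lam y * (4 * lam ^ 2 * (⟪y, E⟫ * ⟪y, E'⟫) - 2 * lam * ⟪E, E'⟫) := by
  funext y
  rw [dirDeriv_gaussWeight]
  have h1 : HasFDerivAt (fun y : Y => -2 * lam * ⟪y, E⟫) ((-2 * lam) • innerSL ℝ E) y := by
    have := (innerSL ℝ E).hasFDerivAt (x := y)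
    have := this.const_mul (-2 * lam)
    refine this.congr_of_eventuallyEq (Filter.Eventually.of_forall fun z => ?_)
    simp [innerSL_apply_apply, real_inner_comm]
  have h2 : HasFDerivAt (gaussWeight lam : Y → ℝ) (fderiv ℝ (gaussWeight lam : Y → ℝ) y) y :=
    ((contDiff_gaussWeight lam).differentiable (by simp) y).hasFDerivAt
  have h3 : fderiv ℝ (gaussWeight lam : Y → ℝ) y E' = -2 * lam * ⟪y, E'⟫ * gaussWeight lam y :=
    congrFun (dirDeriv_gaussWeight lam E') y
  have h4 : HasFDerivAt (fun y : Y => -2 * lam * ⟪y, E⟫ * gaussWeight lam y) _ y := h1.mul h2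
  rw [dirDeriv, h4.fderiv]
  simp [innerSL_apply_apply, h3]
  ring

end Weight

/-! ### Pointwise expansions of the hyperbolic coefficients. -/

theorem abs_sinh_sub_le {z : ℝ} (hz : |z| ≤ 1) : |Real.sinh z - z| ≤ |z| ^ 3 := by
  have h1 := Real.exp_bound hz (n := 3) (by norm_num)
  have h2 := Real.exp_bound (x := -z) (by rwa [abs_neg]) (n := 3) (by norm_num)
  rw [abs_neg] at h2
  norm_num [Finset.sum_range_succ, Nat.factorial] at h1 h2
  rw [Real.sinh_eq]
  have h0 : 0 ≤ |z| ^ 3 := by positivity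
  rw [abs_le] at *
  constructor <;> linarith [h1.1, h1.2, h2.1, h2.2]

theorem abs_cosh_sub_le {z : ℝ} (hz : |z| ≤ 1) : |Real.cosh z - 1 - z ^ 2 / 2| ≤ z ^ 4 := by
  have h1 := Real.exp_bound hz (n := 4) (by norm_num)
  have h2 := Real.exp_bound (x := -z) (by rwa [abs_neg]) (n := 4) (by norm_num)
  rw [abs_neg] at h2
  have h3 : |z| ^ 4 = z ^ 4 := by
    rw [show (4 : ℕ) = 2 * 2 from rfl, pow_mul, sq_abs, ← pow_mul]
  norm_num [Finset.sum_range_succ, Nat.factorial, h3] at h1 h2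
  rw [Real.cosh_eq]
  have h0 : 0 ≤ z ^ 4 := by positivity
  rw [abs_le] at *
  constructor <;> linarith [h1.1, h1.2, h2.1, h2.2]

theorem abs_cosh_sub_one_le {z : ℝ} (hz : |z| ≤ 1) : |Real.cosh z - 1| ≤ 2 * z ^ 2 := by
  have h1 := abs_cosh_sub_le hz
  have h2 : z ^ 2 ≤ 1 := by rw [← sq_abs]; exact pow_le_one₀ (abs_nonneg z) hz
  have h3 : z ^ 4 ≤ z ^ 2 := by nlinarith [sq_nonneg z]
  rw [abs_le] at *
  constructor <;> linarith [h1.1, h1.2, sq_nonneg z]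

section PointwiseEstimates

variable {C ε σ h : ℝ}

theorem abs_le_of_abs_sub_le {x y a b : ℝ} (h1 : |x - y| ≤ a) (h2 : |y| ≤ b) : |x| ≤ a + b := by
  have : x = (x - y) + y := by ring
  rw [this]; exact (abs_add_le _ _).trans (add_le_add h1 h2)

/-- Expansion of the diagonal coefficients of the commutator. -/
theorem diag_estimate (hC : 1 ≤ C) (hε : 8 * C * ε ≤ 1) (hσ : 0 ≤ σ) (hσε : σ ≤ ε) (hh : 0 ≤ h)
    (hhε : h ≤ ε) {β β' γ p p' H : ℝ} (hp : |p| ≤ C) (hp' : |p'| ≤ C)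
    (hH : |H| ≤ C) (hβ : |β - σ * p| ≤ C * (σ * h)) (hβ' : |β' - σ * p'| ≤ C * (σ * h))
    (hγ : |γ - σ * h * H| ≤ C * (σ * h ^ 2)) :
    |Real.sinh γ * Real.cosh (β - β') - γ - 2⁻¹ * (σ ^ 3 * h) * (H * (p - p') ^ 2)| ≤
      600 * C ^ 5 * ε * (σ ^ 3 * h) := by
  have hC0 : 0 ≤ C := by linarith
  have hε0 : 0 ≤ ε := hσ.trans hσε
  have hCε : C * ε ≤ 1 / 8 := by linarith
  have hε1 : ε ≤ 1 / 8 := by nlinarith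
  have hh1 : h ≤ 1 := by linarith
  have hγb : |γ| ≤ 2 * C * (σ * h) := by
    refine (abs_le_of_abs_sub_le hγ (b := σ * h * C) ?_).trans ?_
    · rw [abs_mul, abs_of_nonneg (by positivity)]; gcongr
    · have : σ * h ^ 2 ≤ σ * h := by rw [pow_two]; nlinarith [mul_nonneg hσ hh]
      nlinarith
  set z := β - β' with hz
  have hzp : |z - σ * (p - p')| ≤ 2 * C * (σ * h) := by
    have : z - σ * (p - p') = (β - σ * p) - (β' - σ * p') := by rw [hz]; ring
    rw [this]; refine (abs_sub _ _).trans ?_; linarith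
  have hpp : |p - p'| ≤ 2 * C := (abs_sub _ _).trans (by linarith)
  have hσpp : |σ * (p - p')| ≤ 2 * C * σ := by
    rw [abs_mul, abs_of_nonneg hσ]; nlinarith
  have hzb : |z| ≤ 4 * C * σ := by
    refine (abs_le_of_abs_sub_le hzp hσpp).trans ?_
    have : σ * h ≤ σ := mul_le_of_le_one_right hσ hh1
    nlinarith
  have hz1 : |z| ≤ 1 := hzb.trans (by nlinarith)
  have hγ1 : |γ| ≤ 1 := hγb.trans (by
    have : σ * h ≤ ε := (mul_le_of_le_one_right hσ hh1).trans hσε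
    nlinarith)
  have t1 : |(Real.sinh γ - γ) * Real.cosh z| ≤ 24 * C ^ 3 * (σ ^ 3 * h * ε) := by
    rw [abs_mul]
    have c1 : |Real.cosh z| ≤ 3 := by
      refine (abs_le_of_abs_sub_le (abs_cosh_sub_one_le hz1) (b := 1) (by simp)).trans ?_
      have : z ^ 2 ≤ 1 := by rw [← sq_abs]; exact pow_le_one₀ (abs_nonneg z) hz1
      linarith
    calc _ ≤ (2 * C * (σ * h)) ^ 3 * 3 :=
          mul_le_mul ((abs_sinh_sub_le hγ1).trans (by gcongr)) c1 (abs_nonneg _) (by positivity)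
      _ = 24 * C ^ 3 * (σ ^ 3 * h * (h * h)) := by ring
      _ ≤ 24 * C ^ 3 * (σ ^ 3 * h * (ε * 1)) := by gcongr
      _ = _ := by ring
  have t2 : |γ * (Real.cosh z - 1 - z ^ 2 / 2)| ≤ 512 * C ^ 5 * (σ ^ 3 * h * ε) := by
    rw [abs_mul]
    calc _ ≤ (2 * C * (σ * h)) * (4 * C * σ) ^ 4 := by
          refine mul_le_mul hγb ((abs_cosh_sub_le hz1).trans ?_) (abs_nonneg _) (by positivity)
          rw [← abs_of_nonneg (show 0 ≤ z ^ 4 by positivity), abs_pow]; gcongr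
      _ = 512 * C ^ 5 * (σ ^ 3 * h * (σ * σ)) := by ring
      _ ≤ 512 * C ^ 5 * (σ ^ 3 * h * (ε * 1)) := by gcongr; linarith
      _ = _ := by ring
  have t3 : |(γ - σ * h * H) * z ^ 2 / 2| ≤ 8 * C ^ 3 * (σ ^ 3 * h * ε) := by
    rw [abs_div, abs_mul, abs_two, abs_pow]
    calc _ ≤ C * (σ * h ^ 2) * (4 * C * σ) ^ 2 / 2 := by gcongr
      _ = 8 * C ^ 3 * (σ ^ 3 * h * h) := by ring
      _ ≤ _ := by gcongr
  have t4 : |σ * h * H * ((z - σ * (p - p')) * (z + σ * (p - p'))) / 2| ≤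
      6 * C ^ 3 * (σ ^ 3 * h * ε) := by
    rw [abs_div, abs_mul, abs_mul, abs_mul (z - σ * (p - p')), abs_two,
      abs_of_nonneg (show 0 ≤ σ * h by positivity)]
    have : |z + σ * (p - p')| ≤ 6 * C * σ := (abs_add_le _ _).trans (by linarith)
    calc _ ≤ σ * h * C * (2 * C * (σ * h) * (6 * C * σ)) / 2 := by gcongr
      _ = 6 * C ^ 3 * (σ ^ 3 * h * h) := by ring
      _ ≤ _ := by gcongr
  have hCC : C ^ 3 ≤ C ^ 5 := pow_le_pow_right₀ hC (by norm_num)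
  have hpos : 0 ≤ σ ^ 3 * h * ε := by positivity
  -- The four terms replace in turn sinh γ by γ, cosh z by 1 + z²/2, γ by σ h H, and z by σ (p -
  -- p'). Each error is O(ε σ³ h).
  have key : Real.sinh γ * Real.cosh z - γ - 2⁻¹ * (σ ^ 3 * h) * (H * (p - p') ^ 2) =
      (Real.sinh γ - γ) * Real.cosh z + γ * (Real.cosh z - 1 - z ^ 2 / 2) +
      (γ - σ * h * H) * z ^ 2 / 2 +
      σ * h * H * ((z - σ * (p - p')) * (z + σ * (p - p'))) / 2 := by ring
  rw [key]
  calc _ ≤ 24 * C ^ 3 * (σ ^ 3 * h * ε) + 512 * C ^ 5 * (σ ^ 3 * h * ε) +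
        8 * C ^ 3 * (σ ^ 3 * h * ε) + 6 * C ^ 3 * (σ ^ 3 * h * ε) :=
        (abs_add_le _ _).trans (add_le_add ((abs_add_le _ _).trans (add_le_add
          ((abs_add_le _ _).trans (add_le_add t1 t2)) t3)) t4)
    _ = (38 * C ^ 3 + 512 * C ^ 5) * (σ ^ 3 * h * ε) := by ring
    _ ≤ (600 * C ^ 5) * (σ ^ 3 * h * ε) := by
        apply mul_le_mul_of_nonneg_right _ hpos
        have : 0 ≤ C ^ 5 := by positivity
        linarith
    _ = _ := by ring

/-- Expansion of the coefficients of the commutator. -/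
theorem coeff_estimate (hC : 1 ≤ C) (hε : 8 * C * ε ≤ 1) (hσ : 0 ≤ σ) (hσε : σ ≤ ε) (hh : 0 ≤ h)
    (hhε : h ≤ ε) {β β' γ p p' H : ℝ} (hp : |p| ≤ C) (hp' : |p'| ≤ C)
    (hH : |H| ≤ C) (hβ : |β - σ * p| ≤ C * (σ * h)) (hβ' : |β' - σ * p'| ≤ C * (σ * h))
    (hγ : |γ - σ * h * H| ≤ C * (σ * h ^ 2)) :
    |Real.sinh γ * Real.cosh (β + β' + γ) - σ * h * H| ≤ 200 * C ^ 3 * ε * (σ * h) := by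
  have hC0 : 0 ≤ C := by linarith
  have hε0 : 0 ≤ ε := hσ.trans hσε
  have hCε : C * ε ≤ 1 / 8 := by linarith
  have hε1 : ε ≤ 1 / 8 := by nlinarith
  have hh1 : h ≤ 1 := by linarith
  have hσh : σ * h ≤ σ * ε := by gcongr
  have hγb : |γ| ≤ 2 * C * (σ * h) := by
    refine (abs_le_of_abs_sub_le hγ (b := σ * h * C) ?_).trans ?_
    · rw [abs_mul, abs_of_nonneg (by positivity)]; gcongr
    · have : σ * h ^ 2 ≤ σ * h := by rw [pow_two]; nlinarith [mul_nonneg hσ hh]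
      nlinarith
  have hσC : 0 ≤ C * σ := by positivity
  have bb : ∀ {b q : ℝ}, |q| ≤ C → |b - σ * q| ≤ C * (σ * h) → |b| ≤ (9 / 8) * C * σ := by
    intro b q hq hb
    refine (abs_le_of_abs_sub_le hb (b := σ * C) ?_).trans ?_
    · rw [abs_mul, abs_of_nonneg hσ]; gcongr
    · nlinarith
  have hγb2 : |γ| ≤ (1 / 4) * C * σ := hγb.trans (by nlinarith)
  set η := β + β' + γ with hη
  have hηb : |η| ≤ 3 * C * σ := by
    refine (abs_add_le _ _).trans ((add_le_add ((abs_add_le _ _).trans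
      (add_le_add (bb hp hβ) (bb hp' hβ'))) hγb2).trans ?_)
    nlinarith
  have hCσ : C * σ ≤ C * ε := by gcongr
  have hη1 : |η| ≤ 1 := hηb.trans (by nlinarith)
  have hγ1 : |γ| ≤ 1 := hγb2.trans (by nlinarith)
  have t1 : |(Real.sinh γ - γ) * Real.cosh η| ≤ 24 * C ^ 3 * (σ * h * ε) := by
    rw [abs_mul]
    have c1 : |Real.cosh η| ≤ 3 := by
      refine (abs_le_of_abs_sub_le (abs_cosh_sub_one_le hη1) (b := 1) (by simp)).trans ?_
      have : η ^ 2 ≤ 1 := by rw [← sq_abs]; exact pow_le_one₀ (abs_nonneg η) hη1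
      linarith
    calc _ ≤ (2 * C * (σ * h)) ^ 3 * 3 :=
          mul_le_mul ((abs_sinh_sub_le hγ1).trans (by gcongr)) c1 (abs_nonneg _) (by positivity)
      _ = 24 * C ^ 3 * (σ * h * ((σ * σ) * (h * h))) := by ring
      _ ≤ 24 * C ^ 3 * (σ * h * ((1 * 1) * (ε * 1))) := by gcongr <;> linarith
      _ = _ := by ring
  have t2 : |γ * (Real.cosh η - 1)| ≤ 36 * C ^ 3 * (σ * h * ε) := by
    rw [abs_mul]
    calc _ ≤ (2 * C * (σ * h)) * (2 * (3 * C * σ) ^ 2) := by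
          refine mul_le_mul hγb ((abs_cosh_sub_one_le hη1).trans ?_) (abs_nonneg _) (by positivity)
          rw [← sq_abs]; gcongr
      _ = 36 * C ^ 3 * (σ * h * (σ * σ)) := by ring
      _ ≤ 36 * C ^ 3 * (σ * h * (ε * 1)) := by gcongr; linarith
      _ = _ := by ring
  have t3 : |γ - σ * h * H| ≤ C ^ 3 * (σ * h * ε) := by
    refine hγ.trans ?_
    have : C ^ 1 ≤ C ^ 3 := pow_le_pow_right₀ hC (by norm_num)
    calc _ = C ^ 1 * (σ * h * h) := by ring
      _ ≤ _ := by gcongr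
  have key : Real.sinh γ * Real.cosh η - σ * h * H = (Real.sinh γ - γ) * Real.cosh η +
      γ * (Real.cosh η - 1) + (γ - σ * h * H) := by ring
  have hpos : 0 ≤ C ^ 3 * (σ * h * ε) := by positivity
  rw [key]
  refine ((abs_add_le _ _).trans (add_le_add ((abs_add_le _ _).trans (add_le_add t1 t2)) t3)).trans ?_
  nlinarith

/-- Expansion of the potential produced by the symmetric part. -/
theorem symm_estimate (hC : 1 ≤ C) (hε : 8 * C * ε ≤ 1) (hσ : 0 ≤ σ) (hσε : σ ≤ ε) (hh : 0 ≤ h)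
    (hhε : h ≤ ε) {β p w w' : ℝ} (hp : |p| ≤ C) (hβ : |β - σ * p| ≤ C * (σ * h))
    (hw0 : 0 ≤ w) (hw : w ≤ 1) (hw' : |w' - w| ≤ C * h) :
    |(Real.cosh β - 1) * (w + w') - σ ^ 2 * (w * p ^ 2)| ≤ 100 * C ^ 4 * ε * σ ^ 2 := by
  have hC0 : 0 ≤ C := by linarith
  have hε0 : 0 ≤ ε := hσ.trans hσε
  have hCε : C * ε ≤ 1 / 8 := by linarith
  have hε1 : ε ≤ 1 / 8 := by nlinarith
  have hσp : |σ * p| ≤ C * σ := by rw [abs_mul, abs_of_nonneg hσ]; nlinarith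
  have hβb : |β| ≤ 2 * C * σ := by
    refine (abs_le_of_abs_sub_le hβ hσp).trans ?_
    have : σ * h ≤ σ := mul_le_of_le_one_right hσ (by linarith)
    nlinarith
  have hβ1 : |β| ≤ 1 := hβb.trans (by nlinarith)
  have t1 : |(Real.cosh β - 1) * (w' - w)| ≤ 8 * C ^ 3 * (σ ^ 2 * ε) := by
    rw [abs_mul]
    calc _ ≤ (2 * (2 * C * σ) ^ 2) * (C * h) := by
          refine mul_le_mul ((abs_cosh_sub_one_le hβ1).trans ?_) hw' (abs_nonneg _) (by positivity)
          rw [← sq_abs]; gcongr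
      _ = 8 * C ^ 3 * (σ ^ 2 * h) := by ring
      _ ≤ _ := by gcongr
  have t2 : |2 * w * (Real.cosh β - 1 - β ^ 2 / 2)| ≤ 32 * C ^ 4 * (σ ^ 2 * ε) := by
    rw [abs_mul, abs_of_nonneg (by positivity)]
    calc _ ≤ (2 * 1) * (2 * C * σ) ^ 4 := by
          refine mul_le_mul (by gcongr) ((abs_cosh_sub_le hβ1).trans ?_) (abs_nonneg _)
            (by positivity)
          rw [← abs_of_nonneg (show 0 ≤ β ^ 4 by positivity), abs_pow]; gcongr
      _ = 32 * C ^ 4 * (σ ^ 2 * (σ * σ)) := by ring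
      _ ≤ 32 * C ^ 4 * (σ ^ 2 * (ε * 1)) := by gcongr; linarith
      _ = _ := by ring
  have t3 : |w * ((β - σ * p) * (β + σ * p))| ≤ 3 * C ^ 2 * (σ ^ 2 * ε) := by
    rw [abs_mul, abs_mul, abs_of_nonneg hw0]
    have : |β + σ * p| ≤ 3 * C * σ := (abs_add_le _ _).trans (by linarith)
    calc _ ≤ 1 * (C * (σ * h) * (3 * C * σ)) := by gcongr
      _ = 3 * C ^ 2 * (σ ^ 2 * h) := by ring
      _ ≤ _ := by gcongr
  have key : (Real.cosh β - 1) * (w + w') - σ ^ 2 * (w * p ^ 2) =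
      (Real.cosh β - 1) * (w' - w) + 2 * w * (Real.cosh β - 1 - β ^ 2 / 2) +
      w * ((β - σ * p) * (β + σ * p)) := by ring
  have hpos : 0 ≤ σ ^ 2 * ε := by positivity
  have h24 : C ^ 2 ≤ C ^ 4 := pow_le_pow_right₀ hC (by norm_num)
  have h34 : C ^ 3 ≤ C ^ 4 := pow_le_pow_right₀ hC (by norm_num)
  have h4 : 0 ≤ C ^ 4 := by positivity
  rw [key]
  calc _ ≤ 8 * C ^ 3 * (σ ^ 2 * ε) + 32 * C ^ 4 * (σ ^ 2 * ε) + 3 * C ^ 2 * (σ ^ 2 * ε) :=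
        (abs_add_le _ _).trans (add_le_add ((abs_add_le _ _).trans (add_le_add t1 t2)) t3)
    _ = (8 * C ^ 3 + 32 * C ^ 4 + 3 * C ^ 2) * (σ ^ 2 * ε) := by ring
    _ ≤ (100 * C ^ 4) * (σ ^ 2 * ε) := mul_le_mul_of_nonneg_right (by linarith) hpos
    _ = _ := by ring

end PointwiseEstimates

/-! ### Second moments and the Hessian form of the Gaussian weight. -/

namespace Stencil

variable {G : Type*} [AddCommGroup G] (S : Stencil G)
variable {Y : Type*} [NormedAddCommGroup Y]

/-- The trace `∑ a_e ‖T e‖²` of the second moment matrix. -/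
noncomputable def trace (T : G →+ Y) : ℝ := ∑ e ∈ S.steps, S.wt e * ‖T e‖ ^ 2

theorem trace_nonneg (T : G →+ Y) : 0 ≤ S.trace T :=
  Finset.sum_nonneg fun e _ => mul_nonneg (S.wt_nonneg e) (by positivity)

variable [InnerProductSpace ℝ Y] (T : G →+ Y)

/-- The second moment form `∑ a_e ⟪y, T e⟫²`. -/
noncomputable def moment (y : Y) : ℝ := ∑ e ∈ S.steps, S.wt e * ⟪y, T e⟫ ^ 2

/-- Triangle inequality, then Cauchy–Schwarz with respect to the weights. -/
theorem sq_norm_sum_le (c : G → ℝ) :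
    ‖∑ e ∈ S.steps, (S.wt e * c e) • T e‖ ^ 2 ≤ S.trace T * ∑ e ∈ S.steps, S.wt e * c e ^ 2 := by
  have h1 : ‖∑ e ∈ S.steps, (S.wt e * c e) • T e‖ ≤
      ∑ e ∈ S.steps, S.wt e * |c e| * ‖T e‖ := by
    refine (norm_sum_le _ _).trans (le_of_eq (Finset.sum_congr rfl fun e _ => ?_))
    rw [norm_smul, Real.norm_eq_abs, abs_mul, abs_of_nonneg (S.wt_nonneg e)]
  refine (pow_le_pow_left₀ (norm_nonneg _) h1 2).trans ?_
  refine Finset.sum_sq_le_sum_mul_sum_of_sq_le_mul _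
    (fun e _ => mul_nonneg (S.wt_nonneg e) (by positivity))
    (fun e _ => mul_nonneg (S.wt_nonneg e) (by positivity)) (fun e _ => ?_)
  rw [← sq_abs (c e)]; exact (by ring : _ = _).le

theorem sum_smul_eq_zero : ∑ e ∈ S.steps, S.wt e • T e = 0 := by
  have h : ∑ e ∈ S.steps, S.wt e • T e = -∑ e ∈ S.steps, S.wt e • T e := by
    conv_lhs => rw [← Finset.sum_nbij' (fun e => -e) (fun e => -e) S.neg_mem S.neg_mem
      (by simp) (by simp) (f := fun e => S.wt (-e) • T (-e)) (by simp)]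
    simp [S.wt_neg]
  have h2 := eq_neg_iff_add_eq_zero.1 h
  rw [← two_smul ℝ] at h2
  exact (smul_eq_zero.1 h2).resolve_left two_ne_zero

/-- The Hessian form of the Gaussian weight on the steps. -/
noncomputable def hess (lam : ℝ) (y : Y) (e e' : G) : ℝ :=
  gaussWeight lam y * (4 * lam ^ 2 * (⟪y, T e⟫ * ⟪y, T e'⟫) - 2 * lam * ⟪T e, T e'⟫)

theorem hess_comm (lam : ℝ) (y : Y) (e e' : G) : hess T lam y e e' = hess T lam y e' e := by
  rw [hess, hess, real_inner_comm (T e) (T e')]; ring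

theorem hess_neg_left (lam : ℝ) (y : Y) (e e' : G) :
    hess T lam y (-e) e' = -hess T lam y e e' := by
  simp only [hess, map_neg, inner_neg_right, inner_neg_left]; ring

theorem hess_neg_right (lam : ℝ) (y : Y) (e e' : G) :
    hess T lam y e (-e') = -hess T lam y e e' := by
  rw [hess_comm, hess_neg_left, hess_comm]

theorem sum_hess (lam : ℝ) (y : Y) (e : G) :
    ∑ e' ∈ S.steps, S.wt e' * hess T lam y e e' = 0 :=
  S.sum_odd _ (hess_neg_right T lam y e)

/-- The Hessian is a rank-one form minus a multiple of the inner product; the first sums to a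
square, the second to the squared norm of one vector. -/
theorem sum_hess_mul (lam : ℝ) (y : Y) (c : G → ℝ) :
    ∑ e ∈ S.steps, ∑ e' ∈ S.steps, S.wt e * S.wt e' * (hess T lam y e e' * (c e * c e')) =
      gaussWeight lam y * (4 * lam ^ 2 * (∑ e ∈ S.steps, S.wt e * (c e * ⟪y, T e⟫)) ^ 2 -
        2 * lam * ‖∑ e ∈ S.steps, (S.wt e * c e) • T e‖ ^ 2) := by
  rw [← real_inner_self_eq_norm_sq, sum_inner, pow_two (∑ e ∈ S.steps, _), Finset.sum_mul_sum]
  simp only [inner_sum, Finset.mul_sum, ← Finset.sum_sub_distrib]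
  refine Finset.sum_congr rfl fun e _ => Finset.sum_congr rfl fun e' _ => ?_
  rw [real_inner_smul_left, real_inner_smul_right, hess]; ring

/-- The square is discarded. First moments of a symmetric stencil vanish, so `c0` can be subtracted
before Cauchy–Schwarz; hence the negative part of the Hessian costs only differences, which the
symmetric part of the operator can pay for. -/
theorem sum_hess_mul_ge {lam : ℝ} (hl : 0 ≤ lam) (y : Y) (c : G → ℝ) (c0 : ℝ) :
    -(2 * lam * gaussWeight lam y * S.trace T * ∑ e ∈ S.steps, S.wt e * (c e - c0) ^ 2) ≤
      ∑ e ∈ S.steps, ∑ e' ∈ S.steps, S.wt e * S.wt e' * (hess T lam y e e' * (c e * c e')) := by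
  rw [sum_hess_mul]
  have h1 : ∑ e ∈ S.steps, (S.wt e * c e) • T e = ∑ e ∈ S.steps, (S.wt e * (c e - c0)) • T e := by
    simp only [mul_sub, sub_smul, Finset.sum_sub_distrib]
    have : ∑ e ∈ S.steps, (S.wt e * c0) • T e = c0 • ∑ e ∈ S.steps, S.wt e • T e := by
      rw [Finset.smul_sum]
      exact Finset.sum_congr rfl fun e _ => by rw [smul_smul, mul_comm]
    rw [this, sum_smul_eq_zero, smul_zero, sub_zero]
  rw [h1]
  have h2 := S.sq_norm_sum_le T (fun e => c e - c0)
  have h3 := gaussWeight_pos lam y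
  have h4 : 0 ≤ gaussWeight lam y * (4 * lam ^ 2 * (∑ e ∈ S.steps, S.wt e * (c e * ⟪y, T e⟫)) ^ 2) := by
    positivity
  have h5 := mul_le_mul_of_nonneg_left h2 (show 0 ≤ gaussWeight lam y * (2 * lam) by positivity)
  linarith

/-- In the expanded square the pure squares drop out because the Hessian is odd in each step. The
cross term is the Hessian form evaluated at the derivatives of the weight along the steps. There the
rank-one part grows like lam⁴ and the negative part only like lam³, so a large `lam` makes the bound
positive where the moment is bounded below. -/
theorem neg_sum_hess_mul_sq_ge {lam : ℝ} (hl : 0 ≤ lam) (y : Y) :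
    4 * lam ^ 3 * gaussWeight lam y ^ 3 * S.moment T y *
        (4 * lam * S.moment T y - 2 * S.trace T) ≤
      -(2⁻¹ * ∑ e ∈ S.steps, ∑ e' ∈ S.steps, S.wt e * S.wt e' * (hess T lam y e e' *
        (-2 * lam * ⟪y, T e⟫ * gaussWeight lam y - -2 * lam * ⟪y, T e'⟫ * gaussWeight lam y) ^ 2)) := by
  set φ := gaussWeight lam y with hφ
  have h3 : 0 < φ := gaussWeight_pos lam y
  set p : G → ℝ := fun e => -2 * lam * ⟪y, T e⟫ * φ with hp
  have h1 : ∑ e ∈ S.steps, ∑ e' ∈ S.steps, S.wt e * S.wt e' * (hess T lam y e e' *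
      (p e - p e') ^ 2) = -2 * ∑ e ∈ S.steps, ∑ e' ∈ S.steps, S.wt e * S.wt e' *
        (hess T lam y e e' * (p e * p e')) := by
    have a1 : ∑ e ∈ S.steps, ∑ e' ∈ S.steps, S.wt e * S.wt e' * (hess T lam y e e' * p e ^ 2) = 0 := by
      refine Finset.sum_eq_zero fun e _ => ?_
      have := S.sum_hess T lam y e
      calc _ = (S.wt e * p e ^ 2) * ∑ e' ∈ S.steps, S.wt e' * hess T lam y e e' := by
            rw [Finset.mul_sum]; exact Finset.sum_congr rfl fun e' _ => by ring
        _ = 0 := by rw [this, mul_zero]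
    have a2 : ∑ e ∈ S.steps, ∑ e' ∈ S.steps, S.wt e * S.wt e' * (hess T lam y e e' * p e' ^ 2) = 0 := by
      rw [Finset.sum_comm, ← a1]
      refine Finset.sum_congr rfl fun e _ => Finset.sum_congr rfl fun e' _ => ?_
      rw [hess_comm]; ring
    have a3 : ∑ e ∈ S.steps, ∑ e' ∈ S.steps, S.wt e * S.wt e' * (hess T lam y e e' *
        (p e - p e') ^ 2) = ∑ e ∈ S.steps, ∑ e' ∈ S.steps, S.wt e * S.wt e' * (hess T lam y e e' * p e ^ 2)
        + ∑ e ∈ S.steps, ∑ e' ∈ S.steps, S.wt e * S.wt e' * (hess T lam y e e' * p e' ^ 2)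
        + -2 * ∑ e ∈ S.steps, ∑ e' ∈ S.steps, S.wt e * S.wt e' * (hess T lam y e e' * (p e * p e')) := by
      simp only [Finset.mul_sum, ← Finset.sum_add_distrib]
      exact Finset.sum_congr rfl fun e _ => Finset.sum_congr rfl fun e' _ => by ring
    rw [a3, a1, a2]; ring
  rw [h1, sum_hess_mul]
  have h4 : ∑ e ∈ S.steps, S.wt e * (p e * ⟪y, T e⟫) = -2 * lam * φ * S.moment T y := by
    rw [moment, Finset.mul_sum]; exact Finset.sum_congr rfl fun e _ => by rw [hp]; ring
  have h5 := S.sq_norm_sum_le T p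
  have h6 : ∑ e ∈ S.steps, S.wt e * p e ^ 2 = 4 * lam ^ 2 * φ ^ 2 * S.moment T y := by
    rw [moment, Finset.mul_sum]; exact Finset.sum_congr rfl fun e _ => by rw [hp]; ring
  rw [h6] at h5
  rw [h4, ← hφ]
  have h7 := mul_le_mul_of_nonneg_left h5 (show 0 ≤ φ * (2 * lam) by positivity)
  linarith

variable [FiniteDimensional ℝ Y]

theorem exists_gauss_bounds (lam : ℝ) : ∃ C, 1 ≤ C ∧
    ∀ e ∈ S.steps, ∀ e' ∈ S.steps, ∀ y : Y, ‖y‖ ≤ 4 → ∀ h ∈ Set.Icc (0 : ℝ) 1,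
      |(-2 * lam * ⟪y, T e⟫ * gaussWeight lam y)| ≤ C ∧
      |gaussWeight lam (y + h • T e) - gaussWeight lam y| ≤ C * h ∧
      |gaussWeight lam (y + h • T e) - gaussWeight lam y -
        h * (-2 * lam * ⟪y, T e⟫ * gaussWeight lam y)| ≤ C * h ^ 2 ∧
      |gaussWeight lam (y + h • T e) + gaussWeight lam (y + -(h • T e)) - 2 * gaussWeight lam y|
        ≤ C * h ^ 2 ∧
      |hess T lam y e e'| ≤ C ∧
      |mixed (gaussWeight lam) (h • T e) (h • T e') y - h ^ 2 * hess T lam y e e'| ≤ C * h ^ 3 ∧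
      |mixed (gaussWeight lam) (h • T e) (h • T e') y +
        mixed (gaussWeight lam) (-(h • T e)) (h • T e') y +
        mixed (gaussWeight lam) (h • T e) (-(h • T e')) y +
        mixed (gaussWeight lam) (-(h • T e)) (-(h • T e')) y| ≤ C * h ^ 4 := by
  have hφ := contDiff_gaussWeight (Y := Y) lam
  obtain ⟨C, hC0, hC⟩ := exists_common_bound (S.steps ×ˢ S.steps)
    (fun q C => ∀ y : Y, ‖y‖ ≤ 4 → ∀ h ∈ Set.Icc (0 : ℝ) 1,
      |(-2 * lam * ⟪y, T q.1⟫ * gaussWeight lam y)| ≤ C ∧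
      |gaussWeight lam (y + h • T q.1) - gaussWeight lam y| ≤ C * h ∧
      |gaussWeight lam (y + h • T q.1) - gaussWeight lam y -
        h * (-2 * lam * ⟪y, T q.1⟫ * gaussWeight lam y)| ≤ C * h ^ 2 ∧
      |gaussWeight lam (y + h • T q.1) + gaussWeight lam (y + -(h • T q.1)) - 2 * gaussWeight lam y|
        ≤ C * h ^ 2 ∧
      |hess T lam y q.1 q.2| ≤ C ∧
      |mixed (gaussWeight lam) (h • T q.1) (h • T q.2) y - h ^ 2 * hess T lam y q.1 q.2| ≤ C * h ^ 3 ∧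
      |mixed (gaussWeight lam) (h • T q.1) (h • T q.2) y +
        mixed (gaussWeight lam) (-(h • T q.1)) (h • T q.2) y +
        mixed (gaussWeight lam) (h • T q.1) (-(h • T q.2)) y +
        mixed (gaussWeight lam) (-(h • T q.1)) (-(h • T q.2)) y| ≤ C * h ^ 4)
    (fun q C C' hCC H y hy h hh => by
      obtain ⟨H1, H2, H3, H4, H5, H6, H7⟩ := H y hy h hh
      have := hh.1
      exact ⟨H1.trans hCC, H2.trans (by gcongr), H3.trans (by gcongr), H4.trans (by gcongr),
        H5.trans hCC, H6.trans (by gcongr), H7.trans (by gcongr)⟩)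
    (fun q _ => by
      obtain ⟨C1, p1, H1⟩ := exists_bound_on_ball (hφ.dirDeriv (T q.1)).continuous 4
      obtain ⟨C2, p2, H2⟩ := exists_first_diff_bound hφ 4 (T q.1)
      obtain ⟨C3, p3, H3⟩ := exists_taylor_bound hφ 4 (T q.1)
      obtain ⟨C4, p4, H4⟩ := exists_second_diff_bound hφ 4 (T q.1)
      obtain ⟨C5, p5, H5⟩ := exists_bound_on_ball ((hφ.dirDeriv (T q.1)).dirDeriv (T q.2)).continuous 4
      obtain ⟨C6, p6, H6⟩ := exists_mixed_bound hφ 4 (T q.1) (T q.2)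
      obtain ⟨C7, p7, H7⟩ := exists_fourth_diff_bound hφ 4 (T q.1) (T q.2)
      rw [dirDeriv_dirDeriv_gaussWeight] at H5 H6
      rw [dirDeriv_gaussWeight] at H1 H3
      refine ⟨C1 + C2 + C3 + C4 + C5 + C6 + C7, by positivity, fun y hy h hh => ?_⟩
      have := hh.1
      refine ⟨(H1 y hy).trans ?_, (H2 y hy h hh).trans ?_, (H3 y hy h hh).trans ?_,
        (H4 y hy h hh).trans ?_, (H5 y hy).trans ?_, (H6 y hy h hh).trans ?_,
        (H7 y hy h hh).trans ?_⟩
      · linarith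
      · gcongr; linarith
      · gcongr; linarith
      · gcongr; linarith
      · linarith
      · gcongr; linarith
      · gcongr; linarith)
  refine ⟨C + 1, by linarith, fun e he e' he' y hy h hh => ?_⟩
  obtain ⟨H1, H2, H3, H4, H5, H6, H7⟩ := hC (e, e') (Finset.mk_mem_product he he') y hy h hh
  have := hh.1
  exact ⟨H1.trans (by linarith), H2.trans (by gcongr; linarith), H3.trans (by gcongr; linarith),
    H4.trans (by gcongr; linarith), H5.trans (by linarith), H6.trans (by gcongr; linarith),
    H7.trans (by gcongr; linarith)⟩

end Stencil

/-! ### Differences of the phase and the coefficients of the conjugated operator. -/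

namespace Stencil

variable {G : Type*} [AddCommGroup G] (S : Stencil G)

/-- Reflecting either step leaves the sum unchanged, so the summand may be averaged over the four
sign choices. -/
theorem four_mul_sum_sum (k : G → G → ℝ) :
    4 * ∑ e ∈ S.steps, ∑ e' ∈ S.steps, S.wt e * S.wt e' * k e e' =
      ∑ e ∈ S.steps, ∑ e' ∈ S.steps, S.wt e * S.wt e' *
        (k e e' + k (-e) e' + k e (-e') + k (-e) (-e')) := by
  have h1 : ∀ k : G → G → ℝ, ∑ e ∈ S.steps, ∑ e' ∈ S.steps, S.wt e * S.wt e' * k (-e) e' =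
      ∑ e ∈ S.steps, ∑ e' ∈ S.steps, S.wt e * S.wt e' * k e e' := fun k => by
    rw [← S.sum_neg]; simp [S.wt_neg]
  have h2 : ∀ k : G → G → ℝ, ∑ e ∈ S.steps, ∑ e' ∈ S.steps, S.wt e * S.wt e' * k e (-e') =
      ∑ e ∈ S.steps, ∑ e' ∈ S.steps, S.wt e * S.wt e' * k e e' := fun k =>
    Finset.sum_congr rfl fun e _ => by rw [← S.sum_neg]; simp [S.wt_neg]
  simp only [mul_add, Finset.sum_add_distrib, h1, h2]
  ring

theorem abs_sum_sum_le {k : G → G → ℝ} {B : ℝ}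
    (hk : ∀ e ∈ S.steps, ∀ e' ∈ S.steps, |k e e'| ≤ B) :
    |∑ e ∈ S.steps, ∑ e' ∈ S.steps, S.wt e * S.wt e' * k e e'| ≤ S.total ^ 2 * B := by
  rw [pow_two, total, Finset.sum_mul_sum, Finset.sum_mul]
  refine (Finset.abs_sum_le_sum_abs _ _).trans (Finset.sum_le_sum fun e he => ?_)
  rw [Finset.sum_mul]
  refine (Finset.abs_sum_le_sum_abs _ _).trans (Finset.sum_le_sum fun e' he' => ?_)
  have := mul_nonneg (S.wt_nonneg e) (S.wt_nonneg e')
  rw [abs_mul, abs_of_nonneg this]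
  exact mul_le_mul_of_nonneg_left (hk e he e' he') this

theorem abs_sum_le {k : G → ℝ} {B : ℝ} (hk : ∀ e ∈ S.steps, |k e| ≤ B) :
    |∑ e ∈ S.steps, S.wt e * k e| ≤ S.total * B := by
  rw [total, Finset.sum_mul]
  refine (Finset.abs_sum_le_sum_abs _ _).trans (Finset.sum_le_sum fun e he => ?_)
  rw [abs_mul, abs_of_nonneg (S.wt_nonneg e)]
  exact mul_le_mul_of_nonneg_left (hk e he) (S.wt_nonneg e)

theorem two_mul_sum (k : G → ℝ) : 2 * ∑ e ∈ S.steps, S.wt e * k e =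
    ∑ e ∈ S.steps, S.wt e * (k e + k (-e)) := by
  have := S.sum_neg (fun e => S.wt e * k e)
  simp only [S.wt_neg] at this
  simp only [mul_add, Finset.sum_add_distrib, this]
  ring

variable {Y : Type*} [NormedAddCommGroup Y] [InnerProductSpace ℝ Y] (T : G →+ Y)

/-- The bounds on the differences of the Gaussian weight along the steps used in the Carleman
estimate. -/
def GaussBounds (lam C : ℝ) : Prop :=
  ∀ e ∈ S.steps, ∀ e' ∈ S.steps, ∀ y : Y, ‖y‖ ≤ 4 → ∀ h ∈ Set.Icc (0 : ℝ) 1,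
      |(-2 * lam * ⟪y, T e⟫ * gaussWeight lam y)| ≤ C ∧
      |gaussWeight lam (y + h • T e) - gaussWeight lam y| ≤ C * h ∧
      |gaussWeight lam (y + h • T e) - gaussWeight lam y -
        h * (-2 * lam * ⟪y, T e⟫ * gaussWeight lam y)| ≤ C * h ^ 2 ∧
      |gaussWeight lam (y + h • T e) + gaussWeight lam (y + -(h • T e)) - 2 * gaussWeight lam y|
        ≤ C * h ^ 2 ∧
      |hess T lam y e e'| ≤ C ∧
      |mixed (gaussWeight lam) (h • T e) (h • T e') y - h ^ 2 * hess T lam y e e'| ≤ C * h ^ 3 ∧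
      |mixed (gaussWeight lam) (h • T e) (h • T e') y +
        mixed (gaussWeight lam) (-(h • T e)) (h • T e') y +
        mixed (gaussWeight lam) (h • T e) (-(h • T e')) y +
        mixed (gaussWeight lam) (-(h • T e)) (-(h • T e')) y| ≤ C * h ^ 4

/-- The weight `τ exp (-lam ‖h T x‖²)`. -/
noncomputable def phase (lam h τ : ℝ) (x : G) : ℝ := τ * gaussWeight lam (h • T x)

section

variable {lam C ε h τ : ℝ}

theorem phase_add (x e : G) :
    phase T lam h τ (x + e) = τ * gaussWeight lam (h • T x + h • T e) := by
  rw [phase, map_add, smul_add]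

theorem mixed_phase (x e e' : G) : mixed (phase T lam h τ) e e' x =
    τ * mixed (gaussWeight lam) (h • T e) (h • T e') (h • T x) := by
  simp only [mixed, phase, map_add, smul_add]; ring

variable {S T}

theorem GaussBounds.phase_step (hB : S.GaussBounds T lam C) (hh : h ∈ Set.Icc (0 : ℝ) 1)
    (hτ : 0 ≤ τ) {x : G} (hx : ‖h • T x‖ ≤ 4) {e : G} (he : e ∈ S.steps) :
    |(phase T lam h τ (x + e) - phase T lam h τ x) -
      τ * h * (-2 * lam * ⟪h • T x, T e⟫ * gaussWeight lam (h • T x))| ≤ C * (τ * h * h) := by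
  obtain ⟨-, -, H, -⟩ := hB e he e he _ hx h hh
  rw [phase_add, phase]
  calc _ = |τ * (gaussWeight lam (h • T x + h • T e) - gaussWeight lam (h • T x) -
        h * (-2 * lam * ⟪h • T x, T e⟫ * gaussWeight lam (h • T x)))| := by congr 1; ring
    _ ≤ τ * (C * h ^ 2) := by
        rw [abs_mul, abs_of_nonneg hτ]; exact mul_le_mul_of_nonneg_left H hτ
    _ = _ := by ring

theorem GaussBounds.mixed_phase (hB : S.GaussBounds T lam C) (hh : h ∈ Set.Icc (0 : ℝ) 1)
    (hτ : 0 ≤ τ) {x : G} (hx : ‖h • T x‖ ≤ 4) {e e' : G} (he : e ∈ S.steps) (he' : e' ∈ S.steps) :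
    |mixed (phase T lam h τ) e e' x - τ * h * h * hess T lam (h • T x) e e'| ≤
      C * (τ * h * h ^ 2) := by
  obtain ⟨-, -, -, -, -, H, -⟩ := hB e he e' he' _ hx h hh
  rw [Stencil.mixed_phase]
  calc _ = |τ * (mixed (gaussWeight lam) (h • T e) (h • T e') (h • T x) -
        h ^ 2 * hess T lam (h • T x) e e')| := by congr 1; ring
    _ ≤ τ * (C * h ^ 3) := by
        rw [abs_mul, abs_of_nonneg hτ]; exact mul_le_mul_of_nonneg_left H hτ
    _ = _ := by ring

/-- A single mixed difference has size τ h². Averaging over signs leaves a fourth order difference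
of size τ h⁴, which is negligible against the main term τ³ h⁴ when τ is large. -/
theorem GaussBounds.sum_mixed (hB : S.GaussBounds T lam C) (hh : h ∈ Set.Icc (0 : ℝ) 1)
    (hτ : 0 ≤ τ) {x : G} (hx : ‖h • T x‖ ≤ 4) :
    |∑ e ∈ S.steps, ∑ e' ∈ S.steps, S.wt e * S.wt e' * mixed (phase T lam h τ) e e' x| ≤
      S.total ^ 2 * (C * (τ * h * h ^ 3)) := by
  have h1 := S.four_mul_sum_sum (fun e e' => mixed (phase T lam h τ) e e' x)
  have h2 : |4 * ∑ e ∈ S.steps, ∑ e' ∈ S.steps, S.wt e * S.wt e' *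
      mixed (phase T lam h τ) e e' x| ≤ S.total ^ 2 * (C * (τ * h * h ^ 3)) := by
    rw [h1]
    refine S.abs_sum_sum_le fun e he e' he' => ?_
    obtain ⟨-, -, -, -, -, -, H⟩ := hB e he e' he' _ hx h hh
    simp only [Stencil.mixed_phase, map_neg, smul_neg, ← mul_add]
    rw [abs_mul, abs_of_nonneg hτ]
    calc _ ≤ τ * (C * h ^ 4) := mul_le_mul_of_nonneg_left H hτ
      _ = _ := by ring
  rw [abs_mul, abs_of_pos (by norm_num : (0 : ℝ) < 4)] at h2
  have := abs_nonneg (∑ e ∈ S.steps, ∑ e' ∈ S.steps, S.wt e * S.wt e' *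
      mixed (phase T lam h τ) e e' x)
  linarith

/-- Lower bound for the diagonal part of the commutator. -/
theorem GaussBounds.diag_ge (hB : S.GaussBounds T lam C) (hl : 0 ≤ lam) (hC : 1 ≤ C)
    (hε : 8 * C * ε ≤ 1) (hh : 0 < h) (hhε : h ≤ ε) (hτh : τ * h ≤ ε)
    (hτε : 1 ≤ ε * τ) (hτ : 0 ≤ τ) {x : G} (hx : ‖h • T x‖ ≤ 4) :
    ((τ * h) ^ 3 * h) * (4 * lam ^ 3 * gaussWeight lam (h • T x) ^ 3 * S.moment T (h • T x) *
        (4 * lam * S.moment T (h • T x) - 2 * S.trace T) -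
        S.total ^ 2 * (600 * C ^ 5 + C) * ε) ≤
      ∑ e ∈ S.steps, ∑ e' ∈ S.steps, S.wt e * S.wt e' *
        (Real.sinh (mixed (phase T lam h τ) (-e) e' (x + e)) *
          Real.cosh (phase T lam h τ (x + e + -e + e') - phase T lam h τ (x + e)) -
          τ * h * h * hess T lam (h • T (x + e)) (-e) e') := by
  set θ := phase T lam h τ with hθ
  set σ := τ * h with hσ
  set y := h • T x with hy
  have hσ0 : 0 ≤ σ := by positivity
  have hε0 : 0 ≤ ε := hσ0.trans hτh
  have hε1 : ε ≤ 1 := by nlinarith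
  have hh1 : h ∈ Set.Icc (0 : ℝ) 1 := ⟨hh.le, hhε.trans hε1⟩
  have hhσ : h ≤ ε * σ := by rw [hσ, ← mul_assoc]; exact le_mul_of_one_le_left hh.le hτε
  set p : G → ℝ := fun e => -2 * lam * ⟪y, T e⟫ * gaussWeight lam y with hp
  -- Seen from `x + e` with the first step reversed, the mixed difference changes sign and the cosh
  -- contains a difference of two increments. The Hessian terms sum to zero by oddness in `e'`.
  have hsplit : ∑ e ∈ S.steps, ∑ e' ∈ S.steps, S.wt e * S.wt e' *
        (Real.sinh (mixed θ (-e) e' (x + e)) * Real.cosh (θ (x + e + -e + e') - θ (x + e)) -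
          σ * h * hess T lam (h • T (x + e)) (-e) e') =
      -∑ e ∈ S.steps, ∑ e' ∈ S.steps, S.wt e * S.wt e' *
        (Real.sinh (mixed θ e e' x) * Real.cosh ((θ (x + e) - θ x) - (θ (x + e') - θ x))) := by
    have e1 : ∀ e e', mixed θ (-e) e' (x + e) = -mixed θ e e' x := fun e e' => by
      simp only [mixed, add_neg_cancel_right]; ring
    have e2 : ∀ e e', θ (x + e + -e + e') - θ (x + e) =
        -((θ (x + e) - θ x) - (θ (x + e') - θ x)) := fun e e' => by
      rw [add_neg_cancel_right]; ring
    have e3 : ∀ e, ∑ e' ∈ S.steps, S.wt e * S.wt e' * (σ * h * hess T lam (h • T (x + e)) (-e) e')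
        = 0 := fun e => by
      have := S.sum_hess T lam (h • T (x + e)) (-e)
      calc _ = S.wt e * (σ * h) * ∑ e' ∈ S.steps, S.wt e' * hess T lam (h • T (x + e)) (-e) e' := by
            rw [Finset.mul_sum]; exact Finset.sum_congr rfl fun e' _ => by ring
        _ = 0 := by rw [this, mul_zero]
    rw [← Finset.sum_neg_distrib]
    refine Finset.sum_congr rfl fun e _ => ?_
    simp only [mul_sub (S.wt e * _) (Real.sinh _ * _), Finset.sum_sub_distrib, e3, sub_zero]
    rw [← Finset.sum_neg_distrib]
    refine Finset.sum_congr rfl fun e' _ => ?_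
    rw [e1, e2, Real.sinh_neg, Real.cosh_neg]; ring
  rw [hsplit]
  have hest : |∑ e ∈ S.steps, ∑ e' ∈ S.steps, S.wt e * S.wt e' *
      (Real.sinh (mixed θ e e' x) * Real.cosh ((θ (x + e) - θ x) - (θ (x + e') - θ x)) -
        mixed θ e e' x - 2⁻¹ * (σ ^ 3 * h) * (hess T lam y e e' * (p e - p e') ^ 2))| ≤
      S.total ^ 2 * (600 * C ^ 5 * ε * (σ ^ 3 * h)) := by
    refine S.abs_sum_sum_le fun e he e' he' => ?_
    obtain ⟨H1, -, -, -, H5, -, -⟩ := hB e he e' he' _ hx h hh1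
    obtain ⟨H1', -, -, -, -, -, -⟩ := hB e' he' e he _ hx h hh1
    exact diag_estimate hC hε hσ0 hτh hh.le hhε H1 H1' H5 (hB.phase_step hh1 hτ hx he)
      (hB.phase_step hh1 hτ hx he') (hB.mixed_phase hh1 hτ hx he he')
  have hm := hB.sum_mixed hh1 hτ hx
  have hP := S.neg_sum_hess_mul_sq_ge T hl y
  have hexp : ∑ e ∈ S.steps, ∑ e' ∈ S.steps, S.wt e * S.wt e' *
      (Real.sinh (mixed θ e e' x) * Real.cosh ((θ (x + e) - θ x) - (θ (x + e') - θ x)) -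
        mixed θ e e' x - 2⁻¹ * (σ ^ 3 * h) * (hess T lam y e e' * (p e - p e') ^ 2)) =
      ∑ e ∈ S.steps, ∑ e' ∈ S.steps, S.wt e * S.wt e' *
        (Real.sinh (mixed θ e e' x) * Real.cosh ((θ (x + e) - θ x) - (θ (x + e') - θ x))) -
      ∑ e ∈ S.steps, ∑ e' ∈ S.steps, S.wt e * S.wt e' * mixed θ e e' x -
      (σ ^ 3 * h) * (2⁻¹ * ∑ e ∈ S.steps, ∑ e' ∈ S.steps, S.wt e * S.wt e' *
        (hess T lam y e e' * (p e - p e') ^ 2)) := by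
    simp only [Finset.mul_sum, ← Finset.sum_sub_distrib]
    exact Finset.sum_congr rfl fun e _ => Finset.sum_congr rfl fun e' _ => by ring
  rw [hexp] at hest
  have h3 : 0 ≤ σ ^ 3 * h := by positivity
  have hP2 := mul_le_mul_of_nonneg_left hP h3
  -- Since 1 ≤ ε τ gives h ≤ ε σ, the fourth order remainder σ h³ is at most ε σ³ h.
  have hsm : S.total ^ 2 * (C * (σ * h ^ 3)) ≤ S.total ^ 2 * (C * (ε * (σ ^ 3 * h))) := by
    have : h ^ 2 ≤ ε * σ ^ 2 := by
      calc h ^ 2 ≤ (ε * σ) ^ 2 := by gcongr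
        _ = ε * (ε * σ ^ 2) := by ring
        _ ≤ 1 * (ε * σ ^ 2) := by gcongr
        _ = _ := one_mul _
    have : σ * h ^ 3 ≤ ε * (σ ^ 3 * h) := by
      calc σ * h ^ 3 = σ * h * h ^ 2 := by ring
        _ ≤ σ * h * (ε * σ ^ 2) := by gcongr
        _ = _ := by ring
    gcongr
  have hm' := (abs_le.1 hm).2
  have he' := (abs_le.1 hest).2
  linarith

/-- Upper bound for the potential coming from the symmetric part. -/
theorem GaussBounds.symm_le (hB : S.GaussBounds T lam C) (hl : 0 ≤ lam) (hC : 1 ≤ C)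
    (hε : 8 * C * ε ≤ 1) (hh : 0 < h) (hhε : h ≤ ε) (hτh : τ * h ≤ ε)
    (hτε : 1 ≤ ε * τ) (hτ : 0 ≤ τ) {x : G} (hx : ‖h • T x‖ ≤ 4) {K : ℝ} (hK : 0 ≤ K)
    {κ : G → ℝ} (hκ : ∀ z, κ z = τ * h * h * K * gaussWeight lam (h • T z)) :
    (∑ e ∈ S.steps, S.wt e *
      ((Real.cosh (phase T lam h τ (x + e) - phase T lam h τ x) - 1) * (κ x + κ (x + e)) +
        (κ (x + e) - κ x))) + κ x ^ 2 ≤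
      ((τ * h) ^ 3 * h) * (4 * lam ^ 2 * gaussWeight lam (h • T x) ^ 3 * S.moment T (h • T x) * K +
        (100 * C ^ 4 * S.total * K + C * S.total * K + K ^ 2) * ε) := by
  set θ := phase T lam h τ with hθ
  set σ := τ * h with hσ
  set y := h • T x with hy
  set φ : G → ℝ := fun z => gaussWeight lam (h • T z) with hφ
  have hσ0 : 0 ≤ σ := by positivity
  have hε0 : 0 ≤ ε := hσ0.trans hτh
  have hε1 : ε ≤ 1 := by nlinarith
  have hh1 : h ∈ Set.Icc (0 : ℝ) 1 := ⟨hh.le, hhε.trans hε1⟩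
  have hhσ : h ≤ ε * σ := by rw [hσ, ← mul_assoc]; exact le_mul_of_one_le_left hh.le hτε
  have hφadd : ∀ e, φ (x + e) = gaussWeight lam (y + h • T e) := fun e => by
    simp only [hφ, map_add, smul_add, hy]
  have hφx : φ x = gaussWeight lam y := rfl
  have hφ0 : 0 < φ x := gaussWeight_pos _ _
  have hφ1 : φ x ≤ 1 := gaussWeight_le_one hl _
  have ht := S.total_nonneg
  set p : G → ℝ := fun e => -2 * lam * ⟪y, T e⟫ * gaussWeight lam y with hp
  have h1 : |∑ e ∈ S.steps, S.wt e * ((Real.cosh (θ (x + e) - θ x) - 1) * (φ x + φ (x + e)) -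
      σ ^ 2 * (φ x * p e ^ 2))| ≤ S.total * (100 * C ^ 4 * ε * σ ^ 2) := by
    refine S.abs_sum_le fun e he => ?_
    obtain ⟨H1, H2, -⟩ := hB e he e he _ hx h hh1
    exact symm_estimate hC hε hσ0 hτh hh.le hhε H1 (hB.phase_step hh1 hτ hx he) hφ0.le hφ1
      (by rw [hφadd]; exact H2)
  -- Pairing each step with its reflection turns first differences into second differences, of size
  -- h² instead of h.
  have h2 : |2 * ∑ e ∈ S.steps, S.wt e * (φ (x + e) - φ x)| ≤ S.total * (C * h ^ 2) := by
    rw [S.two_mul_sum]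
    refine S.abs_sum_le fun e he => ?_
    obtain ⟨-, -, -, H, -⟩ := hB e he e he _ hx h hh1
    convert H using 2
    rw [hφadd, hφadd, hφx, map_neg, smul_neg]; ring
  have h3 : ∑ e ∈ S.steps, S.wt e * (σ ^ 2 * (φ x * p e ^ 2)) =
      σ ^ 2 * (4 * lam ^ 2 * φ x ^ 3 * S.moment T y) := by
    rw [moment, Finset.mul_sum, Finset.mul_sum]
    refine Finset.sum_congr rfl fun e _ => ?_
    simp only [hp, ← hφx]; ring
  have h4 : ∑ e ∈ S.steps, S.wt e * ((Real.cosh (θ (x + e) - θ x) - 1) * (κ x + κ (x + e)) +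
        (κ (x + e) - κ x)) = σ * h * K *
      (∑ e ∈ S.steps, S.wt e * ((Real.cosh (θ (x + e) - θ x) - 1) * (φ x + φ (x + e)) -
        σ ^ 2 * (φ x * p e ^ 2)) + ∑ e ∈ S.steps, S.wt e * (σ ^ 2 * (φ x * p e ^ 2)) +
        ∑ e ∈ S.steps, S.wt e * (φ (x + e) - φ x)) := by
    rw [← Finset.sum_add_distrib, ← Finset.sum_add_distrib, Finset.mul_sum]
    refine Finset.sum_congr rfl fun e _ => ?_
    rw [hκ, hκ]; ring
  have h5 : κ x ^ 2 ≤ σ ^ 3 * h * (K ^ 2 * ε) := by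
    rw [hκ]
    calc (σ * h * K * φ x) ^ 2 = σ ^ 2 * h * K ^ 2 * h * (φ x) ^ 2 := by ring
      _ ≤ σ ^ 2 * h * K ^ 2 * (ε * σ) * 1 ^ 2 := by gcongr
      _ = _ := by ring
  have h6 : h ^ 2 ≤ ε * σ ^ 2 := by
    calc h ^ 2 ≤ (ε * σ) ^ 2 := by gcongr
      _ = ε * (ε * σ ^ 2) := by ring
      _ ≤ 1 * (ε * σ ^ 2) := by gcongr
      _ = _ := one_mul _
  have h7 : S.total * (C * h ^ 2) ≤ S.total * (C * (ε * σ ^ 2)) := by gcongr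
  have h8 : ∑ e ∈ S.steps, S.wt e * (φ (x + e) - φ x) ≤ S.total * (C * (ε * σ ^ 2)) := by
    have := (abs_le.1 h2).2
    have h0 : 0 ≤ S.total * (C * (ε * σ ^ 2)) := by positivity
    linarith
  rw [h4, h3]
  have h9 := mul_le_mul_of_nonneg_left
    (add_le_add (add_le_add_left (abs_le.1 h1).2 (σ ^ 2 * (4 * lam ^ 2 * φ x ^ 3 * S.moment T y)))
      h8) (show 0 ≤ σ * h * K by positivity)
  rw [← hφx]
  linarith

end

end Stencil

/-! ### The Carleman estimate for stencils. -/

namespace Stencil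

variable {G : Type*} [AddCommGroup G] (S : Stencil G)
variable {Y : Type*} [NormedAddCommGroup Y] [InnerProductSpace ℝ Y] (T : G →+ Y)
variable {lam C ε h τ : ℝ} {S T}

/-- The off-diagonal part of the commutator is controlled by the differences. -/
theorem GaussBounds.offdiag_le (hB : S.GaussBounds T lam C) (hC : 1 ≤ C)
    (hε : 8 * C * ε ≤ 1) (hh : 0 < h) (hhε : h ≤ ε) (hτh : τ * h ≤ ε)
    (hτ : 0 ≤ τ) {x : G} (hx : ‖h • T x‖ ≤ 4) (c : G → ℝ) (c0 : ℝ) :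
    2⁻¹ * ∑ e ∈ S.steps, ∑ e' ∈ S.steps, S.wt e * S.wt e' *
        ((Real.sinh (mixed (phase T lam h τ) e e' x) *
          Real.cosh (phase T lam h τ (x + e + e') - phase T lam h τ x) -
          τ * h * h * hess T lam (h • T x) e e') * (c e - c e') ^ 2) ≤
      (τ * h * h) * (400 * C ^ 3 * S.total * ε) * ∑ e ∈ S.steps, S.wt e * (c e - c0) ^ 2 := by
  have hε0 : 0 ≤ ε := hh.le.trans hhε
  have hε1 : ε ≤ 1 := by nlinarith
  have hh1 : h ∈ Set.Icc (0 : ℝ) 1 := ⟨hh.le, hhε.trans hε1⟩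
  have hσ0 : 0 ≤ τ * h := by positivity
  set B := 200 * C ^ 3 * ε * (τ * h * h) with hBdef
  have hB0 : 0 ≤ B := by positivity
  set D := ∑ e ∈ S.steps, S.wt e * (c e - c0) ^ 2 with hD
  have h1 : ∑ e ∈ S.steps, ∑ e' ∈ S.steps, S.wt e * S.wt e' *
        ((Real.sinh (mixed (phase T lam h τ) e e' x) *
          Real.cosh (phase T lam h τ (x + e + e') - phase T lam h τ x) -
          τ * h * h * hess T lam (h • T x) e e') * (c e - c e') ^ 2) ≤
      ∑ e ∈ S.steps, ∑ e' ∈ S.steps, S.wt e * S.wt e' *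
        (B * (2 * (c e - c0) ^ 2 + 2 * (c e' - c0) ^ 2)) := by
    refine Finset.sum_le_sum fun e he => Finset.sum_le_sum fun e' he' => ?_
    refine mul_le_mul_of_nonneg_left ?_ (mul_nonneg (S.wt_nonneg e) (S.wt_nonneg e'))
    obtain ⟨H1, -, -, -, H5, -, -⟩ := hB e he e' he' _ hx h hh1
    obtain ⟨H1', -, -, -, -, -, -⟩ := hB e' he' e he _ hx h hh1
    have h2 := coeff_estimate hC hε hσ0 hτh hh.le hhε H1 H1' H5 (hB.phase_step hh1 hτ hx he)
      (hB.phase_step hh1 hτ hx he') (hB.mixed_phase hh1 hτ hx he he')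
    have h3 : (phase T lam h τ (x + e) - phase T lam h τ x) +
        (phase T lam h τ (x + e') - phase T lam h τ x) + mixed (phase T lam h τ) e e' x =
        phase T lam h τ (x + e + e') - phase T lam h τ x := by unfold mixed; ring
    rw [h3] at h2
    refine mul_le_mul ((le_abs_self _).trans h2) ?_ (sq_nonneg _) hB0
    nlinarith [sq_nonneg ((c e - c0) + (c e' - c0))]
  have h2 : ∑ e ∈ S.steps, ∑ e' ∈ S.steps, S.wt e * S.wt e' *
        (B * (2 * (c e - c0) ^ 2 + 2 * (c e' - c0) ^ 2)) = 4 * B * S.total * D := by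
    have a1 : ∑ e ∈ S.steps, ∑ e' ∈ S.steps, (S.wt e * (c e - c0) ^ 2) * S.wt e' = D * S.total := by
      rw [← Finset.sum_mul_sum, hD, total]
    have a2 : ∑ e ∈ S.steps, ∑ e' ∈ S.steps, S.wt e * (S.wt e' * (c e' - c0) ^ 2) = S.total * D := by
      rw [← Finset.sum_mul_sum, hD, total]
    calc _ = 2 * B * (∑ e ∈ S.steps, ∑ e' ∈ S.steps, (S.wt e * (c e - c0) ^ 2) * S.wt e') +
        2 * B * (∑ e ∈ S.steps, ∑ e' ∈ S.steps, S.wt e * (S.wt e' * (c e' - c0) ^ 2)) := by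
          simp only [Finset.mul_sum, ← Finset.sum_add_distrib]
          exact Finset.sum_congr rfl fun e _ => Finset.sum_congr rfl fun e' _ => by ring
      _ = _ := by rw [a1, a2]; ring
  rw [h2] at h1
  calc _ ≤ 2⁻¹ * (4 * B * S.total * D) := by gcongr
    _ = _ := by rw [hBdef]; ring

/-- The Carleman estimate with all smallness conditions explicit. -/
theorem GaussBounds.carleman (hB : S.GaussBounds T lam C) (hl : 0 < lam) (hC : 1 ≤ C)
    (hε : 8 * C * ε ≤ 1) (hh : 0 < h) (hhε : h ≤ ε) (hτh : τ * h ≤ ε)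
    (hτε : 1 ≤ ε * τ) (hstep : ∀ e ∈ S.steps, ε * ‖T e‖ ≤ 1) {b c : ℝ} (hb : 0 ≤ b)
    (hlam : 1 ≤ 4 * lam * b - (4 * S.trace T + 1))
    (hε1 : 400 * C ^ 3 * S.total * ε ≤ lam * Real.exp (-lam * 16))
    (hε2 : c + (S.total ^ 2 * (600 * C ^ 5 + C) +
      (100 * C ^ 4 * S.total * ((2 * S.trace T + 1) * lam) +
        C * S.total * ((2 * S.trace T + 1) * lam) + ((2 * S.trace T + 1) * lam) ^ 2)) * ε ≤
      4 * lam ^ 3 * Real.exp (-lam * 16) ^ 3 * b)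
    {f : G → ℝ} {Ω : Finset G} (hcov : S.Covers f Ω)
    (hsupp : ∀ x, f x ≠ 0 → ‖h • T x‖ ≤ 3 ∧ b ≤ S.moment T (h • T x)) :
    c * (τ ^ 3 * h ^ 4) * ∑ x ∈ Ω, (Real.exp (phase T lam h τ x) * f x) ^ 2 ≤
      ∑ x ∈ Ω, (Real.exp (phase T lam h τ x) * S.lap f x) ^ 2 := by
  have hε0 : 0 < ε := hh.trans_le hhε
  have hτ : 0 ≤ τ := by
    by_contra hneg
    nlinarith
  set θ := phase T lam h τ with hθ
  set g : G → ℝ := fun z => Real.exp (θ z) * f z with hg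
  -- The part `2 * S.trace T * lam` compensates the loss in `sum_hess_mul_ge`; the additional `lam`
  -- absorbs the off-diagonal error.
  set K := (2 * S.trace T + 1) * lam with hK
  have htr := S.trace_nonneg T
  have hK0 : 0 ≤ K := by positivity
  set κ : G → ℝ := fun z => τ * h * h * K * gaussWeight lam (h • T z) with hκ
  have hcg : S.Covers g Ω := fun x hx => hcov x (right_ne_zero_of_mul hx)
  have hσ0 : 0 ≤ τ * h * h := by positivity
  have hmain := S.sum_sq_exp_mul_lap_ge (θ := θ) (κ := κ) hcov
  refine le_trans ?_ hmain
  -- `R` is the commutator coefficient without its leading Hessian part. The Hessian part is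
  -- estimated directly as a quadratic form, and only `R` is polarised.
  set R : G → G → G → ℝ := fun e e' x => Real.sinh (mixed θ e e' x) *
    Real.cosh (θ (x + e + e') - θ x) - τ * h * h * hess T lam (h • T x) e e' with hR
  have hRsymm : ∀ e e' x, R e e' x = R e' e x := fun e e' x => by
    have e1 : mixed θ e e' x = mixed θ e' e x := by
      simp only [mixed, add_right_comm x e e']; ring
    simp only [hR, e1, hess_comm T lam _ e e', add_right_comm x e e']
  have hquad := sum_quadratic_eq hcg R hRsymm
  have hsplit : ∑ x ∈ Ω, ∑ e ∈ S.steps, ∑ e' ∈ S.steps, S.wt e * S.wt e' *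
        (Real.sinh (mixed θ e e' x) * Real.cosh (θ (x + e + e') - θ x) *
          (g (x + e) * g (x + e'))) =
      ∑ x ∈ Ω, (τ * h * h) * ∑ e ∈ S.steps, ∑ e' ∈ S.steps, S.wt e * S.wt e' *
        (hess T lam (h • T x) e e' * (g (x + e) * g (x + e'))) +
      ∑ x ∈ Ω, ∑ e ∈ S.steps, ∑ e' ∈ S.steps, S.wt e * S.wt e' *
        (R e e' x * (g (x + e) * g (x + e'))) := by
    rw [← Finset.sum_add_distrib]
    refine Finset.sum_congr rfl fun x _ => ?_
    simp only [Finset.mul_sum, ← Finset.sum_add_distrib]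
    exact Finset.sum_congr rfl fun e _ => Finset.sum_congr rfl fun e' _ => by rw [hR]; ring
  rw [hsplit, hquad, Finset.mul_sum (s := Ω), Finset.mul_sum (s := Ω), ← Finset.sum_sub_distrib,
    ← Finset.sum_add_distrib, ← Finset.sum_add_distrib, ← Finset.sum_sub_distrib]
  refine Finset.sum_le_sum fun x _ => ?_
  by_cases hx : ‖h • T x‖ ≤ 4
  · set D := ∑ e ∈ S.steps, S.wt e * (g (x + e) - g x) ^ 2 with hD
    have hD0 : 0 ≤ D := Finset.sum_nonneg fun e _ => mul_nonneg (S.wt_nonneg e) (sq_nonneg _)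
    set φ := gaussWeight lam (h • T x) with hφ
    have hφ0 : 0 < φ := gaussWeight_pos _ _
    have hφm : Real.exp (-lam * 16) ≤ φ := by
      rw [hφ, gaussWeight]
      apply Real.exp_le_exp.2
      have : ‖h • T x‖ ^ 2 ≤ 4 ^ 2 := by gcongr
      nlinarith
    have hm0 : 0 < Real.exp (-lam * 16) := Real.exp_pos _
    have i1 := mul_le_mul_of_nonneg_left
      (S.sum_hess_mul_ge T hl.le (h • T x) (fun e => g (x + e)) (g x)) hσ0
    have i2 := hB.offdiag_le hC hε hh hhε hτh hτ hx (fun e => g (x + e)) (g x)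
    have i3 : κ x * D ≤ κ x * ∑ e ∈ S.steps, S.wt e *
        (Real.cosh (θ (x + e) - θ x) * (g (x + e) - g x) ^ 2) := by
      refine mul_le_mul_of_nonneg_left (Finset.sum_le_sum fun e _ => ?_) (by positivity)
      exact mul_le_mul_of_nonneg_left
        (le_mul_of_one_le_left (sq_nonneg _) (Real.one_le_cosh _)) (S.wt_nonneg e)
    have i4 : 0 ≤ (τ * h * h) * (D * (lam * φ - 400 * C ^ 3 * S.total * ε)) := by
      have : lam * Real.exp (-lam * 16) ≤ lam * φ := by gcongr
      have h' : 0 ≤ lam * φ - 400 * C ^ 3 * S.total * ε := by linarith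
      positivity
    have i5 : κ x = τ * h * h * ((2 * S.trace T + 1) * lam) * φ := rfl
    have i6 : c * (τ ^ 3 * h ^ 4) * g x ^ 2 ≤
        (∑ e ∈ S.steps, ∑ e' ∈ S.steps, S.wt e * S.wt e' * R (-e) e' (x + e)) * g x ^ 2 -
        (∑ e ∈ S.steps, S.wt e * ((Real.cosh (θ (x + e) - θ x) - 1) * (κ x + κ (x + e)) +
          (κ (x + e) - κ x)) + κ x ^ 2) * g x ^ 2 := by
      by_cases hgx : g x = 0
      · simp [hgx]
      · obtain ⟨-, hbx⟩ := hsupp x (right_ne_zero_of_mul hgx)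
        have j1 := hB.diag_ge hl.le hC hε hh hhε hτh hτε hτ hx
        have j2 := hB.symm_le hl.le hC hε hh hhε hτh hτε hτ hx hK0 (κ := κ) (fun z => rfl)
        rw [← sub_mul]
        refine mul_le_mul_of_nonneg_right ?_ (sq_nonneg _)
        set m := S.moment T (h • T x) with hm
        have j3 : 4 * lam ^ 3 * Real.exp (-lam * 16) ^ 3 * b ≤ 4 * lam ^ 3 * φ ^ 3 * m := by
          gcongr
        -- The main term carries the factor 4 lam m - 2 trace, and the potential created by κ
        -- removes 2 trace + 1 from it. By `hlam` and b ≤ m at least 1 is left.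
        have j4 : 4 * lam ^ 3 * φ ^ 3 * m * 1 ≤
            4 * lam ^ 3 * φ ^ 3 * m * (4 * lam * m - (4 * S.trace T + 1)) := by
          have hm0 : 0 ≤ m := hb.trans hbx
          have : 4 * lam * b ≤ 4 * lam * m := by gcongr
          refine mul_le_mul_of_nonneg_left (by linarith) (by positivity)
        have j5 : c ≤ (4 * lam ^ 3 * φ ^ 3 * m * (4 * lam * m - 2 * S.trace T) -
            S.total ^ 2 * (600 * C ^ 5 + C) * ε) - (4 * lam ^ 2 * φ ^ 3 * m * K +
            (100 * C ^ 4 * S.total * K + C * S.total * K + K ^ 2) * ε) := by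
          rw [hK] at *
          linarith
        have j6 := mul_le_mul_of_nonneg_left j5 (show 0 ≤ (τ * h) ^ 3 * h by positivity)
        have j7 : c * (τ ^ 3 * h ^ 4) = (τ * h) ^ 3 * h * c := by ring
        rw [j7]
        refine j6.trans ?_
        rw [mul_sub]
        exact sub_le_sub j1 j2
    rw [i5] at i3
    have i7 : c * (τ ^ 3 * h ^ 4) * (Real.exp (θ x) * f x) ^ 2 = c * (τ ^ 3 * h ^ 4) * g x ^ 2 := rfl
    rw [i7]
    linarith
  -- Beyond radius 4 the function `g` vanishes at `x` and at all points one step away, so every term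
  -- is zero.
  · have hz : ∀ z, g z ≠ 0 → ‖h • T z‖ ≤ 3 := fun z hz => (hsupp z (right_ne_zero_of_mul hz)).1
    have h0 : g x = 0 := by
      by_contra hne
      exact hx ((hz x hne).trans (by norm_num))
    have h1 : ∀ e ∈ S.steps, g (x + e) = 0 := fun e he => by
      by_contra hne
      apply hx
      have h2 := hz _ hne
      have h3 : h • T x = h • T (x + e) - h • T e := by rw [map_add, smul_add]; abel
      rw [h3]
      refine (norm_sub_le _ _).trans ?_
      have h4 : ‖h • T e‖ ≤ 1 := by
        rw [norm_smul, Real.norm_of_nonneg hh.le]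
        exact (mul_le_mul_of_nonneg_right hhε (norm_nonneg _)).trans (hstep e he)
      linarith
    have h0' : Real.exp (θ x) * f x = 0 := h0
    rw [h0', h0]
    have z1 : ∑ e ∈ S.steps, ∑ e' ∈ S.steps, S.wt e * S.wt e' *
        (hess T lam (h • T x) e e' * (g (x + e) * g (x + e'))) = 0 :=
      Finset.sum_eq_zero fun e he => Finset.sum_eq_zero fun e' _ => by rw [h1 e he]; ring
    have z2 : ∑ e ∈ S.steps, ∑ e' ∈ S.steps, S.wt e * S.wt e' *
        (R e e' x * (g (x + e) - g (x + e')) ^ 2) = 0 :=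
      Finset.sum_eq_zero fun e he => Finset.sum_eq_zero fun e' he' => by
        rw [h1 e he, h1 e' he']; ring
    have z3 : ∑ e ∈ S.steps, S.wt e * (Real.cosh (θ (x + e) - θ x) *
        (Real.exp (θ (x + e)) * f (x + e) - 0) ^ 2) = 0 :=
      Finset.sum_eq_zero fun e he => by
        have : Real.exp (θ (x + e)) * f (x + e) = 0 := h1 e he
        rw [this]; ring
    rw [z1, z2, z3]; simp

/-- Carleman estimate for a stencil Laplacian at mesh size `h`. -/
theorem exists_carleman [FiniteDimensional ℝ Y] (S : Stencil G) (T : G →+ Y) {b : ℝ} (hb : 0 < b) :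
    ∃ lam c ε : ℝ, 0 < lam ∧ 0 < c ∧ 0 < ε ∧ ε ≤ 1 ∧ (∀ e ∈ S.steps, ε * ‖T e‖ ≤ 1) ∧
      ∀ h τ : ℝ, 0 < h → h ≤ ε → τ * h ≤ ε → 1 ≤ ε * τ →
        (∀ e ∈ S.steps, ∀ x, ‖h • T x‖ ≤ 4 →
          |phase T lam h τ (x + e) - phase T lam h τ x| ≤ 1) ∧
        ∀ (f : G → ℝ) (Ω : Finset G),
        S.Covers f Ω → (∀ x, f x ≠ 0 → ‖h • T x‖ ≤ 3 ∧ b ≤ S.moment T (h • T x)) →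
        c * (τ ^ 3 * h ^ 4) * ∑ x ∈ Ω, (Real.exp (phase T lam h τ x) * f x) ^ 2 ≤
          ∑ x ∈ Ω, (Real.exp (phase T lam h τ x) * S.lap f x) ^ 2 := by
  have htr := S.trace_nonneg T
  have ht := S.total_nonneg
  obtain ⟨lam, hl, hlam⟩ : ∃ lam : ℝ, 0 < lam ∧ 1 ≤ 4 * lam * b - (4 * S.trace T + 1) := by
    -- This is the value of `lam` giving equality.
    refine ⟨(4 * S.trace T + 2) / (4 * b), by positivity, le_of_eq ?_⟩
    field_simp; ring
  obtain ⟨C, hC, hB⟩ := S.exists_gauss_bounds T lam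
  obtain ⟨B, hB0, hBe⟩ := exists_common_bound S.steps (fun e C => ‖T e‖ ≤ C)
    (fun e C C' h1 h2 => h2.trans h1) (fun e _ => ⟨‖T e‖, norm_nonneg _, le_rfl⟩)
  set P := S.total ^ 2 * (600 * C ^ 5 + C) +
      (100 * C ^ 4 * S.total * ((2 * S.trace T + 1) * lam) +
        C * S.total * ((2 * S.trace T + 1) * lam) + ((2 * S.trace T + 1) * lam) ^ 2) with hP
  have hP0 : 0 ≤ P := by positivity
  set m := lam * Real.exp (-lam * 16) with hm
  have hm0 : 0 < m := by positivity
  -- Half of the main term; the other half absorbs the errors collected in `P`.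
  set q := 2 * lam ^ 3 * Real.exp (-lam * 16) ^ 3 * b with hq
  have hq0 : 0 < q := by positivity
  -- The smallness parameter will be the inverse of `Z`, the sum of all lower bounds required of
  -- that inverse.
  set Z := 8 * C + B + 400 * C ^ 3 * S.total / m + P / q with hZ
  have hZ1 : 8 * C ≤ Z := by
    have : 0 ≤ 400 * C ^ 3 * S.total / m + P / q := by positivity
    linarith
  have hZ2 : B ≤ Z := by
    have : 0 ≤ 400 * C ^ 3 * S.total / m + P / q := by positivity
    linarith
  have hZ3 : 400 * C ^ 3 * S.total / m ≤ Z := by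
    have : 0 ≤ P / q := by positivity
    linarith
  have hZ4 : P / q ≤ Z := by
    have : 0 ≤ 400 * C ^ 3 * S.total / m := by positivity
    linarith
  have hZ0 : 0 < Z := by linarith
  have key : ∀ {a : ℝ}, a ≤ Z → a * Z⁻¹ ≤ 1 := fun ha => by
    rw [← div_eq_mul_inv]; exact (div_le_one hZ0).2 ha
  have hε1 : Z⁻¹ ≤ 1 := inv_le_one_of_one_le₀ (by linarith)
  have hstep : ∀ e ∈ S.steps, Z⁻¹ * ‖T e‖ ≤ 1 := fun e he => by
    rw [mul_comm]; exact key ((hBe e he).trans hZ2)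
  refine ⟨lam, q, Z⁻¹, hl, hq0, by positivity, hε1, hstep,
    fun h τ hh hhε hτh hτε => ⟨fun e he x hx => ?_, fun f Ω hcov hsupp => ?_⟩⟩
  · obtain ⟨-, H, -⟩ := hB e he e he _ hx h ⟨hh.le, hhε.trans hε1⟩
    have hτ : 0 ≤ τ := by
      by_contra hneg
      push Not at hneg
      have : Z⁻¹ * τ < 0 := mul_neg_of_pos_of_neg (by positivity) hneg
      linarith
    rw [phase_add, phase, ← mul_sub, abs_mul, abs_of_nonneg hτ]
    calc _ ≤ τ * (C * h) := mul_le_mul_of_nonneg_left H hτ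
      _ = C * (τ * h) := by ring
      _ ≤ C * Z⁻¹ := by gcongr
      _ ≤ 1 := key (by linarith)
  refine GaussBounds.carleman hB hl hC (key hZ1) hh hhε hτh hτε hstep hb.le hlam ?_ ?_ hcov hsupp
  · have := key hZ3
    rw [div_mul_eq_mul_div, div_le_one hm0] at this
    exact this
  · have := key hZ4
    rw [div_mul_eq_mul_div, div_le_one hq0] at this
    linarith

end Stencil

/-! ### Summation by parts and the Caccioppoli inequality. -/

namespace Stencil

variable {G : Type*} [AddCommGroup G] {S : Stencil G}

theorem Covers.sum_add_eq {w q : G → ℝ} {Ω : Finset G} (h : S.Covers w Ω)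
    (hq : ∀ x, w x = 0 → q x = 0) {e : G} (he : e ∈ S.steps) :
    ∑ x ∈ Ω, q (x + e) = ∑ x ∈ Ω, q x :=
  sum_shift Ω q e (fun x hx => (h x (mt (hq x) hx)).1) (fun _ hx => h.sub_mem (mt (hq _) hx) he)

/-- Summation by parts. -/
theorem Covers.green {u v : G → ℝ} {Ω : Finset G} (h : S.Covers u Ω)
    (hv : ∀ x, u x = 0 → v x = 0) :
    ∑ x ∈ Ω, ∑ e ∈ S.steps, S.wt e * ((u (x + e) - u x) * (v (x + e) - v x)) =
      -(2 * ∑ x ∈ Ω, v x * S.lap u x) := by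
  have h1 : ∑ x ∈ Ω, ∑ e ∈ S.steps, S.wt e * ((u (x + e) - u x) * v (x + e)) =
      -∑ x ∈ Ω, ∑ e ∈ S.steps, S.wt e * ((u (x + e) - u x) * v x) := by
    rw [Finset.sum_comm, Finset.sum_comm (s := Ω), ← S.sum_neg, ← Finset.sum_neg_distrib]
    refine Finset.sum_congr rfl fun e he => ?_
    have h2 : ∑ x ∈ Ω, S.wt (-e) * ((u (x + -e) - u x) * v (x + -e)) =
        ∑ x ∈ Ω, S.wt (-e) * ((u x - u (x + e)) * v x) := by
      rw [← sum_shift Ω (fun x => S.wt (-e) * ((u x - u (x + e)) * v x)) (-e)]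
      · simp
      · intro x hx
        exact (h x (fun h0 => by simp [hv x h0] at hx)).1
      · intro x hx
        rw [sub_neg_eq_add]
        exact (h x (fun h0 => by simp [hv x h0] at hx)).2 e he
    rw [h2, ← Finset.sum_neg_distrib]
    exact Finset.sum_congr rfl fun x _ => by rw [S.wt_neg]; ring
  have h3 : ∑ x ∈ Ω, ∑ e ∈ S.steps, S.wt e * ((u (x + e) - u x) * v x) =
      ∑ x ∈ Ω, v x * S.lap u x := by
    refine Finset.sum_congr rfl fun x _ => ?_
    rw [lap, Finset.mul_sum]; exact Finset.sum_congr rfl fun e _ => by ring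
  simp only [mul_sub (_ - _), mul_sub (S.wt _), Finset.sum_sub_distrib] at h1 h3 ⊢
  linarith

variable {Y : Type*} [NormedAddCommGroup Y] [InnerProductSpace ℝ Y]

/-- The sum of `w²` over the points of `Ω` whose position at mesh size `h` has norm at most `r`. -/
noncomputable def ballMass (T : G →+ Y) (h : ℝ) (w : G → ℝ) (Ω : Finset G) (r : ℝ) : ℝ :=
  ∑ x ∈ Ω, if ‖h • T x‖ ≤ r then w x ^ 2 else 0

theorem ballMass_nonneg (T : G →+ Y) (h : ℝ) (w : G → ℝ) (Ω : Finset G) (r : ℝ) :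
    0 ≤ ballMass T h w Ω r :=
  Finset.sum_nonneg fun x _ => by split_ifs <;> positivity

/-- The local energy density of `w` at `x`. -/
def energy (S : Stencil G) (h : ℝ) (w : G → ℝ) (x : G) : ℝ :=
  h ^ 2 * ∑ e ∈ S.steps, w (x + e) ^ 2 + ∑ e ∈ S.steps, S.wt e * (w (x + e) - w x) ^ 2

theorem energy_nonneg (S : Stencil G) (h : ℝ) (w : G → ℝ) (x : G) : 0 ≤ S.energy h w x :=
  add_nonneg (mul_nonneg (sq_nonneg _) (Finset.sum_nonneg fun _ _ => sq_nonneg _))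
    (Finset.sum_nonneg fun e _ => mul_nonneg (S.wt_nonneg e) (sq_nonneg _))

theorem abs_clamp_sub_le (a b : ℝ) : |max 0 (min 1 a) - max 0 (min 1 b)| ≤ |a - b| :=
  (abs_max_sub_max_le_abs _ _ _).trans (by
    rw [min_comm 1 a, min_comm 1 b]; exact abs_min_sub_min_le_abs _ _ _)
where
  abs_max_sub_max_le_abs (a b c : ℝ) : |max a b - max a c| ≤ |b - c| := by
    rw [max_comm a b, max_comm a c]; exact _root_.abs_max_sub_max_le_abs b c a
  abs_min_sub_min_le_abs (a b c : ℝ) : |min b a - min c a| ≤ |b - c| := by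
    have := _root_.abs_max_sub_max_le_abs (-b) (-c) (-a)
    rw [max_neg_neg, max_neg_neg] at this
    have e1 : -min b a - -min c a = -(min b a - min c a) := by ring
    have e2 : -b - -c = -(b - c) := by ring
    rwa [e1, e2, abs_neg, abs_neg] at this

/-- Caccioppoli inequality: the energy on a ball is controlled by the mass of a larger ball. -/
theorem exists_caccioppoli (S : Stencil G) (T : G →+ Y) {A : ℝ} (hA : 0 ≤ A) {r R : ℝ} (hrR : r < R) :
    ∃ C ε : ℝ, 0 ≤ C ∧ 0 < ε ∧ ∀ h, 0 < h → h ≤ ε → ∀ (w : G → ℝ) (Ω : Finset G), S.Covers w Ω →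
      (∀ x, ‖h • T x‖ ≤ R → |S.lap w x| ≤ A * h ^ 2 * ∑ e ∈ S.steps, |w (x + e)|) →
      ∑ x ∈ Ω, (if ‖h • T x‖ ≤ r then S.energy h w x else 0) ≤ C * h ^ 2 * ballMass T h w Ω R := by
  obtain ⟨B, hB0, hB⟩ := exists_common_bound S.steps (fun e C => ‖T e‖ ≤ C)
    (fun e C C' h1 h2 => h2.trans h1) (fun e _ => ⟨‖T e‖, norm_nonneg _, le_rfl⟩)
  -- The cutoff falls from 1 at radius r to 0 at radius r + δ. The remaining δ leaves room for one
  -- step inside radius R.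
  set δ := (R - r) / 2 with hδ
  have hδ0 : 0 < δ := by rw [hδ]; linarith
  set L := B / δ with hL
  have hL0 : 0 ≤ L := by positivity
  set n : ℝ := (S.steps.card : ℝ) with hn
  have ht := S.total_nonneg
  refine ⟨n + (2 * (L ^ 2 * S.total + 2 * A * n) + 2 * L ^ 2 * S.total), δ / (B + 1),
    by positivity, by positivity, fun h hh hhε w Ω hcov heq => ?_⟩
  have hstep : ∀ e ∈ S.steps, ‖h • T e‖ ≤ h * B := fun e he => by
    rw [norm_smul, Real.norm_of_nonneg hh.le]; gcongr; exact hB e he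
  have hBδ : h * B ≤ δ := by
    have h1 : h * (B + 1) ≤ δ := (le_div_iff₀ (by positivity)).1 hhε
    nlinarith
  have hmove : ∀ x, ∀ e ∈ S.steps, |‖h • T (x + e)‖ - ‖h • T x‖| ≤ h * B := fun x e he => by
    refine (abs_norm_sub_norm_le _ _).trans ?_
    rw [map_add, smul_add, add_sub_cancel_left]; exact hstep e he
  set q : G → ℝ := fun x => if ‖h • T x‖ ≤ R then w x ^ 2 else 0 with hq
  have hq0 : ∀ x, 0 ≤ q x := fun x => by simp only [hq]; split_ifs <;> positivity
  have hqsum : ∀ e ∈ S.steps, ∑ x ∈ Ω, q (x + e) = ballMass T h w Ω R := fun e he =>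
    hcov.sum_add_eq (q := q) (fun x hx => by simp [hq, hx]) he
  have hqR : ∀ x, ‖h • T x‖ ≤ R → q x = w x ^ 2 := fun x hx => by simp [hq, hx]
  set m := ballMass T h w Ω R with hm
  have hm0 : 0 ≤ m := ballMass_nonneg _ _ _ _ _
  have hwt : ∀ k : G → G → ℝ, (∀ e ∈ S.steps, ∑ x ∈ Ω, k e x ≤ m) →
      ∑ x ∈ Ω, ∑ e ∈ S.steps, S.wt e * k e x ≤ S.total * m := fun k hk => by
    rw [Finset.sum_comm, total, Finset.sum_mul]
    refine Finset.sum_le_sum fun e he => ?_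
    rw [← Finset.mul_sum]; exact mul_le_mul_of_nonneg_left (hk e he) (S.wt_nonneg e)
  have hcard : ∀ k : G → G → ℝ, (∀ e ∈ S.steps, ∑ x ∈ Ω, k e x ≤ m) →
      ∑ x ∈ Ω, ∑ e ∈ S.steps, k e x ≤ n * m := fun k hk => by
    rw [Finset.sum_comm, hn, ← nsmul_eq_mul]
    exact Finset.sum_le_card_nsmul _ _ _ hk
  set ζ : G → ℝ := fun x => max 0 (min 1 ((r + δ - ‖h • T x‖) / δ)) with hζ
  have hζ0 : ∀ x, 0 ≤ ζ x := fun x => le_max_left _ _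
  have hζ1 : ∀ x, ζ x ≤ 1 := fun x => max_le zero_le_one (min_le_left _ _)
  have hζr : ∀ x, ‖h • T x‖ ≤ r → ζ x = 1 := fun x hx => by
    have : 1 ≤ (r + δ - ‖h • T x‖) / δ := by rw [le_div_iff₀ hδ0]; linarith
    simp only [hζ]; rw [min_eq_left this]; simp
  have hζR : ∀ x, ζ x ≠ 0 → ‖h • T x‖ ≤ r + δ := fun x hx => by
    by_contra hlt
    push Not at hlt
    apply hx
    have : (r + δ - ‖h • T x‖) / δ ≤ 0 := div_nonpos_of_nonpos_of_nonneg (by linarith) hδ0.le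
    simp only [hζ]
    exact max_eq_left ((min_le_right _ _).trans this)
  have hRr : r + δ + δ = R := by rw [hδ]; ring
  have hζL : ∀ x, ∀ e ∈ S.steps, |ζ (x + e) - ζ x| ≤ L * h := fun x e he => by
    refine (abs_clamp_sub_le _ _).trans ?_
    rw [← sub_div, abs_div, abs_of_pos hδ0, hL, div_mul_eq_mul_div]
    gcongr
    rw [sub_sub_sub_cancel_left, abs_sub_comm, mul_comm]
    exact hmove x e he
  have hζq : ∀ x, ∀ e ∈ S.steps, (ζ (x + e) - ζ x) ^ 2 * w (x + e) ^ 2 ≤ (L * h) ^ 2 * q (x + e) ∧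
      (ζ (x + e) - ζ x) ^ 2 * w x ^ 2 ≤ (L * h) ^ 2 * q x := fun x e he => by
    by_cases h0 : ζ (x + e) - ζ x = 0
    · rw [h0]
      constructor <;> (have := hq0 x; have := hq0 (x + e); ring_nf; positivity)
    · have hmv := abs_le.1 (hmove x e he)
      have hboth : ‖h • T (x + e)‖ ≤ R ∧ ‖h • T x‖ ≤ R := by
        by_cases h1 : ζ x = 0
        · have h2 : ζ (x + e) ≠ 0 := fun h2 => h0 (by rw [h1, h2, sub_zero])
          have := hζR _ h2
          constructor <;> linarith [hmv.1, hmv.2]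
        · have := hζR _ h1
          constructor <;> linarith [hmv.1, hmv.2]
      have hs : (ζ (x + e) - ζ x) ^ 2 ≤ (L * h) ^ 2 := by
        rw [← sq_abs]; gcongr; exact hζL x e he
      rw [hqR _ hboth.1, hqR _ hboth.2]
      constructor <;> gcongr
  have hG := hcov.green (v := fun x => ζ x ^ 2 * w x) (fun x hx => by simp [hx])
  -- the energy of the cut-off function
  have hE : ∑ x ∈ Ω, ∑ e ∈ S.steps, S.wt e * (ζ (x + e) * w (x + e) - ζ x * w x) ^ 2 ≤
      h ^ 2 * (L ^ 2 * S.total + 2 * A * n) * m := by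
    -- With primes for values at x + e: (ζ'w' - ζw)² = (w' - w)(ζ'²w' - ζ²w) + (ζ' - ζ)² w w'.
    -- Summation by parts applies to the first term.
    have e1 : ∑ x ∈ Ω, ∑ e ∈ S.steps, S.wt e * (ζ (x + e) * w (x + e) - ζ x * w x) ^ 2 =
        ∑ x ∈ Ω, ∑ e ∈ S.steps, S.wt e * ((ζ (x + e) - ζ x) ^ 2 * (w x * w (x + e))) -
          2 * ∑ x ∈ Ω, ζ x ^ 2 * w x * S.lap w x := by
      rw [sub_eq_add_neg, ← hG]
      simp only [← Finset.sum_add_distrib]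
      exact Finset.sum_congr rfl fun x _ => Finset.sum_congr rfl fun e _ => by ring
    have e2 : ∑ x ∈ Ω, ∑ e ∈ S.steps, S.wt e * ((ζ (x + e) - ζ x) ^ 2 * (w x * w (x + e))) ≤
        (L * h) ^ 2 * (S.total * m) := by
      have : ∑ x ∈ Ω, ∑ e ∈ S.steps, S.wt e * (2⁻¹ * (q x + q (x + e))) ≤ S.total * m := by
        refine hwt _ fun e he => ?_
        rw [← Finset.mul_sum, Finset.sum_add_distrib, hqsum e he]
        have : ∑ x ∈ Ω, q x = m := rfl
        rw [this]; linarith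
      refine le_trans ?_ (mul_le_mul_of_nonneg_left this (sq_nonneg (L * h)))
      rw [Finset.mul_sum]
      refine Finset.sum_le_sum fun x _ => ?_
      rw [Finset.mul_sum]
      refine Finset.sum_le_sum fun e he => ?_
      obtain ⟨a1, a2⟩ := hζq x e he
      have a3 : (ζ (x + e) - ζ x) ^ 2 * (w x * w (x + e)) ≤ (L * h) ^ 2 * (2⁻¹ * (q x + q (x + e))) := by
        have a4 := mul_nonneg (sq_nonneg (ζ (x + e) - ζ x)) (sq_nonneg (w x - w (x + e)))
        linarith
      calc _ ≤ S.wt e * ((L * h) ^ 2 * (2⁻¹ * (q x + q (x + e)))) :=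
            mul_le_mul_of_nonneg_left a3 (S.wt_nonneg e)
        _ = _ := by ring
    have e3 : -(2 * ∑ x ∈ Ω, ζ x ^ 2 * w x * S.lap w x) ≤ 2 * (A * h ^ 2 * (n * m)) := by
      have : ∑ x ∈ Ω, ∑ e ∈ S.steps, 2⁻¹ * (q x + q (x + e)) ≤ n * m := by
        refine hcard _ fun e he => ?_
        rw [← Finset.mul_sum, Finset.sum_add_distrib, hqsum e he]
        have : ∑ x ∈ Ω, q x = m := rfl
        rw [this]; linarith
      rw [← mul_neg, ← Finset.sum_neg_distrib]
      refine mul_le_mul_of_nonneg_left ?_ zero_le_two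
      refine le_trans ?_ (mul_le_mul_of_nonneg_left this (by positivity : 0 ≤ A * h ^ 2))
      rw [Finset.mul_sum]
      refine Finset.sum_le_sum fun x _ => ?_
      by_cases h0 : ζ x = 0
      · rw [h0]
        have : 0 ≤ ∑ e ∈ S.steps, 2⁻¹ * (q x + q (x + e)) := Finset.sum_nonneg fun e _ => by
          have := hq0 x; have := hq0 (x + e); positivity
        have : 0 ≤ A * h ^ 2 * ∑ e ∈ S.steps, 2⁻¹ * (q x + q (x + e)) := by positivity
        simpa using this
      · have hxr := hζR x h0
        have hxR : ‖h • T x‖ ≤ R := by linarith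
        have hl := heq x hxR
        calc -(ζ x ^ 2 * w x * S.lap w x) ≤ |ζ x ^ 2 * w x * S.lap w x| := neg_le_abs _
          _ = ζ x ^ 2 * (|w x| * |S.lap w x|) := by
              rw [abs_mul, abs_mul, abs_of_nonneg (sq_nonneg (ζ x)), mul_assoc]
          _ ≤ 1 * (|w x| * (A * h ^ 2 * ∑ e ∈ S.steps, |w (x + e)|)) := by
              gcongr; exact pow_le_one₀ (hζ0 x) (hζ1 x)
          _ = A * h ^ 2 * ∑ e ∈ S.steps, |w x| * |w (x + e)| := by
              rw [← Finset.mul_sum]; ring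
          _ ≤ _ := by
              refine mul_le_mul_of_nonneg_left (Finset.sum_le_sum fun e he => ?_) (by positivity)
              have hmv := abs_le.1 (hmove x e he)
              rw [hqR x hxR, hqR (x + e) (by linarith [hmv.2])]
              have a4 := two_mul_le_add_sq |w x| |w (x + e)|
              rw [sq_abs, sq_abs] at a4
              linarith
    rw [e1]
    linarith
  have hF : ∑ x ∈ Ω, ∑ e ∈ S.steps, S.wt e * q (x + e) ≤ S.total * m :=
    hwt _ fun e he => (hqsum e he).le
  have hN : ∑ x ∈ Ω, ∑ e ∈ S.steps, q (x + e) ≤ n * m := hcard _ fun e he => (hqsum e he).le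
  have hpt : ∑ x ∈ Ω, (if ‖h • T x‖ ≤ r then S.energy h w x else 0) ≤
      ∑ x ∈ Ω, (h ^ 2 * ∑ e ∈ S.steps, q (x + e) +
        (2 * ∑ e ∈ S.steps, S.wt e * (ζ (x + e) * w (x + e) - ζ x * w x) ^ 2 +
        2 * (L * h) ^ 2 * ∑ e ∈ S.steps, S.wt e * q (x + e))) := by
    refine Finset.sum_le_sum fun x _ => ?_
    split_ifs with hx
    · refine add_le_add (mul_le_mul_of_nonneg_left (Finset.sum_le_sum fun e he => ?_)
        (sq_nonneg _)) ?_
      · have hmv := abs_le.1 (hmove x e he)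
        rw [hqR (x + e) (by linarith [hmv.2])]
      · rw [Finset.mul_sum, Finset.mul_sum, ← Finset.sum_add_distrib]
        refine Finset.sum_le_sum fun e he => ?_
        obtain ⟨a1, a2⟩ := hζq x e he
        rw [hζr x hx] at *
        have : (w (x + e) - w x) ^ 2 ≤ 2 * (ζ (x + e) * w (x + e) - 1 * w x) ^ 2 +
            2 * ((ζ (x + e) - 1) ^ 2 * w (x + e) ^ 2) := by
          have e1 : w (x + e) - w x = (ζ (x + e) * w (x + e) - 1 * w x) +
            -((ζ (x + e) - 1) * w (x + e)) := by ring
          rw [e1]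
          refine add_sq_le.trans (le_of_eq ?_)
          ring
        have h2 : (w (x + e) - w x) ^ 2 ≤ 2 * (ζ (x + e) * w (x + e) - 1 * w x) ^ 2 +
            2 * ((L * h) ^ 2 * q (x + e)) := by linarith
        have := mul_le_mul_of_nonneg_left h2 (S.wt_nonneg e)
        linarith
    · have h1 : 0 ≤ ∑ e ∈ S.steps, q (x + e) := Finset.sum_nonneg fun e _ => hq0 _
      have h2 : 0 ≤ ∑ e ∈ S.steps, S.wt e * q (x + e) :=
        Finset.sum_nonneg fun e _ => mul_nonneg (S.wt_nonneg e) (hq0 _)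
      have h3 : 0 ≤ ∑ e ∈ S.steps, S.wt e * (ζ (x + e) * w (x + e) - ζ x * w x) ^ 2 :=
        Finset.sum_nonneg fun e _ => mul_nonneg (S.wt_nonneg e) (sq_nonneg _)
      positivity
  refine hpt.trans ?_
  rw [Finset.sum_add_distrib, Finset.sum_add_distrib, ← Finset.mul_sum, ← Finset.mul_sum,
    ← Finset.mul_sum]
  have b1 := mul_le_mul_of_nonneg_left hF (show 0 ≤ 2 * (L * h) ^ 2 by positivity)
  have b2 := mul_le_mul_of_nonneg_left hN (sq_nonneg h)
  linarith

end Stencil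

/-! ### The annular cutoff and the Laplacian of a cut-off solution. -/

section Cutoff

variable {Y : Type*} [NormedAddCommGroup Y]

/-- A smooth cutoff to the annulus `1/5 ≤ ‖y‖ ≤ 8/5`, equal to one for `3/10 ≤ ‖y‖ ≤ 3/2`. -/
noncomputable def annulusCutoff (y : Y) : ℝ :=
  Real.smoothTransition ((‖y‖ ^ 2 - 1 / 25) * 20) * Real.smoothTransition ((64 / 25 - ‖y‖ ^ 2) * 4)

theorem annulusCutoff_nonneg (y : Y) : 0 ≤ annulusCutoff y :=
  mul_nonneg (Real.smoothTransition.nonneg _) (Real.smoothTransition.nonneg _)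

theorem annulusCutoff_le_one (y : Y) : annulusCutoff y ≤ 1 :=
  mul_le_one₀ (Real.smoothTransition.le_one _) (Real.smoothTransition.nonneg _)
    (Real.smoothTransition.le_one _)

theorem annulusCutoff_eq_one {y : Y} (h1 : 3 / 10 ≤ ‖y‖) (h2 : ‖y‖ ≤ 3 / 2) :
    annulusCutoff y = 1 := by
  rw [annulusCutoff, Real.smoothTransition.one_of_one_le (by nlinarith),
    Real.smoothTransition.one_of_one_le (by nlinarith), one_mul]

theorem annulusCutoff_eq_zero_of_ge {y : Y} (h : 8 / 5 ≤ ‖y‖) : annulusCutoff y = 0 := by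
  rw [annulusCutoff, Real.smoothTransition.zero_of_nonpos (x := (64 / 25 - ‖y‖ ^ 2) * 4)
    (by nlinarith), mul_zero]

theorem mem_annulus_of_annulusCutoff_ne_zero {y : Y} (h : annulusCutoff y ≠ 0) :
    1 / 5 ≤ ‖y‖ ∧ ‖y‖ ≤ 8 / 5 := by
  refine ⟨?_, ?_⟩
  · by_contra hlt
    push Not at hlt
    apply h
    rw [annulusCutoff, Real.smoothTransition.zero_of_nonpos (x := (‖y‖ ^ 2 - 1 / 25) * 20)
      (by nlinarith [norm_nonneg y]), zero_mul]
  · by_contra hlt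
    push Not at hlt
    exact h (annulusCutoff_eq_zero_of_ge hlt.le)

open scoped ContDiff in
theorem contDiff_annulusCutoff [InnerProductSpace ℝ Y] : ContDiff ℝ ∞ (annulusCutoff : Y → ℝ) :=
  (Real.smoothTransition.contDiff.comp
    (((contDiff_norm_sq ℝ).sub contDiff_const).mul contDiff_const)).mul
  (Real.smoothTransition.contDiff.comp
    ((contDiff_const.sub (contDiff_norm_sq ℝ)).mul contDiff_const))

end Cutoff

namespace Stencil

variable {G : Type*} [AddCommGroup G] (S : Stencil G)
variable {Y : Type*} [NormedAddCommGroup Y] [InnerProductSpace ℝ Y] (T : G →+ Y)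

theorem moment_smul (h : ℝ) (y : Y) : S.moment T (h • y) = h ^ 2 * S.moment T y := by
  rw [moment, moment, Finset.mul_sum]
  exact Finset.sum_congr rfl fun e _ => by rw [real_inner_smul_left]; ring

variable [FiniteDimensional ℝ Y]

/-- The Laplacian of a function cut off to an annulus, for a solution of a difference
inequality. -/
theorem exists_lap_cutoff_bound {A : ℝ} (hA : 0 ≤ A) :
    ∃ C ε : ℝ, 0 ≤ C ∧ 0 < ε ∧ ε ≤ 1 ∧ ∀ h, 0 < h → h ≤ ε → ∀ w : G → ℝ,
      (∀ x, ‖h • T x‖ ≤ 2 → |S.lap w x| ≤ A * h ^ 2 * ∑ e ∈ S.steps, |w (x + e)|) →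
      0 ∈ S.steps → ∀ x,
      S.lap (fun z => annulusCutoff (h • T z) * w z) x ^ 2 ≤
        C * h ^ 4 * ∑ e ∈ S.steps, (annulusCutoff (h • T (x + e)) * w (x + e)) ^ 2 +
        (if ‖h • T x‖ ≤ 7 / 20 ∨ (29 / 20 ≤ ‖h • T x‖ ∧ ‖h • T x‖ ≤ 33 / 20) then
          C * h ^ 2 * S.energy h w x else 0) := by
  obtain ⟨B, hB0, hB⟩ := exists_common_bound S.steps (fun e C => ‖T e‖ ≤ C)
    (fun e C C' h1 h2 => h2.trans h1) (fun e _ => ⟨‖T e‖, norm_nonneg _, le_rfl⟩)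
  obtain ⟨D, hD0, hD⟩ := exists_common_bound S.steps
    (fun e D => ∀ y : Y, ‖y‖ ≤ 4 → ∀ h ∈ Set.Icc (0 : ℝ) 1,
      |annulusCutoff (y + h • T e) - annulusCutoff y| ≤ D * h ∧
      |annulusCutoff (y + h • T e) + annulusCutoff (y + -(h • T e)) - 2 * annulusCutoff y| ≤
        D * h ^ 2)
    (fun e D D' hDD H y hy h hh => by
      have := hh.1
      exact ⟨(H y hy h hh).1.trans (by gcongr), (H y hy h hh).2.trans (by gcongr)⟩)
    (fun e _ => by
      obtain ⟨D1, p1, H1⟩ := exists_first_diff_bound (contDiff_annulusCutoff (Y := Y)) 4 (T e)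
      obtain ⟨D2, p2, H2⟩ := exists_second_diff_bound (contDiff_annulusCutoff (Y := Y)) 4 (T e)
      refine ⟨D1 + D2, by positivity, fun y hy h hh => ?_⟩
      have := hh.1
      exact ⟨(H1 y hy h hh).trans (by gcongr; linarith),
        (H2 y hy h hh).trans (by gcongr; linarith)⟩)
  have ht := S.total_nonneg
  set n : ℝ := (S.steps.card : ℝ) with hn
  set t := S.total with htt
  refine ⟨2 * A ^ 2 * n + 4 * D ^ 2 * ((A + t) ^ 2 * n + t), min 1 (1 / 20 / (B + 1)),
    by positivity, by positivity, min_le_left _ _, fun h hh hhε w heq h0mem x => ?_⟩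
  have hh1 : h ∈ Set.Icc (0 : ℝ) 1 := ⟨hh.le, hhε.trans (min_le_left _ _)⟩
  have hstep : ∀ e ∈ S.steps, |‖h • T (x + e)‖ - ‖h • T x‖| ≤ 1 / 20 := fun e he => by
    refine (abs_norm_sub_norm_le _ _).trans ?_
    rw [map_add, smul_add, add_sub_cancel_left, norm_smul, Real.norm_of_nonneg hh.le]
    have h1 : h * (B + 1) ≤ 1 / 20 :=
      (le_div_iff₀ (by positivity)).1 (hhε.trans (min_le_right _ _))
    have h2 : h * ‖T e‖ ≤ h * B := mul_le_mul_of_nonneg_left (hB e he) hh.le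
    linarith
  set χ : G → ℝ := fun z => annulusCutoff (h • T z) with hχ
  set f : G → ℝ := fun z => χ z * w z with hf
  have hχ0 : ∀ z, 0 ≤ χ z := fun z => annulusCutoff_nonneg _
  have hχ1 : ∀ z, χ z ≤ 1 := fun z => annulusCutoff_le_one _
  have hχadd : ∀ e, χ (x + e) = annulusCutoff (h • T x + h • T e) := fun e => by
    simp only [hχ, map_add, smul_add]
  have hlapf : S.lap f x = χ x * S.lap w x + ∑ e ∈ S.steps, S.wt e * ((χ (x + e) - χ x) * w (x + e)) := by
    simp only [lap, hf, Finset.mul_sum, ← Finset.sum_add_distrib]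
    exact Finset.sum_congr rfl fun e _ => by ring
  have hχlap : |χ x * S.lap w x| ≤ A * h ^ 2 * ∑ e ∈ S.steps, (|f (x + e)| +
      |χ (x + e) - χ x| * |w (x + e)|) := by
    have hsum : ∑ e ∈ S.steps, χ x * |w (x + e)| ≤ ∑ e ∈ S.steps, (|f (x + e)| +
        |χ (x + e) - χ x| * |w (x + e)|) := by
      refine Finset.sum_le_sum fun e _ => ?_
      rw [hf]
      simp only [abs_mul]
      rw [← add_mul]
      refine mul_le_mul_of_nonneg_right ?_ (abs_nonneg _)
      rw [abs_of_nonneg (hχ0 _)]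
      linarith [neg_abs_le (χ (x + e) - χ x)]
    by_cases hx0 : χ x = 0
    · rw [hx0, zero_mul, abs_zero]
      exact mul_nonneg (by positivity) (Finset.sum_nonneg fun e _ => by positivity)
    · have hx2 := (mem_annulus_of_annulusCutoff_ne_zero hx0).2
      rw [abs_mul, abs_of_nonneg (hχ0 x)]
      calc _ ≤ χ x * (A * h ^ 2 * ∑ e ∈ S.steps, |w (x + e)|) :=
            mul_le_mul_of_nonneg_left (heq x (by linarith)) (hχ0 x)
        _ = A * h ^ 2 * ∑ e ∈ S.steps, χ x * |w (x + e)| := by rw [← Finset.mul_sum]; ring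
        _ ≤ _ := by gcongr
  have hfs : (∑ e ∈ S.steps, |f (x + e)|) ^ 2 ≤ n * ∑ e ∈ S.steps, f (x + e) ^ 2 := by
    have := sq_sum_le_card_mul_sum_sq (s := S.steps) (f := fun e => |f (x + e)|)
    simpa only [sq_abs] using this
  have hF0 : 0 ≤ ∑ e ∈ S.steps, f (x + e) ^ 2 := Finset.sum_nonneg fun _ _ => sq_nonneg _
  have hC1 : 2 * A ^ 2 * n ≤ 2 * A ^ 2 * n + 4 * D ^ 2 * ((A + t) ^ 2 * n + t) := by
    have : 0 ≤ 4 * D ^ 2 * ((A + t) ^ 2 * n + t) := by positivity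
    linarith
  have hmainterm : 2 * (A * h ^ 2 * ∑ e ∈ S.steps, |f (x + e)|) ^ 2 ≤
      (2 * A ^ 2 * n + 4 * D ^ 2 * ((A + t) ^ 2 * n + t)) * h ^ 4 * ∑ e ∈ S.steps, f (x + e) ^ 2 := by
    calc _ = 2 * A ^ 2 * h ^ 4 * (∑ e ∈ S.steps, |f (x + e)|) ^ 2 := by ring
      _ ≤ 2 * A ^ 2 * h ^ 4 * (n * ∑ e ∈ S.steps, f (x + e) ^ 2) := by gcongr
      _ = 2 * A ^ 2 * n * h ^ 4 * ∑ e ∈ S.steps, f (x + e) ^ 2 := by ring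
      _ ≤ _ := by gcongr
  split_ifs with hz
  -- Where the cutoff may vary, its first differences are O(h) and multiply differences of `w`,
  -- while its Laplacian is O(h²) and multiplies `w` itself. Both contributions are controlled by
  -- the energy.
  · have hx4 : ‖h • T x‖ ≤ 4 := by rcases hz with h1 | h1 <;> linarith
    have hχL : ∀ e ∈ S.steps, |χ (x + e) - χ x| ≤ D * h := fun e he => by
      rw [hχadd]; exact (hD e he _ hx4 h hh1).1
    have hlapχ : |∑ e ∈ S.steps, S.wt e * (χ (x + e) - χ x)| ≤ t * (D * h ^ 2) := by
      have h2 : |2 * ∑ e ∈ S.steps, S.wt e * (χ (x + e) - χ x)| ≤ t * (D * h ^ 2) := by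
        rw [S.two_mul_sum]
        refine S.abs_sum_le fun e he => ?_
        convert (hD e he _ hx4 h hh1).2 using 2
        rw [hχadd, hχadd, map_neg, smul_neg]; ring
      rw [abs_mul, abs_two] at h2
      linarith [abs_nonneg (∑ e ∈ S.steps, S.wt e * (χ (x + e) - χ x))]
    set W := ∑ e ∈ S.steps, |w (x + e)| with hW
    set V := ∑ e ∈ S.steps, S.wt e * |w (x + e) - w x| with hV
    have hW0 : 0 ≤ W := Finset.sum_nonneg fun _ _ => abs_nonneg _
    have hV0 : 0 ≤ V := Finset.sum_nonneg fun e _ => mul_nonneg (S.wt_nonneg e) (abs_nonneg _)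
    have hwW : |w x| ≤ W := by
      have := Finset.single_le_sum (f := fun e => |w (x + e)|) (fun _ _ => abs_nonneg _) h0mem
      simpa using this
    have hcomm : |∑ e ∈ S.steps, S.wt e * ((χ (x + e) - χ x) * w (x + e))| ≤
        D * h * V + t * (D * h ^ 2) * W := by
      have : ∑ e ∈ S.steps, S.wt e * ((χ (x + e) - χ x) * w (x + e)) =
          ∑ e ∈ S.steps, S.wt e * ((χ (x + e) - χ x) * (w (x + e) - w x)) +
          (∑ e ∈ S.steps, S.wt e * (χ (x + e) - χ x)) * w x := by
        rw [Finset.sum_mul, ← Finset.sum_add_distrib]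
        exact Finset.sum_congr rfl fun e _ => by ring
      rw [this]
      refine (abs_add_le _ _).trans (add_le_add ?_ ?_)
      · refine (Finset.abs_sum_le_sum_abs _ _).trans ?_
        rw [hV, Finset.mul_sum]
        refine Finset.sum_le_sum fun e he => ?_
        rw [abs_mul, abs_mul, abs_of_nonneg (S.wt_nonneg e)]
        calc _ ≤ S.wt e * (D * h * |w (x + e) - w x|) :=
              mul_le_mul_of_nonneg_left (mul_le_mul_of_nonneg_right (hχL e he) (abs_nonneg _))
                (S.wt_nonneg e)
          _ = _ := by ring
      · rw [abs_mul]
        exact mul_le_mul hlapχ hwW (abs_nonneg _) (by positivity)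
    have hsplit : ∑ e ∈ S.steps, (|f (x + e)| + |χ (x + e) - χ x| * |w (x + e)|) ≤
        ∑ e ∈ S.steps, |f (x + e)| + D * h * W := by
      rw [Finset.sum_add_distrib, hW, Finset.mul_sum]
      exact add_le_add le_rfl (Finset.sum_le_sum fun e he =>
        mul_le_mul_of_nonneg_right (hχL e he) (abs_nonneg _))
    have htot : |S.lap f x| ≤ A * h ^ 2 * ∑ e ∈ S.steps, |f (x + e)| +
        D * h * ((A + t) * h * W + V) := by
      rw [hlapf]
      refine (abs_add_le _ _).trans ((add_le_add (hχlap.trans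
        (mul_le_mul_of_nonneg_left hsplit (by positivity))) hcomm).trans ?_)
      have : A * h ^ 2 * (D * h * W) ≤ A * h ^ 2 * (D * 1 * W) := by gcongr; exact hh1.2
      linarith
    have hErr : ((A + t) * h * W + V) ^ 2 ≤ 2 * ((A + t) ^ 2 * n + t) * S.energy h w x := by
      have c1 : W ^ 2 ≤ n * ∑ e ∈ S.steps, w (x + e) ^ 2 := by
        have := sq_sum_le_card_mul_sum_sq (s := S.steps) (f := fun e => |w (x + e)|)
        simpa only [sq_abs] using this
      have c2 : V ^ 2 ≤ t * ∑ e ∈ S.steps, S.wt e * (w (x + e) - w x) ^ 2 := by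
        refine Finset.sum_sq_le_sum_mul_sum_of_sq_le_mul _ (fun e _ => S.wt_nonneg e)
          (fun e _ => mul_nonneg (S.wt_nonneg e) (sq_nonneg _)) (fun e _ => ?_)
        rw [mul_pow, sq_abs]; exact (by ring : _ = _).le
      have c3 : 0 ≤ ∑ e ∈ S.steps, w (x + e) ^ 2 := Finset.sum_nonneg fun _ _ => sq_nonneg _
      have c4 : 0 ≤ ∑ e ∈ S.steps, S.wt e * (w (x + e) - w x) ^ 2 :=
        Finset.sum_nonneg fun e _ => mul_nonneg (S.wt_nonneg e) (sq_nonneg _)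
      calc ((A + t) * h * W + V) ^ 2 ≤ 2 * (((A + t) * h * W) ^ 2 + V ^ 2) := add_sq_le
        _ = 2 * (A + t) ^ 2 * h ^ 2 * W ^ 2 + 2 * V ^ 2 := by ring
        _ ≤ 2 * (A + t) ^ 2 * h ^ 2 * (n * ∑ e ∈ S.steps, w (x + e) ^ 2) +
            2 * (t * ∑ e ∈ S.steps, S.wt e * (w (x + e) - w x) ^ 2) := by gcongr
        _ ≤ _ := by
            have d1 : 0 ≤ 2 * t * (h ^ 2 * ∑ e ∈ S.steps, w (x + e) ^ 2) := by positivity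
            have d2 : 0 ≤ 2 * ((A + t) ^ 2 * n) *
              ∑ e ∈ S.steps, S.wt e * (w (x + e) - w x) ^ 2 := by positivity
            rw [energy]
            linarith
    have hEn := S.energy_nonneg h w x
    have hsq : S.lap f x ^ 2 ≤ 2 * (A * h ^ 2 * ∑ e ∈ S.steps, |f (x + e)|) ^ 2 +
        2 * (D * h * ((A + t) * h * W + V)) ^ 2 := by
      rw [← sq_abs (S.lap f x)]
      refine (pow_le_pow_left₀ (abs_nonneg _) htot 2).trans (add_sq_le.trans (le_of_eq ?_))
      rw [mul_add]
    refine hsq.trans (add_le_add hmainterm ?_)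
    calc 2 * (D * h * ((A + t) * h * W + V)) ^ 2 = 2 * D ^ 2 * h ^ 2 * ((A + t) * h * W + V) ^ 2 := by
          ring
      _ ≤ 2 * D ^ 2 * h ^ 2 * (2 * ((A + t) ^ 2 * n + t) * S.energy h w x) := by gcongr
      _ = (4 * D ^ 2 * ((A + t) ^ 2 * n + t)) * h ^ 2 * S.energy h w x := by ring
      _ ≤ _ := by
          have : 4 * D ^ 2 * ((A + t) ^ 2 * n + t) ≤
            2 * A ^ 2 * n + 4 * D ^ 2 * ((A + t) ^ 2 * n + t) := by
            have : 0 ≤ 2 * A ^ 2 * n := by positivity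
            linarith
          gcongr
  -- Elsewhere the cutoff is constant over one step: it is 1 between radii 3/10 and 3/2 and 0 beyond
  -- 8/5, and a step changes the radius by at most 1/20.
  · push Not at hz
    have hconst : ∀ e ∈ S.steps, χ (x + e) - χ x = 0 := fun e he => by
      have hmv := abs_le.1 (hstep e he)
      by_cases h1 : ‖h • T x‖ ≤ 29 / 20
      · simp only [hχ]
        rw [annulusCutoff_eq_one (by linarith [hz.1]) (by linarith),
          annulusCutoff_eq_one (by linarith [hz.1]) (by linarith), sub_self]
      · have h2 := hz.2 (by linarith)
        simp only [hχ]
        rw [annulusCutoff_eq_zero_of_ge (by linarith), annulusCutoff_eq_zero_of_ge (by linarith),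
          sub_self]
    have h1 : S.lap f x = χ x * S.lap w x := by
      rw [hlapf, Finset.sum_eq_zero fun e he => by rw [hconst e he]; ring, add_zero]
    have h2 : |S.lap f x| ≤ A * h ^ 2 * ∑ e ∈ S.steps, |f (x + e)| := by
      rw [h1]
      refine hχlap.trans (le_of_eq ?_)
      congr 1
      exact Finset.sum_congr rfl fun e he => by rw [hconst e he]; simp
    rw [add_zero, ← sq_abs]
    refine le_trans (pow_le_pow_left₀ (abs_nonneg _) h2 2) (le_trans ?_ hmainterm)
    exact le_mul_of_one_le_left (sq_nonneg _) one_le_two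

end Stencil

/-! ### Three balls inequality on a lattice. -/

section

variable {Y : Type*} [NormedAddCommGroup Y]

theorem gaussWeight_le_of_le {lam : ℝ} (hl : 0 ≤ lam) {y : Y} {r : ℝ} (hr : 0 ≤ r) (h : r ≤ ‖y‖) :
    gaussWeight lam y ≤ Real.exp (-lam * r ^ 2) := by
  refine Real.exp_le_exp.2 ?_
  have : lam * r ^ 2 ≤ lam * ‖y‖ ^ 2 := by gcongr
  linarith

theorem le_gaussWeight_of_le {lam : ℝ} (hl : 0 ≤ lam) {y : Y} {r : ℝ} (h : ‖y‖ ≤ r) :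
    Real.exp (-lam * r ^ 2) ≤ gaussWeight lam y := by
  refine Real.exp_le_exp.2 ?_
  have : lam * ‖y‖ ^ 2 ≤ lam * r ^ 2 := by gcongr
  linarith

end

namespace Stencil

variable {G : Type*} [AddCommGroup G] (S : Stencil G)
variable {Y : Type*} [NormedAddCommGroup Y] [InnerProductSpace ℝ Y] (T : G →+ Y)

variable {S T}

/-- Shifting by one step inside a weighted sum costs a bounded factor. -/
theorem sum_sum_weight_shift_le {θ f : G → ℝ} {Ω : Finset G} (hcov : S.Covers f Ω)
    (hθ : ∀ e ∈ S.steps, ∀ x, f (x + e) ≠ 0 → |θ (x + e) - θ x| ≤ 1) :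
    ∑ x ∈ Ω, Real.exp (θ x) ^ 2 * ∑ e ∈ S.steps, f (x + e) ^ 2 ≤
      (S.steps.card : ℝ) * (Real.exp 1 ^ 2 * ∑ x ∈ Ω, (Real.exp (θ x) * f x) ^ 2) := by
  have h1 : ∑ x ∈ Ω, Real.exp (θ x) ^ 2 * ∑ e ∈ S.steps, f (x + e) ^ 2 =
      ∑ e ∈ S.steps, ∑ x ∈ Ω, Real.exp (θ x) ^ 2 * f (x + e) ^ 2 := by
    rw [Finset.sum_comm]; exact Finset.sum_congr rfl fun x _ => by rw [Finset.mul_sum]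
  rw [h1, ← nsmul_eq_mul]
  refine Finset.sum_le_card_nsmul _ _ _ fun e he => ?_
  rw [← hcov.sum_add_eq (q := fun x => (Real.exp (θ x) * f x) ^ 2) (fun x hx => by simp [hx]) he,
    Finset.mul_sum]
  refine Finset.sum_le_sum fun x _ => ?_
  by_cases h0 : f (x + e) = 0
  · simp [h0]
  · have h2 : Real.exp (θ x) ≤ Real.exp 1 * Real.exp (θ (x + e)) := by
      rw [← Real.exp_add]
      exact Real.exp_le_exp.2 (by linarith [(abs_le.1 (hθ e he x h0)).1])
    calc _ ≤ (Real.exp 1 * Real.exp (θ (x + e))) ^ 2 * f (x + e) ^ 2 := by gcongr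
      _ = _ := by ring

variable (S T) [FiniteDimensional ℝ Y]

/-- Three balls inequality for solutions of a difference inequality on a lattice. -/
theorem exists_ballMass_three_balls (h0mem : 0 ∈ S.steps) {A b : ℝ} (hA : 0 ≤ A) (hb : 0 < b)
    (hmom : ∀ x, b * ‖T x‖ ^ 2 ≤ S.moment T (T x)) :
    ∃ C c ε : ℝ, 0 < C ∧ 0 < c ∧ 0 < ε ∧ ε ≤ 1 ∧ ∀ h τ : ℝ, 0 < h → h ≤ ε → τ * h ≤ ε →
      1 ≤ ε * τ → ∀ (w : G → ℝ) (Ω : Finset G), S.Covers w Ω →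
      (∀ x, ‖h • T x‖ ≤ 2 → |S.lap w x| ≤ A * h ^ 2 * ∑ e ∈ S.steps, |w (x + e)|) →
      ballMass T h w Ω (11 / 10) ≤ C * (Real.exp (2 * τ) * ballMass T h w Ω (1 / 2) +
        Real.exp (-(2 * c * τ)) * ballMass T h w Ω 2) := by
  -- The cutoff is supported where the norm is at least 1/5, so the moment form is at least b/25
  -- there.
  obtain ⟨lam, c, ε₁, hl, hc, hε₁, hε₁1, hstep, hcarl⟩ :=
    exists_carleman S T (b := b / 25) (by positivity)
  obtain ⟨C₁, ε₂, hC₁, hε₂, hε₂1, hlap⟩ := S.exists_lap_cutoff_bound T hA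
  obtain ⟨C₂, ε₃, hC₂, hε₃, hcac⟩ :=
    exists_caccioppoli S T hA (r := 7 / 20) (R := 1 / 2) (by norm_num)
  obtain ⟨C₃, ε₄, hC₃, hε₄, hcac'⟩ :=
    exists_caccioppoli S T hA (r := 33 / 20) (R := 2) (by norm_num)
  set P := C₁ * (S.steps.card : ℝ) * Real.exp 1 ^ 2 with hP
  have hP0 : 0 ≤ P := by positivity
  -- A lower bound for the weight on the ball of radius 11/10; `s'` is an upper bound on the outer
  -- transition zone. Their gap is the exponential gain.
  set s := Real.exp (-lam * (11 / 10) ^ 2) with hs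
  set s' := Real.exp (-lam * (29 / 20) ^ 2) with hs'
  have hss : 0 < s - s' := by
    refine sub_pos.2 (Real.exp_lt_exp.2 ?_)
    nlinarith
  have hs0 : 0 < s := Real.exp_pos _
  -- The bound `c / (1 + P)` turns 1 ≤ ε τ into c τ ≥ 1 + P, so that the term with coefficient `P`
  -- can be absorbed in the left side of the Carleman estimate.
  refine ⟨1 + C₁ * C₂ + C₁ * C₃, s - s', min (min (min ε₁ ε₂) (min ε₃ ε₄)) (c / (1 + P)),
    by positivity, hss, by positivity,
    (min_le_left _ _).trans ((min_le_left _ _).trans ((min_le_left _ _).trans hε₁1)),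
    fun h τ hh hhε hτh hτε w Ω hcov heq => ?_⟩
  set ε := min (min (min ε₁ ε₂) (min ε₃ ε₄)) (c / (1 + P)) with hε
  have hε0 : 0 < ε := hh.trans_le hhε
  have l1 : ε ≤ ε₁ := (min_le_left _ _).trans ((min_le_left _ _).trans (min_le_left _ _))
  have l2 : ε ≤ ε₂ := (min_le_left _ _).trans ((min_le_left _ _).trans (min_le_right _ _))
  have l3 : ε ≤ ε₃ := (min_le_left _ _).trans ((min_le_right _ _).trans (min_le_left _ _))
  have l4 : ε ≤ ε₄ := (min_le_left _ _).trans ((min_le_right _ _).trans (min_le_right _ _))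
  have l5 : ε ≤ c / (1 + P) := min_le_right _ _
  have hτ0 : 0 < τ := by
    by_contra hneg
    push Not at hneg
    have : ε * τ ≤ 0 := mul_nonpos_of_nonneg_of_nonpos hε0.le hneg
    linarith
  have hτ1 : 1 ≤ τ := by
    have : ε * τ ≤ 1 * τ := mul_le_mul_of_nonneg_right (l1.trans hε₁1) hτ0.le
    linarith
  obtain ⟨hphase, hcarl⟩ := hcarl h τ hh (hhε.trans l1) (hτh.trans l1)
    (hτε.trans (mul_le_mul_of_nonneg_right l1 hτ0.le))
  set f : G → ℝ := fun z => annulusCutoff (h • T z) * w z with hf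
  have hcovf : S.Covers f Ω := fun x hx => hcov x (right_ne_zero_of_mul hx)
  have hfsupp : ∀ x, f x ≠ 0 → 1 / 5 ≤ ‖h • T x‖ ∧ ‖h • T x‖ ≤ 8 / 5 := fun x hx =>
    mem_annulus_of_annulusCutoff_ne_zero (left_ne_zero_of_mul hx)
  have hcarl := hcarl f Ω hcovf fun x hx => by
    obtain ⟨h1, h2⟩ := hfsupp x hx
    refine ⟨by linarith, ?_⟩
    rw [moment_smul]
    have h3 := mul_le_mul_of_nonneg_left (hmom x) (sq_nonneg h)
    have h4 : (1 / 5) ^ 2 ≤ ‖h • T x‖ ^ 2 := by gcongr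
    have h5 : ‖h • T x‖ ^ 2 = h ^ 2 * ‖T x‖ ^ 2 := by
      rw [norm_smul, mul_pow, Real.norm_eq_abs, sq_abs]
    rw [h5] at h4
    have h6 := mul_le_mul_of_nonneg_left h4 hb.le
    linarith
  set θ := phase T lam h τ with hθ
  set m := ballMass T h w Ω (1 / 2) with hm
  set M := ballMass T h w Ω 2 with hM
  have hm0 : 0 ≤ m := ballMass_nonneg _ _ _ _ _
  have hM0 : 0 ≤ M := ballMass_nonneg _ _ _ _ _
  set F := ∑ x ∈ Ω, (Real.exp (θ x) * f x) ^ 2 with hF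
  have hF0 : 0 ≤ F := Finset.sum_nonneg fun _ _ => sq_nonneg _
  have hshift := sum_sum_weight_shift_le (θ := θ) hcovf fun e he x hx => by
    refine hphase e he x ?_
    have h2 := (hfsupp _ hx).2
    have h3 : h • T x = h • T (x + e) - h • T e := by rw [map_add, smul_add]; abel
    rw [h3]
    refine (norm_sub_le _ _).trans ?_
    have h4 : ‖h • T e‖ ≤ 1 := by
      rw [norm_smul, Real.norm_of_nonneg hh.le]
      exact (mul_le_mul_of_nonneg_right (hhε.trans l1) (norm_nonneg _)).trans (hstep e he)
    linarith
  have hin := hcac h hh (hhε.trans l3) w Ω hcov fun x hx => heq x (by linarith)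
  have hout := hcac' h hh (hhε.trans l4) w Ω hcov heq
  have hweight : ∀ x, θ x = τ * gaussWeight lam (h • T x) := fun x => rfl
  have hsq : ∀ {a : ℝ} x, gaussWeight lam (h • T x) ≤ a →
      Real.exp (θ x) ^ 2 ≤ Real.exp (2 * τ * a) := fun {a} x hx => by
    rw [← Real.exp_nat_mul]
    refine Real.exp_le_exp.2 ?_
    rw [hweight]; push_cast
    have := mul_le_mul_of_nonneg_left hx (show 0 ≤ 2 * τ by linarith)
    linarith
  have hpt : ∑ x ∈ Ω, (Real.exp (θ x) * S.lap f x) ^ 2 ≤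
      ∑ x ∈ Ω, (C₁ * h ^ 4 * (Real.exp (θ x) ^ 2 * ∑ e ∈ S.steps, f (x + e) ^ 2) +
        Real.exp (2 * τ) * (C₁ * h ^ 2) * (if ‖h • T x‖ ≤ 7 / 20 then S.energy h w x else 0) +
        Real.exp (2 * τ * s') * (C₁ * h ^ 2) *
          (if ‖h • T x‖ ≤ 33 / 20 then S.energy h w x else 0)) := by
    refine Finset.sum_le_sum fun x _ => ?_
    have hEn := S.energy_nonneg h w x
    have h1 := hlap h hh (hhε.trans l2) w heq h0mem x
    have h2 := mul_le_mul_of_nonneg_left h1 (sq_nonneg (Real.exp (θ x)))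
    have hn1 : 0 ≤ (if ‖h • T x‖ ≤ 7 / 20 then S.energy h w x else 0) := by
      split_ifs <;> positivity
    have hn2 : 0 ≤ (if ‖h • T x‖ ≤ 33 / 20 then S.energy h w x else 0) := by
      split_ifs <;> positivity
    have h3 : Real.exp (θ x) ^ 2 *
        (if ‖h • T x‖ ≤ 7 / 20 ∨ (29 / 20 ≤ ‖h • T x‖ ∧ ‖h • T x‖ ≤ 33 / 20) then
          C₁ * h ^ 2 * S.energy h w x else 0) ≤
        Real.exp (2 * τ) * (C₁ * h ^ 2) * (if ‖h • T x‖ ≤ 7 / 20 then S.energy h w x else 0) +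
        Real.exp (2 * τ * s') * (C₁ * h ^ 2) *
          (if ‖h • T x‖ ≤ 33 / 20 then S.energy h w x else 0) := by
      by_cases hz : ‖h • T x‖ ≤ 7 / 20 ∨ (29 / 20 ≤ ‖h • T x‖ ∧ ‖h • T x‖ ≤ 33 / 20)
      · rw [if_pos hz]
        rcases hz with hz | hz
        · have a1 := hsq x (gaussWeight_le_one hl.le (h • T x))
          rw [mul_one] at a1
          refine le_add_of_le_of_nonneg ?_ (by positivity)
          rw [if_pos hz, mul_assoc (Real.exp _)]
          exact mul_le_mul_of_nonneg_right a1 (mul_nonneg (by positivity) hEn)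
        · have a1 := hsq x (gaussWeight_le_of_le hl.le (by norm_num) hz.1)
          refine le_add_of_nonneg_of_le (by positivity) ?_
          rw [if_pos hz.2, mul_assoc (Real.exp _)]
          exact mul_le_mul_of_nonneg_right a1 (mul_nonneg (by positivity) hEn)
      · rw [if_neg hz, mul_zero]; positivity
    rw [mul_pow]
    refine h2.trans ?_
    rw [mul_add]
    linarith
  rw [Finset.sum_add_distrib, Finset.sum_add_distrib, ← Finset.mul_sum, ← Finset.mul_sum,
    ← Finset.mul_sum] at hpt
  have hFle : F ≤ C₁ * C₂ * (Real.exp (2 * τ) * m) + C₁ * C₃ * (Real.exp (2 * τ * s') * M) := by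
    have b1 := mul_le_mul_of_nonneg_left hshift (show 0 ≤ C₁ * h ^ 4 by positivity)
    have b2 := mul_le_mul_of_nonneg_left hin (show 0 ≤ Real.exp (2 * τ) * (C₁ * h ^ 2) by positivity)
    have b3 := mul_le_mul_of_nonneg_left hout
      (show 0 ≤ Real.exp (2 * τ * s') * (C₁ * h ^ 2) by positivity)
    -- Every term now carries h⁴: the cutoff errors have one factor h², and the Caccioppoli
    -- inequality supplies the other.
    have b4 : h ^ 4 * ((c * τ ^ 3 - P) * F) ≤
        h ^ 4 * (C₁ * C₂ * (Real.exp (2 * τ) * m) + C₁ * C₃ * (Real.exp (2 * τ * s') * M)) := by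
      have := hcarl.trans (hpt.trans (add_le_add (add_le_add b1 b2) b3))
      rw [hP]
      linarith
    have b5 := le_of_mul_le_mul_left b4 (by positivity)
    have b6 : 1 ≤ c * τ ^ 3 - P := by
      have c1 : ε * (1 + P) ≤ c := (le_div_iff₀ (by positivity)).1 l5
      have c2 : τ ≤ τ ^ 3 := le_self_pow₀ hτ1 (by norm_num)
      have c3 : 1 + P ≤ c * τ := by
        calc 1 + P ≤ (ε * τ) * (1 + P) := le_mul_of_one_le_left (by positivity) hτε
          _ = (ε * (1 + P)) * τ := by ring
          _ ≤ c * τ := by gcongr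
      have c4 : c * τ ≤ c * τ ^ 3 := by gcongr
      linarith
    exact (le_mul_of_one_le_left hF0 b6).trans b5
  have hlow : ballMass T h w Ω (11 / 10) ≤ m + Real.exp (-(2 * τ * s)) * F := by
    rw [hm, hF, ballMass, ballMass, Finset.mul_sum, ← Finset.sum_add_distrib]
    refine Finset.sum_le_sum fun x _ => ?_
    have hn1 : 0 ≤ Real.exp (-(2 * τ * s)) * (Real.exp (θ x) * f x) ^ 2 := by positivity
    have hn2 : 0 ≤ (if ‖h • T x‖ ≤ 1 / 2 then w x ^ 2 else 0) := by split_ifs <;> positivity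
    by_cases h1 : ‖h • T x‖ ≤ 11 / 10
    · rw [if_pos h1]
      by_cases h2 : ‖h • T x‖ ≤ 1 / 2
      · rw [if_pos h2]; linarith
      · rw [if_neg h2, zero_add]
        push Not at h2
        have h3 : f x = w x := by
          simp only [hf]; rw [annulusCutoff_eq_one (by linarith) (by linarith), one_mul]
        have h4 := le_gaussWeight_of_le hl.le h1
        rw [← hs] at h4
        have h5 : 1 ≤ Real.exp (-(2 * τ * s)) * Real.exp (θ x) ^ 2 := by
          rw [← Real.exp_nat_mul, ← Real.exp_add]
          refine Real.one_le_exp ?_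
          rw [hweight]; push_cast
          have := mul_le_mul_of_nonneg_left h4 (show 0 ≤ 2 * τ by linarith)
          linarith
        rw [h3, mul_pow, ← mul_assoc]
        exact le_mul_of_one_le_left (sq_nonneg _) h5
    · rw [if_neg h1]; linarith
  have d1 := mul_le_mul_of_nonneg_left hFle (Real.exp_nonneg (-(2 * τ * s)))
  have d2 : Real.exp (-(2 * τ * s)) * Real.exp (2 * τ) ≤ Real.exp (2 * τ) :=
    mul_le_of_le_one_left (Real.exp_nonneg _) (Real.exp_le_one_iff.2 (by
      have : 0 ≤ 2 * τ * s := by positivity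
      linarith))
  have d3 : Real.exp (-(2 * τ * s)) * Real.exp (2 * τ * s') = Real.exp (-(2 * (s - s') * τ)) := by
    rw [← Real.exp_add]; congr 1; ring
  have d4 : 1 ≤ Real.exp (2 * τ) := Real.one_le_exp (by linarith)
  have d5 := mul_le_mul_of_nonneg_right d2 (show 0 ≤ C₁ * C₂ * m by positivity)
  have d6 : Real.exp (-(2 * τ * s)) * (C₁ * C₃ * (Real.exp (2 * τ * s') * M)) =
      C₁ * C₃ * (Real.exp (-(2 * (s - s') * τ)) * M) := by rw [← d3]; ring
  have d7 := mul_le_mul_of_nonneg_right d4 hm0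
  have d8 : 0 ≤ C₁ * C₃ * (Real.exp (2 * τ) * m) := by positivity
  have d9 : 0 ≤ (1 + C₁ * C₂) * (Real.exp (-(2 * (s - s') * τ)) * M) := by positivity
  linarith

end Stencil

/-! ### Reduction of a star graph to a stencil on the first sublattice. -/

namespace PeriodicGraph

variable {d s : ℕ} (Γ : PeriodicGraph d s)

/-- The finite set of neighbours of a point. -/
noncomputable def nbrs (x : Fin d → ℝ) : Finset (Fin d → ℝ) := (Γ.locallyFinite x).toFinset

variable {Γ}

theorem mem_nbrs {x y : Fin d → ℝ} : y ∈ Γ.nbrs x ↔ Γ.graph.Adj x y := by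
  simp [nbrs]

theorem adj_add_iff {x y l : Fin d → ℝ} (hl : l ∈ latticeOf Γ.v) :
    Γ.graph.Adj (x + l) (y + l) ↔ Γ.graph.Adj x y := by
  refine ⟨fun h => ?_, fun h => Γ.periodic x y h l hl⟩
  have := Γ.periodic _ _ h (-l) (neg_mem hl)
  simpa using this

theorem add_mem_sublattice_iff {i : Fin s} {x l : Fin d → ℝ} (hl : l ∈ latticeOf Γ.v) :
    x + l ∈ Γ.sublattice i ↔ x ∈ Γ.sublattice i := by
  constructor
  · rintro ⟨m, hm, h⟩
    exact ⟨m - l, sub_mem hm hl, by rw [← add_sub_assoc, ← h, add_sub_cancel_right]⟩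
  · rintro ⟨m, hm, h⟩
    exact ⟨m + l, add_mem hm hl, by rw [← add_assoc, ← h]⟩

theorem sub_mem_lattice {i : Fin s} {x y : Fin d → ℝ} (hx : x ∈ Γ.sublattice i)
    (hy : y ∈ Γ.sublattice i) : y - x ∈ latticeOf Γ.v := by
  obtain ⟨l, hl, rfl⟩ := hx
  obtain ⟨m, hm, rfl⟩ := hy
  rw [add_sub_add_left_eq_sub]; exact sub_mem hm hl

theorem p_mem_sublattice (i : Fin s) : Γ.p i ∈ Γ.sublattice i := ⟨0, zero_mem _, by simp⟩

theorem mem_verts_of_adj {x y : Fin d → ℝ} (h : Γ.graph.Adj x y) : x ∈ Γ.verts :=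
  Γ.mem_of_adj x y h

theorem sublattice_subset_verts (i : Fin s) : Γ.sublattice i ⊆ Γ.verts :=
  Set.subset_iUnion _ i

open scoped Classical in
variable (Γ) in
/-- Points at graph distance at most two. -/
noncomputable def nbrs₂ (x : Fin d → ℝ) : Finset (Fin d → ℝ) :=
  Γ.nbrs x ∪ (Γ.nbrs x).biUnion Γ.nbrs

theorem nbrs₂_add {x z l : Fin d → ℝ} (hl : l ∈ latticeOf Γ.v) (hz : z ∈ Γ.nbrs₂ (x + l)) :
    z - l ∈ Γ.nbrs₂ x := by
  simp only [nbrs₂, Finset.mem_union, Finset.mem_biUnion, mem_nbrs] at hz ⊢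
  rcases hz with hz | ⟨y, h1, h2⟩
  · left; rw [← adj_add_iff hl, sub_add_cancel]; exact hz
  · right
    refine ⟨y - l, ?_, ?_⟩
    · rw [← adj_add_iff hl, sub_add_cancel]; exact h1
    · rw [← adj_add_iff hl, sub_add_cancel, sub_add_cancel]; exact h2

theorem mem_nbrs₂_of_adj {x y : Fin d → ℝ} (h : Γ.graph.Adj x y) : y ∈ Γ.nbrs₂ x :=
  Finset.mem_union_left _ (mem_nbrs.2 h)

theorem mem_nbrs₂_of_adj_adj {x y z : Fin d → ℝ} (h : Γ.graph.Adj x y) (h' : Γ.graph.Adj y z) :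
    z ∈ Γ.nbrs₂ x :=
  Finset.mem_union_right _ (Finset.mem_biUnion.2 ⟨y, mem_nbrs.2 h, mem_nbrs.2 h'⟩)

theorem card_nbrs_add {y l : Fin d → ℝ} (hl : l ∈ latticeOf Γ.v) :
    (Γ.nbrs (y + l)).card = (Γ.nbrs y).card := by
  refine Finset.card_nbij' (fun z => z - l) (fun z => z + l) ?_ ?_
    (fun z _ => sub_add_cancel z l) (fun z _ => add_sub_cancel_right z l)
  · intro z hz
    simp only [Finset.mem_coe, mem_nbrs] at hz ⊢
    rw [← adj_add_iff hl, sub_add_cancel]; exact hz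
  · intro z hz
    simp only [Finset.mem_coe, mem_nbrs] at hz ⊢
    rwa [adj_add_iff hl]

variable [NeZero s]

theorem IsStar.mem_of_adj (hΓ : Γ.IsStar) {x y : Fin d → ℝ} (h : Γ.graph.Adj x y)
    (hx : x ∉ Γ.sublattice 0) : y ∈ Γ.sublattice 0 := by
  obtain ⟨j, hj⟩ := Set.mem_iUnion.1 (mem_verts_of_adj h)
  by_cases h0 : j = 0
  · subst h0; exact absurd hj hx
  · exact hΓ j h0 x hj y h

/-- The neighbour is the second vertex of a walk to `Γ.p 0`. -/
theorem exists_adj {x : Fin d → ℝ} (hx : x ∈ Γ.verts) (hx0 : x ∉ Γ.sublattice 0) :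
    ∃ y, Γ.graph.Adj x y := by
  have h0 := p_mem_sublattice (Γ := Γ) 0
  obtain ⟨p⟩ := Γ.connected.preconnected ⟨x, hx⟩ ⟨Γ.p 0, sublattice_subset_verts 0 h0⟩
  cases p with
  | nil => exact absurd h0 hx0
  | cons h _ => exact ⟨_, h⟩

open scoped Classical in
variable (Γ) in
/-- The vertices outside the first sublattice adjacent to both `x` and `z`. -/
noncomputable def midpoints (x z : Fin d → ℝ) : Finset (Fin d → ℝ) :=
  (Γ.nbrs x ∩ Γ.nbrs z).filter fun y => y ∉ Γ.sublattice 0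

open scoped Classical in
variable (Γ) in
/-- The edge weights left on the first sublattice when the other vertices are eliminated. -/
noncomputable def reducedWeight (x z : Fin d → ℝ) : ℝ :=
  (if Γ.graph.Adj x z ∧ x ∈ Γ.sublattice 0 ∧ z ∈ Γ.sublattice 0 then 1 else 0) +
    ∑ y ∈ Γ.midpoints x z, ((Γ.nbrs y).card : ℝ)⁻¹

theorem mem_midpoints {x z y : Fin d → ℝ} : y ∈ Γ.midpoints x z ↔
    Γ.graph.Adj x y ∧ Γ.graph.Adj y z ∧ y ∉ Γ.sublattice 0 := by
  simp [midpoints, mem_nbrs, and_assoc, Γ.graph.adj_comm z y]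

theorem reducedWeight_comm (x z : Fin d → ℝ) : Γ.reducedWeight x z = Γ.reducedWeight z x := by
  have h1 : Γ.midpoints x z = Γ.midpoints z x := by
    ext y; rw [mem_midpoints, mem_midpoints, Γ.graph.adj_comm x y, Γ.graph.adj_comm y z]; tauto
  rw [reducedWeight, reducedWeight, h1]
  congr 2
  rw [Γ.graph.adj_comm]; ext; tauto

theorem reducedWeight_nonneg (x z : Fin d → ℝ) : 0 ≤ Γ.reducedWeight x z := by
  refine add_nonneg ?_ (Finset.sum_nonneg fun _ _ => by positivity)
  split_ifs <;> norm_num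

theorem reducedWeight_add {x z l : Fin d → ℝ} (hl : l ∈ latticeOf Γ.v) :
    Γ.reducedWeight (x + l) (z + l) = Γ.reducedWeight x z := by
  rw [reducedWeight, reducedWeight]
  congr 1
  · rw [adj_add_iff hl, add_mem_sublattice_iff hl, add_mem_sublattice_iff hl]
  · refine Finset.sum_nbij' (fun y => y - l) (fun y => y + l) ?_ ?_ (by simp) (by simp) ?_
    · intro y hy
      rw [mem_midpoints] at hy ⊢
      rwa [← adj_add_iff hl, ← adj_add_iff (x := y - l) hl, sub_add_cancel,
        ← add_mem_sublattice_iff hl, sub_add_cancel]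
    · intro y hy
      rw [mem_midpoints] at hy ⊢
      rwa [adj_add_iff hl, adj_add_iff hl, add_mem_sublattice_iff hl]
    · intro y _
      rw [← card_nbrs_add (y := y - l) hl, sub_add_cancel]

/-- Any midpoint lies outside the first sublattice, so the star condition places both of its
neighbours `x` and `z` inside. -/
theorem IsStar.mem_of_reducedWeight_ne_zero (hΓ : Γ.IsStar) {x z : Fin d → ℝ}
    (h : Γ.reducedWeight x z ≠ 0) : x ∈ Γ.sublattice 0 ∧ z ∈ Γ.sublattice 0 := by
  by_contra hn
  apply h
  rw [reducedWeight, if_neg (fun h' => hn h'.2), zero_add]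
  refine Finset.sum_eq_zero fun y hy => ?_
  rw [mem_midpoints] at hy
  exact absurd ⟨hΓ.mem_of_adj hy.1.symm hy.2.2, hΓ.mem_of_adj hy.2.1 hy.2.2⟩ hn

open scoped Classical in
variable (Γ) in
/-- The steps of the reduced operator. -/
noncomputable def reducedSteps : Finset (Fin d → ℝ) :=
  -- The step 0 does not affect the Laplacian; it is included so that |w x| is one of the terms |w
  -- (x + e)|. The reflected image makes the set symmetric.
  insert 0 ((Γ.nbrs₂ (Γ.p 0)).image (fun z => z - Γ.p 0) ∪
    ((Γ.nbrs₂ (Γ.p 0)).image (fun z => z - Γ.p 0)).image (fun e => -e))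

theorem zero_mem_reducedSteps : (0 : Fin d → ℝ) ∈ Γ.reducedSteps := Finset.mem_insert_self _ _

theorem sub_mem_reducedSteps {x z : Fin d → ℝ} (hx : x ∈ Γ.sublattice 0) (hz : z ∈ Γ.nbrs₂ x) :
    z - x ∈ Γ.reducedSteps := by
  obtain ⟨l, hl, rfl⟩ := hx
  refine Finset.mem_insert_of_mem (Finset.mem_union_left _ (Finset.mem_image.2
    ⟨z - l, nbrs₂_add hl hz, ?_⟩))
  abel

/-- The stencil on the first sublattice obtained by eliminating the other vertices. -/
noncomputable def reducedStencil (hΓ : Γ.IsStar) : Stencil (Fin d → ℝ) where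
  steps := Γ.reducedSteps
  wt e := Γ.reducedWeight (Γ.p 0) (Γ.p 0 + e)
  neg_mem e he := by
    classical
    rw [reducedSteps, Finset.mem_insert, Finset.mem_union] at he ⊢
    rcases he with rfl | he | he
    · left; simp
    · right; right; exact Finset.mem_image_of_mem _ he
    · right; left
      obtain ⟨e', he', rfl⟩ := Finset.mem_image.1 he
      rwa [neg_neg]
  -- For `e` in the lattice, translate by `e` and exchange the endpoints. Otherwise both weights
  -- vanish, since a nonzero weight needs both endpoints in the first sublattice.
  wt_neg e := by
    by_cases he : e ∈ latticeOf Γ.v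
    · rw [reducedWeight_comm, ← reducedWeight_add he, neg_add_cancel_right]
    · have key : ∀ f : Fin d → ℝ, f ∉ latticeOf Γ.v →
          Γ.reducedWeight (Γ.p 0) (Γ.p 0 + f) = 0 := fun f hf => by
        by_contra hne
        obtain ⟨h1, h2⟩ := hΓ.mem_of_reducedWeight_ne_zero hne
        have := sub_mem_lattice h1 h2
        rw [add_sub_cancel_left] at this
        exact hf this
      rw [key e he, key (-e) (by rwa [neg_mem_iff])]
  wt_nonneg e := reducedWeight_nonneg _ _

theorem IsStar.wt_eq (hΓ : Γ.IsStar) {x : Fin d → ℝ} (hx : x ∈ Γ.sublattice 0) (e : Fin d → ℝ) :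
    (reducedStencil hΓ).wt e = Γ.reducedWeight x (x + e) := by
  obtain ⟨l, hl, rfl⟩ := hx
  rw [add_right_comm, reducedWeight_add hl]; rfl

open scoped Classical in
/-- The reduced operator as a sum over paths of length one or two. -/
theorem IsStar.sum_wt_mul (hΓ : Γ.IsStar) {x : Fin d → ℝ} (hx : x ∈ Γ.sublattice 0)
    (f : (Fin d → ℝ) → ℝ) :
    ∑ e ∈ (reducedStencil hΓ).steps, (reducedStencil hΓ).wt e * f (x + e) =
      ∑ z ∈ (Γ.nbrs x).filter (· ∈ Γ.sublattice 0), f z +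
      ∑ y ∈ (Γ.nbrs x).filter (· ∉ Γ.sublattice 0), ((Γ.nbrs y).card : ℝ)⁻¹ * ∑ z ∈ Γ.nbrs y, f z := by
  set Z := (reducedStencil hΓ).steps.image (fun e => x + e) with hZ
  have hmem : ∀ z ∈ Γ.nbrs₂ x, z ∈ Z := fun z hz =>
    Finset.mem_image.2 ⟨z - x, sub_mem_reducedSteps hx hz, add_sub_cancel _ _⟩
  have h1 : ∑ e ∈ (reducedStencil hΓ).steps, (reducedStencil hΓ).wt e * f (x + e) =
      ∑ z ∈ Z, Γ.reducedWeight x z * f z := by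
    rw [hZ, Finset.sum_image (fun a _ b _ h => add_left_cancel h)]
    exact Finset.sum_congr rfl fun e _ => by rw [hΓ.wt_eq hx]
  rw [h1]
  simp only [reducedWeight, add_mul, Finset.sum_add_distrib]
  congr 1
  · simp only [ite_mul, one_mul, zero_mul]
    rw [← Finset.sum_filter]
    refine Finset.sum_congr ?_ fun _ _ => rfl
    ext z
    simp only [Finset.mem_filter, mem_nbrs]
    constructor
    · rintro ⟨-, h, -, h'⟩; exact ⟨h, h'⟩
    · rintro ⟨h, h'⟩; exact ⟨hmem z (mem_nbrs₂_of_adj h), h, hx, h'⟩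
  · simp only [Finset.sum_mul, Finset.mul_sum]
    refine Finset.sum_comm' fun z y => ?_
    simp only [mem_midpoints, Finset.mem_filter, mem_nbrs]
    constructor
    · rintro ⟨-, h1, h2, h3⟩; exact ⟨h2, h1, h3⟩
    · rintro ⟨h2, h1, h3⟩; exact ⟨hmem z (mem_nbrs₂_of_adj_adj h1 h2), h1, h2, h3⟩

theorem IsStar.add_mem_of_wt_ne_zero (hΓ : Γ.IsStar) {x e : Fin d → ℝ}
    (he : (reducedStencil hΓ).wt e ≠ 0) (hx : x + e ∈ Γ.sublattice 0) : x ∈ Γ.sublattice 0 := by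
  obtain ⟨h1, h2⟩ := hΓ.mem_of_reducedWeight_ne_zero he
  have := sub_mem_lattice h1 h2
  rw [add_sub_cancel_left] at this
  exact (add_mem_sublattice_iff this).1 hx

theorem reducedWeight_pos_of_adj {x z : Fin d → ℝ} (h : Γ.graph.Adj x z)
    (hx : x ∈ Γ.sublattice 0) (hz : z ∈ Γ.sublattice 0) : 0 < Γ.reducedWeight x z := by
  rw [reducedWeight, if_pos ⟨h, hx, hz⟩]
  have : 0 ≤ ∑ y ∈ Γ.midpoints x z, ((Γ.nbrs y).card : ℝ)⁻¹ :=
    Finset.sum_nonneg fun _ _ => by positivity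
  linarith

theorem reducedWeight_pos_of_adj_adj {x y z : Fin d → ℝ} (h : Γ.graph.Adj x y)
    (h' : Γ.graph.Adj y z) (hy : y ∉ Γ.sublattice 0) : 0 < Γ.reducedWeight x z := by
  classical
  rw [reducedWeight]
  refine add_pos_of_nonneg_of_pos (by split_ifs <;> norm_num) ?_
  refine Finset.sum_pos' (fun _ _ => by positivity) ⟨y, mem_midpoints.2 ⟨h, h', hy⟩, ?_⟩
  have : 0 < (Γ.nbrs y).card := Finset.card_pos.2 ⟨z, mem_nbrs.2 h'⟩
  positivity

/-- The steps of positive weight generate the lattice: a linear form vanishing on them is zero. -/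
theorem IsStar.eq_zero_of_forall_step (hΓ : Γ.IsStar) (ℓ : (Fin d → ℝ) →ₗ[ℝ] ℝ)
    (h : ∀ e ∈ (reducedStencil hΓ).steps, 0 < (reducedStencil hΓ).wt e → ℓ e = 0) : ℓ = 0 := by
  set o := Γ.p 0 with ho
  have hstep : ∀ {x z : Fin d → ℝ}, x ∈ Γ.sublattice 0 → z ∈ Γ.nbrs₂ x →
      0 < Γ.reducedWeight x z → ℓ z = ℓ x := fun {x z} hx hz hpos => by
    have := h (z - x) (sub_mem_reducedSteps hx hz)
      (by rw [hΓ.wt_eq hx, add_sub_cancel]; exact hpos)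
    rw [map_sub] at this
    linarith
  -- The invariant along a walk: ℓ equals ℓ o at the current vertex if it lies in the first
  -- sublattice, and at all its neighbours otherwise. The second alternative is needed because a
  -- reduced step jumps over an intermediate vertex.
  have hwalk : ∀ (x y : (⋃ i, latticeCoset Γ.v (Γ.p i) : Set (Fin d → ℝ))),
      (Γ.graph.induce (⋃ i, latticeCoset Γ.v (Γ.p i))).Walk x y →
      ((x : Fin d → ℝ) ∈ Γ.sublattice 0 → ℓ x = ℓ o) →
      ((x : Fin d → ℝ) ∉ Γ.sublattice 0 → ∀ z, Γ.graph.Adj x z → ℓ z = ℓ o) →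
      (y : Fin d → ℝ) ∈ Γ.sublattice 0 → ℓ y = ℓ o := by
    intro x y w
    induction w with
    | nil => intro h1 _ h3; exact h1 h3
    | @cons a b c hab _ ih =>
      intro h1 h2 h3
      have hab' : Γ.graph.Adj (a : Fin d → ℝ) b := hab
      refine ih (fun hb => ?_) (fun hb z hz => ?_) h3
      · by_cases ha : (a : Fin d → ℝ) ∈ Γ.sublattice 0
        · rw [hstep ha (mem_nbrs₂_of_adj hab') (reducedWeight_pos_of_adj hab' ha hb), h1 ha]
        · exact h2 ha b hab'
      · have ha : (a : Fin d → ℝ) ∈ Γ.sublattice 0 := hΓ.mem_of_adj hab'.symm hb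
        rw [hstep ha (mem_nbrs₂_of_adj_adj hab' hz) (reducedWeight_pos_of_adj_adj hab' hz hb), h1 ha]
  refine Γ.v.ext fun j => ?_
  have hj : Γ.v j ∈ latticeOf Γ.v := Submodule.subset_span (Set.mem_range_self j)
  have hoj : o + Γ.v j ∈ Γ.sublattice 0 := (add_mem_sublattice_iff hj).2 (p_mem_sublattice 0)
  obtain ⟨w⟩ := Γ.connected.preconnected ⟨o, sublattice_subset_verts 0 (p_mem_sublattice 0)⟩
    ⟨o + Γ.v j, sublattice_subset_verts 0 hoj⟩
  have := hwalk _ _ w (fun _ => rfl) (fun hn => absurd (p_mem_sublattice 0) hn) hoj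
  simpa using this

end PeriodicGraph

/-! ### The given norm as a Euclidean norm. -/

section GramMap

variable {d k : ℕ} {E : Matrix (Fin k) (Fin d) ℝ}

theorem eq_zero_of_mulVec_eq_zero (hE : Submodule.span ℝ (Set.range fun j => E j) = ⊤)
    {v : Fin d → ℝ} (hv : E.mulVec v = 0) : v = 0 := by
  have h1 : (⊤ : Submodule ℝ (Fin d → ℝ)) ≤ LinearMap.ker (dotProductBilin ℝ ℝ |>.flip v) := by
    rw [← hE, Submodule.span_le]
    rintro _ ⟨j, rfl⟩
    have := congrFun hv j
    simpa [Matrix.mulVec] using this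
  have h2 : v ⬝ᵥ v = 0 := by simpa using h1 (Submodule.mem_top (x := v))
  exact dotProduct_self_eq_zero.1 h2

theorem isUnit_det_transpose_mul_self (hE : Submodule.span ℝ (Set.range fun j => E j) = ⊤) :
    IsUnit (E.transpose * E).det := by
  rw [isUnit_iff_ne_zero]
  intro h0
  obtain ⟨v, hv, h⟩ := Matrix.exists_mulVec_eq_zero_iff.2 h0
  refine hv (eq_zero_of_mulVec_eq_zero hE (dotProduct_self_eq_zero.1 ?_))
  rw [Matrix.dotProduct_mulVec, ← Matrix.mulVec_transpose, Matrix.mulVec_mulVec, h, zero_dotProduct]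

variable (E) in
/-- The linear map realising the norm `gramNorm E` as a Euclidean norm. -/
noncomputable def gramMap : (Fin d → ℝ) →ₗ[ℝ] EuclideanSpace ℝ (Fin k) :=
  (WithLp.linearEquiv 2 ℝ (Fin k → ℝ)).symm.toLinearMap ∘ₗ E.mulVecLin ∘ₗ
    (E.transpose * E)⁻¹.mulVecLin

/-- With v = (EᵀE)⁻¹ x one has |E v|² = v · EᵀE v = v · x. -/
theorem norm_gramMap (hE : Submodule.span ℝ (Set.range fun j => E j) = ⊤) (x : Fin d → ℝ) :
    ‖gramMap E x‖ = gramNorm E x := by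
  have h1 : ‖gramMap E x‖ ^ 2 = x ⬝ᵥ (Matrix.mulVec (E.transpose * E)⁻¹ x) := by
    have h2 : gramMap E x = WithLp.toLp 2 (E.mulVec ((E.transpose * E)⁻¹.mulVec x)) := rfl
    set v := (E.transpose * E)⁻¹.mulVec x with hv
    rw [h2, EuclideanSpace.norm_sq_eq]
    have h3 : (E.transpose * E).mulVec v = x := by
      rw [hv, Matrix.mulVec_mulVec, Matrix.mul_nonsing_inv _ (isUnit_det_transpose_mul_self hE),
        Matrix.one_mulVec]
    have h4 : E.mulVec v ⬝ᵥ E.mulVec v = x ⬝ᵥ v := by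
      rw [Matrix.dotProduct_mulVec, ← Matrix.mulVec_transpose, Matrix.mulVec_mulVec, h3]
    rw [← h4, dotProduct]
    exact Finset.sum_congr rfl fun i _ => by rw [Real.norm_eq_abs, sq_abs]; exact sq _
  rw [gramNorm, ← h1, Real.sqrt_sq (norm_nonneg _)]

theorem gramMap_injective (hE : Submodule.span ℝ (Set.range fun j => E j) = ⊤) :
    Function.Injective (gramMap E) := by
  refine (injective_iff_map_eq_zero _).2 fun x hx => ?_
  have h1 : E.mulVec ((E.transpose * E)⁻¹.mulVec x) = 0 := congrArg (WithLp.ofLp) hx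
  have h2 := eq_zero_of_mulVec_eq_zero hE h1
  have h3 : (E.transpose * E).mulVec ((E.transpose * E)⁻¹.mulVec x) = x := by
    rw [Matrix.mulVec_mulVec, Matrix.mul_nonsing_inv _ (isUnit_det_transpose_mul_self hE),
      Matrix.one_mulVec]
  rw [← h3, h2, Matrix.mulVec_zero]

end GramMap

/-! ### Ellipticity of the reduced stencil and finiteness of balls. -/

namespace PeriodicGraph

variable {d s : ℕ} {Γ : PeriodicGraph d s} {Y : Type*} [NormedAddCommGroup Y]
  [InnerProductSpace ℝ Y] {T : (Fin d → ℝ) →ₗ[ℝ] Y}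

/-- If the form vanishes at `T x`, the linear form ⟪T x, T ·⟫ vanishes on all steps of positive
weight, hence identically, and x = 0. Compactness of the unit sphere and homogeneity then give a
uniform `b`. -/
theorem IsStar.exists_moment_bound [NeZero s] (hΓ : Γ.IsStar) (hT : Function.Injective T) :
    ∃ b : ℝ, 0 < b ∧ ∀ x, b * ‖T x‖ ^ 2 ≤ (reducedStencil hΓ).moment T.toAddMonoidHom (T x) := by
  set S := reducedStencil hΓ with hS
  have hTc : Continuous T := T.continuous_of_finiteDimensional
  set f : (Fin d → ℝ) → ℝ := fun x => S.moment T.toAddMonoidHom (T x) with hf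
  have hfe : ∀ x, f x = ∑ e ∈ S.steps, S.wt e * ⟪T x, T e⟫ ^ 2 := fun _ => rfl
  have hfc : Continuous f := by
    simp only [hf, Stencil.moment]
    fun_prop
  have hpos : ∀ x, x ≠ 0 → 0 < f x := fun x hx => by
    have hterm : ∀ e ∈ S.steps, 0 ≤ S.wt e * ⟪T x, T e⟫ ^ 2 := fun e _ =>
      mul_nonneg (S.wt_nonneg e) (sq_nonneg _)
    refine lt_of_le_of_ne (by rw [hfe]; exact Finset.sum_nonneg hterm) fun h0 => hx ?_
    rw [hfe] at h0
    have h1 := (Finset.sum_eq_zero_iff_of_nonneg hterm).1 h0.symm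
    have h2 := hΓ.eq_zero_of_forall_step ((innerₗ Y (T x)) ∘ₗ T) fun e he hpos => by
      have := h1 e he
      rcases mul_eq_zero.1 this with h | h
      · exact absurd h hpos.ne'
      · exact pow_eq_zero_iff two_ne_zero |>.1 h
    have h3 : ⟪T x, T x⟫ = 0 := congrArg (fun ℓ : (Fin d → ℝ) →ₗ[ℝ] ℝ => ℓ x) h2
    exact hT (by rw [inner_self_eq_zero.1 h3, map_zero])
  have hmin : ∃ m, 0 < m ∧ ∀ x, ‖x‖ = 1 → m ≤ f x := by
    -- In dimension 0 the unit sphere is empty.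
    rcases (Metric.sphere (0 : Fin d → ℝ) 1).eq_empty_or_nonempty with he | hne
    · exact ⟨1, one_pos, fun x hx => absurd (he ▸ mem_sphere_zero_iff_norm.2 hx)
        (Set.notMem_empty x)⟩
    · obtain ⟨y, hy, hmin⟩ := (isCompact_sphere (0 : Fin d → ℝ) 1).exists_isMinOn hne
        hfc.continuousOn
      refine ⟨f y, hpos y fun h0 => ?_, fun x hx => hmin (mem_sphere_zero_iff_norm.2 hx)⟩
      rw [h0, mem_sphere_zero_iff_norm, norm_zero] at hy
      exact zero_ne_one hy
  obtain ⟨m, hm, hmin⟩ := hmin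
  set Tc := LinearMap.toContinuousLinearMap T with hTc'
  refine ⟨m / (‖Tc‖ ^ 2 + 1), by positivity, fun x => ?_⟩
  have h1 : m * ‖x‖ ^ 2 ≤ f x := by
    rcases eq_or_ne x 0 with rfl | hx
    · rw [norm_zero, hfe]
      simp
    · have hx' : ‖x‖ ≠ 0 := norm_ne_zero_iff.2 hx
      have h2 := hmin (‖x‖⁻¹ • x) (by rw [norm_smul, norm_inv, norm_norm, inv_mul_cancel₀ hx'])
      have h3 : f (‖x‖⁻¹ • x) = (‖x‖ ^ 2)⁻¹ * f x := by
        rw [hfe, hfe, Finset.mul_sum]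
        refine Finset.sum_congr rfl fun e _ => ?_
        rw [map_smul, real_inner_smul_left, mul_pow, inv_pow]; ring
      rw [h3, ← div_eq_inv_mul, le_div_iff₀ (by positivity)] at h2
      exact h2
  have h2 : ‖T x‖ ^ 2 ≤ ‖Tc‖ ^ 2 * ‖x‖ ^ 2 := by
    rw [← mul_pow]
    exact pow_le_pow_left₀ (norm_nonneg _) (Tc.le_opNorm x) 2
  refine le_trans ?_ h1
  rw [div_mul_eq_mul_div, div_le_iff₀ (by positivity)]
  nlinarith [sq_nonneg ‖x‖]

/-- An injective linear map in finite dimension is bounded below, so the set is bounded, and each of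
the finitely many lattice cosets meets it in finitely many points. -/
theorem finite_verts_ball (hT : Function.Injective T) {h : ℝ} (hh : 0 < h) (r : ℝ) :
    (Γ.verts ∩ {z | ‖h • T z‖ ≤ r}).Finite := by
  have hb : Bornology.IsBounded {z : Fin d → ℝ | ‖h • T z‖ ≤ r} := by
    obtain ⟨K, -, hK⟩ := T.exists_antilipschitzWith (LinearMap.ker_eq_bot.2 hT)
    refine (hK.isBounded_preimage (Metric.isBounded_closedBall (x := (0 : Y)) (r := r / h))).subset
      fun z hz => ?_
    rw [Set.mem_ofPred_eq, norm_smul, Real.norm_of_nonneg hh.le] at hz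
    rw [Set.mem_preimage, mem_closedBall_zero_iff, le_div_iff₀ hh, mul_comm]
    exact hz
  rw [verts, Set.iUnion_inter]
  refine Set.finite_iUnion fun i => ?_
  have hb' : Bornology.IsBounded ((fun z => z + -Γ.p i) '' {z : Fin d → ℝ | ‖h • T z‖ ≤ r}) :=
    (IsometryEquiv.addRight (-Γ.p i)).isometry.lipschitz.isBounded_image hb
  refine ((ZSpan.setFinite_inter Γ.v hb').image (fun z => Γ.p i + z)).subset ?_
  rintro z ⟨⟨l, hl, rfl⟩, hz⟩
  exact ⟨l, ⟨⟨_, hz, by simp⟩, hl⟩, rfl⟩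

end PeriodicGraph

/-! ### Elimination of the vertices outside the first sublattice. -/

namespace PeriodicGraph

variable {d s : ℕ} {Γ : PeriodicGraph d s}

section Elimination

variable {U W w : (Fin d → ℝ) → ℝ} {m : ℝ}

/-- The value at a vertex is controlled by the values at its neighbours. -/
theorem abs_le_two_mul_sum_nbrs {y : Fin d → ℝ} (hy : 0 < (Γ.nbrs y).card) (hW : |W y| ≤ 1 / 2)
    (h : ∑ z ∈ Γ.nbrs y, (U z - U y) = -(W y * U y)) :
    |U y| ≤ 2 * ∑ z ∈ Γ.nbrs y, |U z| := by
  have h1 : (((Γ.nbrs y).card : ℝ) - W y) * U y = ∑ z ∈ Γ.nbrs y, U z := by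
    rw [Finset.sum_sub_distrib, Finset.sum_const, nsmul_eq_mul] at h
    linarith
  have h2 : (1 : ℝ) / 2 ≤ ((Γ.nbrs y).card : ℝ) - W y := by
    have : (1 : ℝ) ≤ (Γ.nbrs y).card := by exact_mod_cast hy
    linarith [(abs_le.1 hW).2]
  have h3 : (((Γ.nbrs y).card : ℝ) - W y) * |U y| ≤ ∑ z ∈ Γ.nbrs y, |U z| := by
    rw [← abs_of_nonneg (by linarith : 0 ≤ ((Γ.nbrs y).card : ℝ) - W y), ← abs_mul, h1]
    exact Finset.abs_sum_le_sum_abs _ _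
  nlinarith [abs_nonneg (U y)]

variable [NeZero s]

theorem card_nbrs_pos {y : Fin d → ℝ} (hy : y ∈ Γ.verts)
    (hy0 : y ∉ Γ.sublattice 0) : 0 < (Γ.nbrs y).card := by
  obtain ⟨z, hz⟩ := exists_adj hy hy0
  exact Finset.card_pos.2 ⟨z, mem_nbrs.2 hz⟩

theorem sum_nbrs_nbrs_le (hΓ : Γ.IsStar) {x y : Fin d → ℝ} (hx : x ∈ Γ.sublattice 0)
    (hxy : Γ.graph.Adj x y) {g : (Fin d → ℝ) → ℝ} (hg : ∀ z, 0 ≤ g z) :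
    ∑ z ∈ Γ.nbrs y, g z ≤ ∑ e ∈ (reducedStencil hΓ).steps, g (x + e) := by
  classical
  rw [← Finset.sum_image (f := g) (g := fun e => x + e) (fun a _ b _ h => add_left_cancel h)]
  refine Finset.sum_le_sum_of_subset_of_nonneg (fun z hz => ?_) fun z _ _ => hg z
  exact Finset.mem_image.2 ⟨z - x, sub_mem_reducedSteps hx
    (mem_nbrs₂_of_adj_adj hxy (mem_nbrs.1 hz)), add_sub_cancel _ _⟩

/-- Eliminating the vertices outside the first sublattice leaves a small potential. -/
theorem IsStar.abs_lap_le (hΓ : Γ.IsStar) {x : Fin d → ℝ} (hx : x ∈ Γ.sublattice 0)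
    (hm : m ≤ 1 / 2) (hW : ∀ z, |W z| ≤ m)
    (hUx : ∑ z ∈ Γ.nbrs x, (U z - U x) = -(W x * U x))
    (hUy : ∀ y ∈ Γ.nbrs x, ∑ z ∈ Γ.nbrs y, (U z - U y) = -(W y * U y))
    (hw : ∀ e ∈ (reducedStencil hΓ).steps, x + e ∈ Γ.sublattice 0 → w (x + e) = U (x + e)) :
    |(reducedStencil hΓ).lap w x| ≤
      m * (1 + 2 * (Γ.nbrs x).card) * ∑ e ∈ (reducedStencil hΓ).steps, |w (x + e)| := by
  classical
  set S := reducedStencil hΓ with hS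
  set q := ∑ e ∈ S.steps, |w (x + e)| with hq
  have hm0 : 0 ≤ m := (abs_nonneg _).trans (hW 0)
  have hw0 : w x = U x := by simpa using hw 0 zero_mem_reducedSteps (by simpa using hx)
  have hlap : S.lap w x = ∑ e ∈ S.steps, S.wt e * (U (x + e) - U x) := by
    refine Finset.sum_congr rfl fun e he => ?_
    by_cases h0 : S.wt e = 0
    · rw [h0, zero_mul, zero_mul]
    · rw [hΓ.wt_eq hx] at h0
      rw [hw e he (hΓ.mem_of_reducedWeight_ne_zero h0).2, hw0]
  rw [hΓ.sum_wt_mul hx (fun z => U z - U x)] at hlap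
  have hydeg : ∀ y ∈ (Γ.nbrs x).filter (· ∉ Γ.sublattice 0), 0 < (Γ.nbrs y).card := fun y hy =>
    Finset.card_pos.2 ⟨x, mem_nbrs.2 (mem_nbrs.1 (Finset.mem_filter.1 hy).1).symm⟩
  -- The equation at `y` turns the mean of U z - U x over the neighbours z of y into U y - U x up to
  -- a potential term. The two-step part of the reduced Laplacian thus supplies exactly the
  -- differences missing from the equation at `x`.
  have hy1 : ∀ y ∈ (Γ.nbrs x).filter (· ∉ Γ.sublattice 0),
      ((Γ.nbrs y).card : ℝ)⁻¹ * ∑ z ∈ Γ.nbrs y, (U z - U x) =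
        (U y - U x) - ((Γ.nbrs y).card : ℝ)⁻¹ * (W y * U y) := fun y hy => by
    have hc : ((Γ.nbrs y).card : ℝ) ≠ 0 := by exact_mod_cast (hydeg y hy).ne'
    have h1 := hUy y (Finset.mem_filter.1 hy).1
    have h2 : ∑ z ∈ Γ.nbrs y, (U z - U x) = ((Γ.nbrs y).card : ℝ) * (U y - U x) - W y * U y := by
      rw [sub_eq_add_neg (_ * _), ← h1, ← nsmul_eq_mul, ← Finset.sum_const,
        ← Finset.sum_add_distrib]
      exact Finset.sum_congr rfl fun z _ => by ring
    rw [h2]; field_simp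
  rw [Finset.sum_congr rfl hy1,
    Finset.sum_sub_distrib (s := (Γ.nbrs x).filter (· ∉ Γ.sublattice 0)) (f := fun y => U y - U x),
    ← add_sub_assoc, Finset.sum_filter_add_sum_filter_not, hUx] at hlap
  have hS0 : ∀ e ∈ S.steps, |w (x + e)| ≤ q := fun e he =>
    Finset.single_le_sum (f := fun e => |w (x + e)|) (fun _ _ => abs_nonneg _) he
  have hUxS : |U x| ≤ q := by simpa [hw0] using hS0 0 zero_mem_reducedSteps
  have hq0 : 0 ≤ q := (abs_nonneg _).trans hUxS
  have hterm : ∀ y ∈ (Γ.nbrs x).filter (· ∉ Γ.sublattice 0),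
      |((Γ.nbrs y).card : ℝ)⁻¹ * (W y * U y)| ≤ m * (2 * q) := fun y hy => by
    obtain ⟨hyx, hy0⟩ := Finset.mem_filter.1 hy
    have hxy := mem_nbrs.1 hyx
    have h1 := abs_le_two_mul_sum_nbrs (hydeg y hy) ((hW y).trans hm) (hUy y hyx)
    have h2 : ∑ z ∈ Γ.nbrs y, |U z| = ∑ z ∈ Γ.nbrs y, |w z| :=
      Finset.sum_congr rfl fun z hz => by
        have hz' := mem_nbrs.1 hz
        have := hw (z - x) (sub_mem_reducedSteps hx (mem_nbrs₂_of_adj_adj hxy hz'))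
        rw [add_sub_cancel] at this
        rw [this (hΓ.mem_of_adj hz' hy0)]
    have h3 := sum_nbrs_nbrs_le hΓ hx hxy (g := fun z => |w z|) fun _ => abs_nonneg _
    have hc : ((Γ.nbrs y).card : ℝ)⁻¹ ≤ 1 := inv_le_one_of_one_le₀ (by exact_mod_cast hydeg y hy)
    rw [abs_mul, abs_mul, abs_of_nonneg (by positivity : (0 : ℝ) ≤ ((Γ.nbrs y).card : ℝ)⁻¹)]
    calc ((Γ.nbrs y).card : ℝ)⁻¹ * (|W y| * |U y|) ≤ 1 * (m * (2 * q)) := by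
          gcongr
          · exact hW y
          · rw [h2] at h1; linarith
      _ = _ := one_mul _
  have hsum := (Finset.abs_sum_le_sum_abs _ _).trans (Finset.sum_le_card_nsmul _ _ _ hterm)
  rw [nsmul_eq_mul] at hsum
  have hcard : (((Γ.nbrs x).filter (· ∉ Γ.sublattice 0)).card : ℝ) ≤ (Γ.nbrs x).card := by
    exact_mod_cast Finset.card_filter_le _ _
  have h1 : |W x * U x| ≤ m * q := by
    rw [abs_mul]; exact mul_le_mul (hW x) hUxS (abs_nonneg _) hm0
  rw [hlap]
  calc _ ≤ |W x * U x| + _ := (abs_sub _ _).trans (by rw [abs_neg])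
    _ ≤ m * q + (Γ.nbrs x).card * (m * (2 * q)) :=
      add_le_add h1 (hsum.trans (mul_le_mul_of_nonneg_right hcard (by positivity)))
    _ = _ := by ring

/-- A step of nonzero weight is a lattice vector and cannot enter the first sublattice from outside.
This settles the points off that coset, as the stencil acts on the whole ambient group. -/
theorem IsStar.lap_eq_zero (hΓ : Γ.IsStar) {x : Fin d → ℝ} (hx : x ∉ Γ.sublattice 0)
    (hw : ∀ z, z ∉ Γ.sublattice 0 → w z = 0) : (reducedStencil hΓ).lap w x = 0 := by
  refine Finset.sum_eq_zero fun e _ => ?_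
  by_cases h0 : (reducedStencil hΓ).wt e = 0
  · rw [h0, zero_mul]
  · rw [hw x hx, hw _ (mt (hΓ.add_mem_of_wt_ne_zero h0) hx), sub_zero, mul_zero]

theorem card_nbrs_of_mem {x : Fin d → ℝ} (hx : x ∈ Γ.sublattice 0) :
    (Γ.nbrs x).card = (Γ.nbrs (Γ.p 0)).card := by
  obtain ⟨l, hl, rfl⟩ := hx
  exact card_nbrs_add hl

/-- Square version of `abs_le_two_mul_sum_nbrs`. -/
theorem IsStar.sq_le_sum_nbrs (hΓ : Γ.IsStar) {y : Fin d → ℝ} (hy : y ∈ Γ.verts)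
    (hy0 : y ∉ Γ.sublattice 0) (hW : |W y| ≤ 1 / 2)
    (h : ∑ z ∈ Γ.nbrs y, (U z - U y) = -(W y * U y)) :
    U y ^ 2 ≤ 4 * (reducedStencil hΓ).steps.card * ∑ z ∈ Γ.nbrs y, U z ^ 2 := by
  classical
  have h1 := abs_le_two_mul_sum_nbrs (card_nbrs_pos hy hy0) hW h
  obtain ⟨x, hx⟩ := exists_adj hy hy0
  have h2 : ((Γ.nbrs y).card : ℝ) ≤ (reducedStencil hΓ).steps.card := by
    have := sum_nbrs_nbrs_le hΓ (hΓ.mem_of_adj hx hy0) hx.symm (g := fun _ => 1)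
      fun _ => zero_le_one
    simpa using this
  have h3 : (∑ z ∈ Γ.nbrs y, |U z|) ^ 2 ≤ (Γ.nbrs y).card * ∑ z ∈ Γ.nbrs y, U z ^ 2 := by
    simpa only [sq_abs] using sq_sum_le_card_mul_sum_sq (s := Γ.nbrs y) (f := fun z => |U z|)
  have h4 : 0 ≤ ∑ z ∈ Γ.nbrs y, U z ^ 2 := Finset.sum_nonneg fun _ _ => sq_nonneg _
  calc U y ^ 2 = |U y| ^ 2 := (sq_abs _).symm
    _ ≤ (2 * ∑ z ∈ Γ.nbrs y, |U z|) ^ 2 := pow_le_pow_left₀ (abs_nonneg _) h1 2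
    _ = 4 * (∑ z ∈ Γ.nbrs y, |U z|) ^ 2 := by ring
    _ ≤ 4 * ((reducedStencil hΓ).steps.card * ∑ z ∈ Γ.nbrs y, U z ^ 2) := by
        gcongr
        exact h3.trans (mul_le_mul_of_nonneg_right h2 h4)
    _ = _ := by ring

end Elimination

end PeriodicGraph

/-! ### Transfer of the three balls inequality to the graph. -/

namespace PeriodicGraph

variable {d s : ℕ} {Γ : PeriodicGraph d s} [NeZero s] {Y : Type*} [NormedAddCommGroup Y]
  [InnerProductSpace ℝ Y] {T : (Fin d → ℝ) →ₗ[ℝ] Y}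

open scoped Classical in
/-- The vertices outside the first sublattice are controlled by those inside. -/
theorem IsStar.ballMass_le (hΓ : Γ.IsStar) {h : ℝ} {U W w : (Fin d → ℝ) → ℝ}
    {Q Ω : Finset (Fin d → ℝ)} (hQ : ∀ z ∈ Q, z ∈ Γ.verts)
    (hW : ∀ z, |W z| ≤ 1 / 2)
    (hU : ∀ y ∈ Q, y ∉ Γ.sublattice 0 → ‖h • T y‖ ≤ 1 →
      ∑ z ∈ Γ.nbrs y, (U z - U y) = -(W y * U y))
    (hw0 : ∀ z, z ∉ Γ.sublattice 0 → w z = 0)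
    (hw : ∀ z ∈ Γ.sublattice 0, ‖h • T z‖ ≤ 11 / 10 → w z = U z)
    (hΩ : ∀ z ∈ Γ.sublattice 0, ‖h • T z‖ ≤ 11 / 10 → z ∈ Ω)
    (hT : ∀ e ∈ (reducedStencil hΓ).steps, ‖h • T e‖ ≤ 1 / 10) :
    Stencil.ballMass T.toAddMonoidHom h U Q 1 ≤
      (1 + 4 * (reducedStencil hΓ).steps.card * (Γ.nbrs (Γ.p 0)).card) *
        Stencil.ballMass T.toAddMonoidHom h w Ω (11 / 10) := by
  set N : ℝ := ((reducedStencil hΓ).steps.card : ℝ) with hN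
  set D : ℝ := ((Γ.nbrs (Γ.p 0)).card : ℝ) with hD
  have hin : ∑ z ∈ Q.filter (· ∈ Γ.sublattice 0), (if ‖h • T z‖ ≤ 1 then U z ^ 2 else 0) ≤
      Stencil.ballMass T.toAddMonoidHom h w Ω (11 / 10) := by
    rw [← Finset.sum_filter]
    refine le_trans ?_ (Finset.sum_le_sum_of_subset_of_nonneg
      (s := (Q.filter (· ∈ Γ.sublattice 0)).filter fun z => ‖h • T z‖ ≤ 1) (fun z hz => ?_)
      fun z _ _ => by split_ifs <;> positivity)
    · refine Finset.sum_le_sum fun z hz => ?_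
      obtain ⟨hz, hz1⟩ := Finset.mem_filter.1 hz
      have hz2 : ‖h • T z‖ ≤ 11 / 10 := hz1.trans (by norm_num)
      rw [if_pos (by exact hz2), hw z (Finset.mem_filter.1 hz).2 hz2]
    · obtain ⟨hz, hz1⟩ := Finset.mem_filter.1 hz
      exact hΩ z (Finset.mem_filter.1 hz).2 (hz1.trans (by norm_num))
  have hone : ∀ y ∈ Q.filter (· ∉ Γ.sublattice 0), (if ‖h • T y‖ ≤ 1 then U y ^ 2 else 0) ≤
      4 * N * ∑ z ∈ Ω, if y ∈ Γ.nbrs z then (if ‖h • T z‖ ≤ 11 / 10 then w z ^ 2 else 0) else 0 :=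
    fun y hy => by
    obtain ⟨hyQ, hy0⟩ := Finset.mem_filter.1 hy
    split_ifs with h1
    swap
    · exact mul_nonneg (by positivity) (Finset.sum_nonneg fun z _ => by split_ifs <;> positivity)
    refine (hΓ.sq_le_sum_nbrs (hQ y hyQ) hy0 (hW y) (hU y hyQ hy0 h1)).trans ?_
    refine mul_le_mul_of_nonneg_left ?_ (by positivity)
    have hz : ∀ z ∈ Γ.nbrs y, z ∈ Γ.sublattice 0 ∧ ‖h • T z‖ ≤ 11 / 10 := fun z hz => by
      have hz' := mem_nbrs.1 hz
      have hz0 := hΓ.mem_of_adj hz' hy0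
      refine ⟨hz0, ?_⟩
      have h2 := hT _ (sub_mem_reducedSteps hz0 (mem_nbrs₂_of_adj hz'.symm))
      have h3 : h • T z = h • T y - h • T (y - z) := by rw [map_sub, smul_sub]; abel
      rw [h3]
      exact (norm_sub_le _ _).trans (by linarith)
    have hnn : ∀ z, 0 ≤ if ‖h • T z‖ ≤ 11 / 10 then w z ^ 2 else 0 := fun z => by
      split_ifs
      · exact sq_nonneg _
      · exact le_rfl
    rw [← Finset.sum_filter]
    refine le_trans (le_of_eq (Finset.sum_congr rfl fun z hz' => ?_))
      (Finset.sum_le_sum_of_subset_of_nonneg (s := Γ.nbrs y) (fun z hz' => ?_) fun z _ _ => hnn z)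
    · rw [if_pos (hz z hz').2, hw z (hz z hz').1 (hz z hz').2]
    · exact Finset.mem_filter.2 ⟨hΩ z (hz z hz').1 (hz z hz').2,
        mem_nbrs.2 (mem_nbrs.1 hz').symm⟩
  -- After the sums are exchanged, each z in the first sublattice is counted at most once for each
  -- of its neighbours, hence at most D times.
  have hout : ∑ y ∈ Q.filter (· ∉ Γ.sublattice 0), (if ‖h • T y‖ ≤ 1 then U y ^ 2 else 0) ≤
      4 * N * (D * Stencil.ballMass T.toAddMonoidHom h w Ω (11 / 10)) := by
    refine (Finset.sum_le_sum hone).trans ?_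
    rw [← Finset.mul_sum, Finset.sum_comm, Stencil.ballMass, Finset.mul_sum Ω _ D]
    refine mul_le_mul_of_nonneg_left (Finset.sum_le_sum fun z _ => ?_) (by positivity)
    rw [← Finset.sum_filter, Finset.sum_const, nsmul_eq_mul]
    by_cases hz : z ∈ Γ.sublattice 0
    · refine mul_le_mul_of_nonneg_right ?_ (by split_ifs <;> positivity)
      rw [hD, ← card_nbrs_of_mem hz]
      exact_mod_cast Finset.card_le_card fun y hy => (Finset.mem_filter.1 hy).2
    · simp [hw0 z hz]
  have := add_le_add hin hout
  rw [Finset.sum_filter_add_sum_filter_not] at this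
  refine le_trans (le_of_eq ?_) (this.trans (le_of_eq ?_))
  · rfl
  · ring

/-- The three balls inequality for graphs, in terms of functions on the ambient space. -/
theorem IsStar.exists_ballMass_three_balls [FiniteDimensional ℝ Y] (hΓ : Γ.IsStar)
    (hT : Function.Injective T) (M : ℝ) :
    ∃ C c ε : ℝ, 0 < C ∧ 0 < c ∧ 0 < ε ∧ ε ≤ 1 ∧ ∀ h τ : ℝ, 0 < h → h ≤ ε → τ * h ≤ ε →
      1 ≤ ε * τ → ∀ (U V : (Fin d → ℝ) → ℝ) (Q : Finset (Fin d → ℝ)), (∀ z, |V z| ≤ M) →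
      (∀ z, z ∈ Q ↔ z ∈ Γ.verts ∧ ‖h • T z‖ ≤ 4) →
      (∀ z ∈ Q, ∑ y ∈ Γ.nbrs z, (U y - U z) = -(h ^ 2 * V z * U z)) →
      Stencil.ballMass T.toAddMonoidHom h U Q 1 ≤
        C * (Real.exp (2 * τ) * Stencil.ballMass T.toAddMonoidHom h U Q (1 / 2) +
          Real.exp (-(2 * c * τ)) * Stencil.ballMass T.toAddMonoidHom h U Q 2) := by
  classical
  rcases lt_or_ge M 0 with hM | hM
  · exact ⟨1, 1, 1, one_pos, one_pos, one_pos, le_rfl, fun h τ _ _ _ _ U V Q hV =>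
      absurd ((abs_nonneg _).trans (hV 0)) (not_le.2 hM)⟩
  set S := reducedStencil hΓ with hS
  set D : ℝ := ((Γ.nbrs (Γ.p 0)).card : ℝ) with hD
  obtain ⟨b, hb, hmom⟩ := hΓ.exists_moment_bound hT
  obtain ⟨C, c, ε, hC, hc, hε, hε1, key⟩ := S.exists_ballMass_three_balls T.toAddMonoidHom
    zero_mem_reducedSteps (A := M * (1 + 2 * D)) (by positivity) hb hmom
  set R : ℝ := ∑ e ∈ S.steps, ‖T e‖ with hR
  have hR0 : 0 ≤ R := Finset.sum_nonneg fun _ _ => norm_nonneg _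
  refine ⟨(1 + 4 * S.steps.card * D) * C, c, min ε (min (1 / (10 * (R + 1))) (1 / (2 * (M + 1)))),
    by positivity, hc, by positivity, (min_le_left _ _).trans hε1, ?_⟩
  intro h τ hh hhε hτh hτ U V Q hV hQ hU
  have hh1 := hhε.trans (min_le_left _ _)
  have hhR := hhε.trans ((min_le_right _ _).trans (min_le_left _ _))
  have hhM := hhε.trans ((min_le_right _ _).trans (min_le_right _ _))
  rw [le_div_iff₀ (by positivity)] at hhR hhM
  have hτ0 : 0 ≤ τ := by
    by_contra hn
    have : (min ε (min (1 / (10 * (R + 1))) (1 / (2 * (M + 1))))) * τ ≤ 0 :=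
      mul_nonpos_of_nonneg_of_nonpos (by positivity) (not_le.1 hn).le
    linarith
  have hτε : 1 ≤ ε * τ := hτ.trans (mul_le_mul_of_nonneg_right (min_le_left _ _) hτ0)
  have hm : h ^ 2 * M ≤ 1 / 2 := by nlinarith [mul_nonneg hh.le hM]
  have hW : ∀ z, |h ^ 2 * V z| ≤ h ^ 2 * M := fun z => by
    rw [abs_mul, abs_of_nonneg (sq_nonneg h)]
    exact mul_le_mul_of_nonneg_left (hV z) (sq_nonneg h)
  have hTe : ∀ e ∈ S.steps, ‖h • T e‖ ≤ 1 / 10 := fun e he => by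
    have : ‖T e‖ ≤ R := Finset.single_le_sum (f := fun e => ‖T e‖) (fun _ _ => norm_nonneg _) he
    rw [norm_smul, Real.norm_of_nonneg hh.le]
    nlinarith
  have hTadd : ∀ {x e}, e ∈ S.steps → ‖h • T (x + e)‖ ≤ ‖h • T x‖ + 1 / 10 := fun {x e} he => by
    rw [map_add, smul_add]
    exact (norm_add_le _ _).trans (add_le_add_right (hTe e he) _)
  -- The solution restricted to the first sublattice and truncated at radius 3. Steps have length at
  -- most 1/10, so the truncation is not seen by the Laplacian on the ball of radius 2.
  set w : (Fin d → ℝ) → ℝ := fun z => if z ∈ Γ.sublattice 0 ∧ ‖h • T z‖ ≤ 3 then U z else 0 with hw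
  have hwU : ∀ z ∈ Γ.sublattice 0, ‖h • T z‖ ≤ 3 → w z = U z := fun z h1 h2 => if_pos ⟨h1, h2⟩
  have hw0 : ∀ z, z ∉ Γ.sublattice 0 → w z = 0 := fun z hz => if_neg fun h' => hz h'.1
  have hwQ : ∀ z, w z ≠ 0 → z ∈ Q ∧ w z = U z := fun z hz => by
    by_cases h' : z ∈ Γ.sublattice 0 ∧ ‖h • T z‖ ≤ 3
    · exact ⟨(hQ z).2 ⟨sublattice_subset_verts 0 h'.1, h'.2.trans (by norm_num)⟩, if_pos h'⟩
    · exact absurd (if_neg h') hz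
  set Ω : Finset (Fin d → ℝ) := Finset.image₂ (fun x e => x + e) Q S.steps with hΩ
  have hQΩ : Q ⊆ Ω := fun z hz =>
    Finset.mem_image₂.2 ⟨z, hz, 0, zero_mem_reducedSteps, add_zero z⟩
  have hcov : S.Covers w Ω := fun x hx =>
    ⟨hQΩ (hwQ x hx).1, fun e he => Finset.mem_image₂_of_mem (hwQ x hx).1 he⟩
  have hmass : ∀ r, Stencil.ballMass T.toAddMonoidHom h w Ω r ≤
      Stencil.ballMass T.toAddMonoidHom h U Q r := fun r => by
    rw [Stencil.ballMass, ← Finset.sum_subset hQΩ fun z _ hz => by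
      rw [show w z = 0 from by_contra fun h' => hz (hwQ z h').1]; simp]
    refine Finset.sum_le_sum fun z _ => ?_
    split_ifs
    · by_cases h' : w z = 0
      · rw [h', zero_pow two_ne_zero]; exact sq_nonneg _
      · rw [(hwQ z h').2]
    · exact le_rfl
  have hlap : ∀ x, ‖h • T.toAddMonoidHom x‖ ≤ 2 →
      |S.lap w x| ≤ M * (1 + 2 * D) * h ^ 2 * ∑ e ∈ S.steps, |w (x + e)| := fun x hx => by
    by_cases hx0 : x ∈ Γ.sublattice 0
    · have hxQ : x ∈ Q := (hQ x).2 ⟨sublattice_subset_verts 0 hx0, hx.trans (by norm_num)⟩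
      have := hΓ.abs_lap_le (U := U) (W := fun z => h ^ 2 * V z) (w := w) hx0 hm hW (hU x hxQ)
        (fun y hy => hU y ((hQ y).2 ⟨mem_verts_of_adj (mem_nbrs.1 hy).symm, ?_⟩))
        (fun e he hxe => hwU _ hxe ((hTadd he).trans (by
          have : ‖h • T x‖ ≤ 2 := hx
          linarith)))
      · rw [card_nbrs_of_mem hx0] at this
        exact this.trans (le_of_eq (by ring))
      · have h2 := hTadd (x := x) (sub_mem_reducedSteps hx0 (mem_nbrs₂_of_adj (mem_nbrs.1 hy)))
        rw [add_sub_cancel] at h2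
        have : ‖h • T x‖ ≤ 2 := hx
        linarith
    · rw [hΓ.lap_eq_zero hx0 hw0, abs_zero]
      exact mul_nonneg (by positivity) (Finset.sum_nonneg fun _ _ => abs_nonneg _)
  have h1 := key h τ hh hh1 (hτh.trans (min_le_left _ _)) hτε w Ω hcov hlap
  have h2 := hΓ.ballMass_le (T := T) (h := h) (U := U) (W := fun z => h ^ 2 * V z) (w := w) (Q := Q)
    (Ω := Ω) (fun z hz => ((hQ z).1 hz).1) (fun z => (hW z).trans hm) (fun y hy _ _ => hU y hy) hw0
    (fun z hz hz' => hwU z hz (hz'.trans (by norm_num)))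
    (fun z hz hz' => hQΩ ((hQ z).2 ⟨sublattice_subset_verts 0 hz, hz'.trans (by norm_num)⟩)) hTe
  refine h2.trans ?_
  rw [mul_assoc (_ + _) C]
  refine mul_le_mul_of_nonneg_left (h1.trans ?_) (by positivity)
  gcongr
  · exact hmass _
  · exact hmass _

end PeriodicGraph

/-! ### Passage between mesh size h and mesh size one. -/

namespace PeriodicGraph

variable {d s : ℕ} {Γ : PeriodicGraph d s}

open scoped Classical in
/-- A function on the mesh of size `h`, read at mesh size one and extended by zero. -/
noncomputable def pull (h : ℝ) (u : Γ.meshVerts h → ℝ) (z : Fin d → ℝ) : ℝ :=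
  if hz : h • z ∈ Γ.meshVerts h then u ⟨h • z, hz⟩ else 0

theorem pull_inv_smul {h : ℝ} (hh : h ≠ 0) (u : Γ.meshVerts h → ℝ) (x : Γ.meshVerts h) :
    pull h u (h⁻¹ • (x : Fin d → ℝ)) = u x := by
  have : h • h⁻¹ • (x : Fin d → ℝ) = x := smul_inv_smul₀ hh _
  rw [pull, dif_pos (by rw [this]; exact x.2)]
  exact congrArg u (Subtype.ext this)

theorem laplacian_eq {h : ℝ} (hh : h ≠ 0) (u : Γ.meshVerts h → ℝ) (x : Γ.meshVerts h) :
    Γ.laplacian h u x = ∑ y ∈ Γ.nbrs (h⁻¹ • (x : Fin d → ℝ)),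
      (pull h u y - pull h u (h⁻¹ • (x : Fin d → ℝ))) := by
  rw [laplacian, ← finsum_mem_coe_finset]
  refine finsum_mem_eq_of_bijOn (fun y => h⁻¹ • (y : Fin d → ℝ)) ⟨fun y hy => ?_, fun y _ y' _ hyy => ?_,
    fun z hz => ?_⟩ fun y _ => by rw [pull_inv_smul hh, pull_inv_smul hh]
  · exact Finset.mem_coe.2 (mem_nbrs.2 hy)
  · exact Subtype.ext (smul_right_injective _ (inv_ne_zero hh) hyy)
  · have hz' := mem_nbrs.1 (Finset.mem_coe.1 hz)
    have hzv : h • z ∈ Γ.meshVerts h := ⟨z, mem_verts_of_adj hz'.symm, rfl⟩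
    have h1 : h⁻¹ • h • z = z := inv_smul_smul₀ hh z
    refine ⟨⟨h • z, hzv⟩, ?_, h1⟩
    change Γ.graph.Adj (h⁻¹ • (x : Fin d → ℝ)) (h⁻¹ • h • z)
    rwa [h1]

variable {Y : Type*} [NormedAddCommGroup Y] [InnerProductSpace ℝ Y] {T : (Fin d → ℝ) →ₗ[ℝ] Y}

theorem ell2Norm_eq {h : ℝ} (hh : h ≠ 0) {k : ℕ} {E : Matrix (Fin k) (Fin d) ℝ}
    (hT : ∀ x, ‖T x‖ = gramNorm E x) (u : Γ.meshVerts h → ℝ) {Q : Finset (Fin d → ℝ)} {r₀ r : ℝ}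
    (hQ : ∀ z, z ∈ Q ↔ z ∈ Γ.verts ∧ ‖h • T z‖ ≤ r₀) (hr : r ≤ r₀) :
    ell2Norm Γ h u (gramBall E r) =
      √(Stencil.ballMass T.toAddMonoidHom h (pull h u) Q r) := by
  rw [ell2Norm, Stencil.ballMass, ← Finset.sum_filter, ← finsum_mem_coe_finset]
  congr 1
  refine finsum_mem_eq_of_bijOn (fun y => h⁻¹ • (y : Fin d → ℝ)) ⟨fun y hy => ?_,
    fun y _ y' _ hyy => ?_, fun z hz => ?_⟩ fun y _ => by rw [pull_inv_smul hh, sq_abs]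
  · have h1 : h • T (h⁻¹ • (y : Fin d → ℝ)) = T y := by rw [← map_smul, smul_inv_smul₀ hh]
    have h2 : ‖h • T (h⁻¹ • (y : Fin d → ℝ))‖ ≤ r := by rw [h1, hT]; exact hy
    refine Finset.mem_coe.2 (Finset.mem_filter.2 ⟨(hQ _).2 ⟨?_, h2.trans hr⟩, h2⟩)
    obtain ⟨z, hz, hzy⟩ := y.2
    change h⁻¹ • (y : Fin d → ℝ) ∈ Γ.verts
    rw [← hzy]
    change h⁻¹ • h • z ∈ Γ.verts
    rwa [inv_smul_smul₀ hh]
  · exact Subtype.ext (smul_right_injective _ (inv_ne_zero hh) hyy)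
  · obtain ⟨hzQ, hz⟩ := Finset.mem_filter.1 (Finset.mem_coe.1 hz)
    refine ⟨⟨h • z, z, ((hQ z).1 hzQ).1, rfl⟩, ?_, inv_smul_smul₀ hh z⟩
    change gramNorm E (h • z) ≤ r
    rw [← hT, map_smul]
    exact hz

theorem IsStar.exists_ell2Norm_three_balls [NeZero s] (hΓ : Γ.IsStar)
    {k : ℕ} (E : Matrix (Fin k) (Fin d) ℝ)
    (hE : Submodule.span ℝ (Set.range fun j => E j) = ⊤) (M : ℝ) :
    ∃ C c ε : ℝ, 0 < C ∧ 0 < c ∧ 0 < ε ∧ ε ≤ 1 ∧ ∀ h : ℝ, 0 < h → h ≤ ε →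
      ∀ V : Γ.meshVerts h → ℝ, (∀ x, |V x| ≤ M) → ∀ u : Γ.meshVerts h → ℝ,
        (∀ x : Γ.meshVerts h, (x : Fin d → ℝ) ∈ gramBall E 4 → Γ.schrodinger h V u x = 0) →
        ell2Norm Γ h u (gramBall E 1) ≤ ell2Norm Γ h u (gramBall E 2) ∧
        ∀ τ : ℝ, τ * h ≤ ε → 1 ≤ ε * τ → ell2Norm Γ h u (gramBall E 1) ≤
          C * (Real.exp τ * ell2Norm Γ h u (gramBall E (1 / 2)) +
            Real.exp (-(c * τ)) * ell2Norm Γ h u (gramBall E 2)) := by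
  classical
  set T := gramMap E with hTdef
  have hT := norm_gramMap hE
  have hTi := gramMap_injective hE
  -- The extension of `V` by zero is bounded by |M| whatever the sign of `M`.
  obtain ⟨C, c, ε, hC, hc, hε, hε1, key⟩ := hΓ.exists_ballMass_three_balls hTi |M|
  refine ⟨√C, c, ε, Real.sqrt_pos.2 hC, hc, hε, hε1, ?_⟩
  intro h hh hhε V hV u hu
  have hfin := finite_verts_ball (Γ := Γ) hTi hh 4
  set Q := hfin.toFinset with hQdef
  have hQ : ∀ z, z ∈ Q ↔ z ∈ Γ.verts ∧ ‖h • T z‖ ≤ 4 := fun z => by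
    rw [hQdef, Set.Finite.mem_toFinset]; rfl
  have hnorm : ∀ r ≤ 4, ell2Norm Γ h u (gramBall E r) =
      √(Stencil.ballMass T.toAddMonoidHom h (pull h u) Q r) := fun r hr =>
    ell2Norm_eq hh.ne' hT u hQ hr
  rw [hnorm 1 (by norm_num), hnorm 2 (by norm_num), hnorm (1 / 2) (by norm_num)]
  refine ⟨Real.sqrt_le_sqrt (Finset.sum_le_sum fun z _ => ?_), fun τ hτh hτ => ?_⟩
  · split_ifs with h1 h2
    · exact le_rfl
    · exact absurd (h1.trans one_le_two) h2
    · exact sq_nonneg _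
    · exact le_rfl
  have hVp : ∀ z, |pull h V z| ≤ |M| := fun z => by
    rw [pull]
    split_ifs
    · exact (hV _).trans (le_abs_self M)
    · rw [abs_zero]; exact abs_nonneg M
  have hUp : ∀ z ∈ Q, ∑ y ∈ Γ.nbrs z, (pull h u y - pull h u z) =
      -(h ^ 2 * pull h V z * pull h u z) := fun z hz => by
    obtain ⟨hzv, hz4⟩ := (hQ z).1 hz
    set x : Γ.meshVerts h := ⟨h • z, z, hzv, rfl⟩ with hx
    have hxz : h⁻¹ • (x : Fin d → ℝ) = z := inv_smul_smul₀ hh.ne' z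
    have h1 := laplacian_eq hh.ne' u x
    have h2 := pull_inv_smul hh.ne' u x
    have h3 := pull_inv_smul hh.ne' V x
    rw [hxz] at h1 h2 h3
    have h4 := hu x (by
      change gramNorm E (h • z) ≤ 4
      rw [← hT, map_smul]; exact hz4)
    rw [schrodinger, h1, ← h3, ← h2] at h4
    have h5 : h ^ 2 ≠ 0 := pow_ne_zero 2 hh.ne'
    have h6 := congrArg (fun t => h ^ 2 * t) h4
    simp only [mul_add, mul_inv_cancel_left₀ h5, mul_zero] at h6
    linarith
  have h1 := key h τ hh hhε hτh hτ (pull h u) (pull h V) Q hVp hQ hUp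
  set a := Stencil.ballMass T.toAddMonoidHom h (pull h u) Q (1 / 2)
  set b := Stencil.ballMass T.toAddMonoidHom h (pull h u) Q 2
  have ha : 0 ≤ a := Stencil.ballMass_nonneg _ _ _ _ _
  have hb : 0 ≤ b := Stencil.ballMass_nonneg _ _ _ _ _
  refine Real.sqrt_le_iff.2 ⟨by positivity, h1.trans ?_⟩
  rw [mul_pow, Real.sq_sqrt hC.le]
  refine mul_le_mul_of_nonneg_left ?_ hC.le
  have e1 : Real.exp (2 * τ) = Real.exp τ ^ 2 := by rw [← Real.exp_nat_mul]; norm_num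
  have e2 : Real.exp (-(2 * c * τ)) = Real.exp (-(c * τ)) ^ 2 := by
    rw [← Real.exp_nat_mul]; congr 1; push_cast; ring
  -- Taking the root term by term only adds this nonnegative cross term to the square of the right
  -- side.
  have hcross : 0 ≤ Real.exp τ * √a * (Real.exp (-(c * τ)) * √b) := by positivity
  rw [e1, e2, add_sq, mul_pow, mul_pow, Real.sq_sqrt ha, Real.sq_sqrt hb]
  linarith

end PeriodicGraph

/-! ### Optimisation in the parameter and conclusion. -/

/-- Optimising the free parameter in a three balls inequality gives a Hölder type inequality. -/
theorem exists_holder_of_forall_exp {C c ε : ℝ} (hC : 0 < C) (hc : 0 < c) (hε : 0 < ε) :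
    ∃ D : ℝ, 1 < D ∧ ∀ h a b n : ℝ, 0 < h → h ≤ ε ^ 2 → 0 ≤ a → 0 ≤ b → n ≤ b →
      (∀ τ : ℝ, τ * h ≤ ε → 1 ≤ ε * τ → n ≤ C * (Real.exp τ * a + Real.exp (-(c * τ)) * b)) →
      n ≤ D * (a ^ (c / (1 + c)) * b ^ (1 - c / (1 + c)) + Real.exp (-(c * ε * h⁻¹)) * b) := by
  refine ⟨2 * C + Real.exp (c / ε) + 1, by
    have := Real.exp_pos (c / ε)
    linarith, ?_⟩
  intro h a b n hh hhε ha hb hnb key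
  set D := 2 * C + Real.exp (c / ε) + 1 with hD
  have hDpos := Real.exp_pos (c / ε)
  set P := a ^ (c / (1 + c)) * b ^ (1 - c / (1 + c)) with hP
  have hP0 : 0 ≤ P := by positivity
  set q := Real.exp (-(c * ε * h⁻¹)) * b with hq
  have hq0 : 0 ≤ q := by positivity
  suffices hs : n ≤ 2 * C * q ∨ n ≤ Real.exp (c / ε) * P ∨ n ≤ 2 * C * P by
    have p1 : 0 ≤ 2 * C * q := by positivity
    have p2 : 0 ≤ 2 * C * P := by positivity
    have p3 : 0 ≤ Real.exp (c / ε) * q := by positivity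
    have p4 : 0 ≤ Real.exp (c / ε) * P := by positivity
    rw [hD]
    rcases hs with hs | hs | hs <;> nlinarith
  have hτ0 : ε * h⁻¹ * h ≤ ε := by rw [inv_mul_cancel_right₀ hh.ne']
  have hτ1 : 1 ≤ ε * (ε * h⁻¹) := by
    rw [← mul_assoc, ← sq, ← div_eq_mul_inv, le_div_iff₀ hh, one_mul]; exact hhε
  have hlast := key (ε * h⁻¹) hτ0 hτ1
  rw [← mul_assoc c ε, ← hq] at hlast
  -- The cases b = 0 and a = 0 are separated because logarithms are taken afterwards.
  rcases hb.eq_or_lt with rfl | hb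
  · left; exact hnb.trans (by positivity)
  rcases ha.eq_or_lt with rfl | ha
  · left
    rw [mul_zero, zero_add] at hlast
    nlinarith [mul_nonneg hC.le hq0]
  obtain ⟨A, rfl⟩ : ∃ A, Real.exp A = a := ⟨Real.log a, Real.exp_log ha⟩
  obtain ⟨B, rfl⟩ : ∃ B, Real.exp B = b := ⟨Real.log b, Real.exp_log hb⟩
  have hc1 : 0 < 1 + c := by linarith
  have hPe : P = Real.exp ((B + c * A) / (1 + c)) := by
    rw [hP, ← Real.exp_mul, ← Real.exp_mul, ← Real.exp_add]
    congr 1; field_simp; ring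
  -- At τ = t the terms exp(τ) a and exp(-c τ) b are equal, with common value `P`. The admissible
  -- range is from ε⁻¹ to ε h⁻¹. If `t` lies above it, the endpoint ε h⁻¹ gives the bound by `q`. If
  -- `t` lies below it, n ≤ b = exp(c t) P suffices.
  set t := (B - A) / (1 + c) with ht
  have htm : (1 + c) * t = B - A := by rw [ht]; field_simp
  rcases le_or_gt (ε * h⁻¹) t with h1 | h1
  · left
    have : Real.exp (ε * h⁻¹) * Real.exp A ≤ q := by
      rw [hq, ← Real.exp_add, ← Real.exp_add, Real.exp_le_exp]
      nlinarith
    nlinarith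
  rcases le_or_gt t ε⁻¹ with h2 | h2
  · right; left
    refine hnb.trans ?_
    rw [hPe, ← Real.exp_add, Real.exp_le_exp]
    have h3 : (B + c * A) / (1 + c) = B - c * t := by rw [ht]; field_simp; ring
    rw [h3, div_eq_mul_inv]
    nlinarith
  · right; right
    have h3 := key t (by
      have := mul_le_mul_of_nonneg_right h1.le hh.le
      linarith) (by
      have := mul_le_mul_of_nonneg_left h2.le hε.le
      rwa [mul_inv_cancel₀ hε.ne'] at this)
    have e1 : t + A = (B + c * A) / (1 + c) := by rw [ht]; field_simp; ring
    have e2 : -(c * t) + B = (B + c * A) / (1 + c) := by rw [ht]; field_simp; ring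
    rw [← Real.exp_add, ← Real.exp_add, e1, e2, ← hPe] at h3
    linarith

theorem theorem5p3 {d s : ℕ} [NeZero s] (Γ : PeriodicGraph d s) (hΓ : Γ.IsStar)
    {k : ℕ} (E : Matrix (Fin k) (Fin d) ℝ)
    (hE : Submodule.span ℝ (Set.range fun j => E j) = ⊤) (M : ℝ) :
    (∃ h₀ δ₀ c₁ c₂ τ₀ C : ℝ, h₀ ∈ Set.Ioo 0 1 ∧ δ₀ ∈ Set.Ioo 0 1 ∧ 0 < c₁ ∧ 0 < c₂ ∧ 1 < τ₀ ∧
      0 < C ∧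
      ∀ h ∈ Set.Ioo 0 h₀, ∀ τ ∈ Set.Ioo τ₀ (δ₀ * h⁻¹),
      ∀ V : Γ.meshVerts h → ℝ, (∀ x, |V x| ≤ M) →
      ∀ u : Γ.meshVerts h → ℝ,
        (∀ x : Γ.meshVerts h, (x : Fin d → ℝ) ∈ gramBall E 4 → Γ.schrodinger h V u x = 0) →
        ell2Norm Γ h u (gramBall E 1) ≤
          C * (Real.exp (c₁ * τ) * ell2Norm Γ h u (gramBall E (1 / 2)) +
            Real.exp (-(c₂ * τ)) * ell2Norm Γ h u (gramBall E 2))) ∧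
    (∃ α c₀ h₀ D : ℝ, α ∈ Set.Ioo 0 1 ∧ 0 < c₀ ∧ h₀ ∈ Set.Ioo 0 1 ∧ 1 < D ∧
      ∀ h ∈ Set.Ioo 0 h₀,
      ∀ V : Γ.meshVerts h → ℝ, (∀ x, |V x| ≤ M) →
      ∀ u : Γ.meshVerts h → ℝ,
        (∀ x : Γ.meshVerts h, (x : Fin d → ℝ) ∈ gramBall E 4 → Γ.schrodinger h V u x = 0) →
        ell2Norm Γ h u (gramBall E 1) ≤
          D * (ell2Norm Γ h u (gramBall E (1 / 2)) ^ α * ell2Norm Γ h u (gramBall E 2) ^ (1 - α) +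
            Real.exp (-(c₀ * h⁻¹)) * ell2Norm Γ h u (gramBall E 2))) := by
  obtain ⟨C, c, ε, hC, hc, hε, hε1, key⟩ := hΓ.exists_ell2Norm_three_balls E hE M
  constructor
  · have hδ : min ε (1 / 2) ∈ Set.Ioo (0 : ℝ) 1 :=
      ⟨by positivity, (min_le_right _ _).trans_lt (by norm_num)⟩
    -- The threshold ε⁻¹ + 1 exceeds 1 and forces 1 ≤ ε τ; the bound τ < δ₀ h⁻¹ gives τ h ≤ ε.
    refine ⟨min ε (1 / 2), min ε (1 / 2), 1, c, ε⁻¹ + 1, C, hδ, hδ, one_pos, hc,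
      by linarith [inv_pos.2 hε], hC, ?_⟩
    intro h hh τ hτ V hV u hu
    rw [one_mul]
    refine (key h hh.1 (hh.2.le.trans (min_le_left _ _)) V hV u hu).2 τ ?_ ?_
    · have := mul_le_mul_of_nonneg_right hτ.2.le hh.1.le
      rw [inv_mul_cancel_right₀ hh.1.ne'] at this
      exact this.trans (min_le_left _ _)
    · have := mul_le_mul_of_nonneg_left hτ.1.le hε.le
      rw [mul_add, mul_inv_cancel₀ hε.ne'] at this
      linarith
  · obtain ⟨D, hD, hol⟩ := exists_holder_of_forall_exp hC hc hε
    refine ⟨c / (1 + c), c * ε, min (ε ^ 2) (1 / 2), D,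
      ⟨by positivity, (div_lt_one (by linarith)).2 (by linarith)⟩, by positivity,
      ⟨by positivity, (min_le_right _ _).trans_lt (by norm_num)⟩, hD, ?_⟩
    intro h hh V hV u hu
    -- This makes the range ε⁻¹ ≤ τ ≤ ε h⁻¹ nonempty.
    have hh2 : h ≤ ε ^ 2 := hh.2.le.trans (min_le_left _ _)
    obtain ⟨h12, h3⟩ := key h hh.1 (hh2.trans (by nlinarith)) V hV u hu
    exact hol h _ _ _ hh.1 hh2 (Real.sqrt_nonneg _) (Real.sqrt_nonneg _) h12 h3
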